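/- Let $\mathbb H$ be the quaternions, $\mathbb B=\{p\in\mathbb H:|p|<1\}$, $N,\kappa\in\mathbb N_0$, and let $J\in\mathbb H^{N\times N}$ be a signature matrix ($J=J^*$, $J^2=I_N$). Let $\mathcal V\subseteq\mathbb B$ be an open neighborhood of the origin and let $\varphi:\mathcal V\to\mathbb H^{N\times N}$ be (left) slice hyperholomorphic, i.e. each entry $f$ of $\varphi$ is real differentiable and satisfies $(\partial_x+I\partial_y)f(x+Iy)=0$ for every $I\in\mathbb H$ with $I^2=-1$. We say that $\varphi\in\mathscr C_\kappa(J)$ (on $\mathcal V$) if the Hermitian kernel $$k_\varphi(p,q)=\sum_{\ell=0}^\infty p^\ell\bigl(\varphi(p)J+J\varphi(q)^*\bigr)\overline q^{\,\ell},\qquad p,q\in\mathcal V,$$ has $\kappa$ negative squares in $\mathcal V$: for all $n$, $z_1,\dots,z_n\in\mathcal V$, $c_1,\dots,c_n\in\mathbb H^N$ the Hermitian matrix $\bigl(c_\ell^*k_\varphi(z_\ell,z_j)c_j\bigr)_{\ell,j=1}^n$ has at most $\kappa$ strictly negative eigenvalues (counted with multiplicity), and exactly $\kappa$ for some choice of $n,z_j,c_j$.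 A right quaternionic Pontryagin space of index $\kappa$ is a right $\mathbb H$-vector space $\mathscr P$ with a Hermitian form satisfying $[va,wb]=\overline b[v,w]a$ and a direct orthogonal decomposition $\mathscr P=\mathscr P_++\mathscr P_-$ such that $(\mathscr P_+,[\cdot,\cdot])$ and $(\mathscr P_-,-[\cdot,\cdot])$ are Hilbert spaces and $\dim\mathscr P_-=\kappa$; boundedness of operators refers to the Hilbert norm given by such a decomposition, and adjoints are taken with respect to $[\cdot,\cdot]$ and, on $\mathbb H^N$, to $[x,y]=y^*x$. For a bounded operator $V$ on $\mathscr P$, a bounded operator $C:\mathscr P\to\mathbb H^N$, and $p\in\mathbb H$ such that $|p|^2V^2-2\,\mathrm{Re}(p)V+I$ is invertible, put $$C\star(I-pV)^{-\star}=(C-\overline p\,CV)\bigl(|p|^2V^2-2\,\mathrm{Re}(p)V+I\bigr)^{-1}$$ (which is $\sum_{n\ge0}p^nCV^n$ for small $p$), and $$C\star(I+pV)\star(I-pV)^{-\star}=C\star(I-pV)^{-\star}+p\,\bigl(CV\star(I-pV)^{-\star}\bigr).$$ **Theorem.** $\varphi\in\mathscr C_\kappa(J)$ if and only if there are a right quaternionic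 Pontryagin space $\mathscr P$ of index $\kappa$, a bounded co-isometry $V$ on $\mathscr P$ ($VV^*=I$), and a bounded operator $C:\mathscr P\to\mathbb H^N$ such that the pair $(C,V)$ is observable ($\bigcap_{n\ge0}\ker CV^n=\{0\}$), and such that for every $p\in\mathcal V$ the operator $|p|^2V^2-2\,\mathrm{Re}(p)V+I$ is invertible and $$\varphi(p)=\tfrac12\,C\star(I+pV)\star(I-pV)^{-\star}C^*J+\tfrac12\bigl(\varphi(0)-J\varphi(0)^*J\bigr).$$ **Corollary.** If $J=I_N$ and $\varphi\in\mathscr C_0(I_N)$, then $\varphi$ has a slice hyperholomorphic extension to all of $\mathbb B$. -/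

import Mathlib

open MulOpposite Filter Topology
open scoped Quaternion Matrix

/-! Right quaternionic vector spaces are modules over `ℍ[ℝ]ᵐᵒᵖ`; thus `op a • v` is `v a`.
In particular `Fin N → ℍ[ℝ]` is the right vector space of quaternionic columns. -/

noncomputable section

/-- `f` is (left) slice hyperholomorphic in the open set `Ω`: it is real differentiable and
`(∂/∂x + I ∂/∂y) f (x + I y) = 0` for every imaginary unit `I`. -/
def SliceHyperholomorphicOn (f : ℍ[ℝ] → ℍ[ℝ]) (Ω : Set ℍ[ℝ]) : Prop :=
  DifferentiableOn ℝ f Ω ∧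
    ∀ I : ℍ[ℝ], I * I = -1 → ∀ x y : ℝ, (x : ℍ[ℝ]) + I * (y : ℍ[ℝ]) ∈ Ω →
      fderiv ℝ f ((x : ℍ[ℝ]) + I * (y : ℍ[ℝ])) 1
        + I * fderiv ℝ f ((x : ℍ[ℝ]) + I * (y : ℍ[ℝ])) I = 0

/-- A matrix-valued function is slice hyperholomorphic when all its entries are. -/
def MatrixSliceHyperholomorphicOn {N : ℕ} (φ : ℍ[ℝ] → Matrix (Fin N) (Fin N) ℍ[ℝ])
    (Ω : Set ℍ[ℝ]) : Prop :=
  ∀ i j, SliceHyperholomorphicOn (fun p => φ p i j) Ω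

/-- A signature matrix: self-adjoint and unitary. -/
def IsSignatureMatrix {N : ℕ} (J : Matrix (Fin N) (Fin N) ℍ[ℝ]) : Prop :=
  Jᴴ = J ∧ J * J = 1

/-! ### Negative squares -/

/-- The right subspace `{v : A v = v t}` of eigenvectors for the real number `t`. -/
def realEigenspace {n : ℕ} (A : Matrix (Fin n) (Fin n) ℍ[ℝ]) (t : ℝ) :
    Submodule ℍ[ℝ]ᵐᵒᵖ (Fin n → ℍ[ℝ]) where
  carrier := {v | A *ᵥ v = op (t : ℍ[ℝ]) • v}
  add_mem' := by
    intro v w hv hw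
    simp only [Set.mem_ofPred_eq] at hv hw ⊢
    rw [Matrix.mulVec_add, hv, hw, smul_add]
  zero_mem' := by simp
  smul_mem' := by
    intro a v hv
    simp only [Set.mem_ofPred_eq] at hv ⊢
    rw [Matrix.mulVec_smul, hv, smul_smul, smul_smul]
    congr 1
    rw [← op_unop a, ← op_mul, ← op_mul, Quaternion.coe_commutes]

/-- The number of strictly negative eigenvalues, counted with multiplicity, of a Hermitian
quaternionic matrix (whose right eigenvalues are all real): the dimension of the (direct) sum of
the eigenspaces for the negative eigenvalues. -/
def negEigenvalueCount {n : ℕ} (A : Matrix (Fin n) (Fin n) ℍ[ℝ]) : ℕ :=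
  Module.finrank ℍ[ℝ]ᵐᵒᵖ
    (⨆ t : {t : ℝ // t < 0}, realEigenspace A t : Submodule ℍ[ℝ]ᵐᵒᵖ (Fin n → ℍ[ℝ]))

/-- The matrix with `(l, j)` entry `c_l^* K(z_l, z_j) c_j`. -/
def kernelGram {N n : ℕ} (K : ℍ[ℝ] → ℍ[ℝ] → Matrix (Fin N) (Fin N) ℍ[ℝ])
    (z : Fin n → ℍ[ℝ]) (c : Fin n → Fin N → ℍ[ℝ]) : Matrix (Fin n) (Fin n) ℍ[ℝ] :=
  Matrix.of fun l j => star (c l) ⬝ᵥ (K (z l) (z j) *ᵥ c j)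

/-- The kernel `K` has (exactly) `κ` negative squares in `Ω`. -/
def HasNegativeSquares {N : ℕ} (K : ℍ[ℝ] → ℍ[ℝ] → Matrix (Fin N) (Fin N) ℍ[ℝ])
    (Ω : Set ℍ[ℝ]) (κ : ℕ) : Prop :=
  (∀ z ∈ Ω, ∀ w ∈ Ω, K z w = (K w z)ᴴ) ∧
  (∀ (n : ℕ) (z : Fin n → ℍ[ℝ]) (c : Fin n → Fin N → ℍ[ℝ]), (∀ l, z l ∈ Ω) →
    negEigenvalueCount (kernelGram K z c) ≤ κ) ∧
  (∃ (n : ℕ) (z : Fin n → ℍ[ℝ]) (c : Fin n → Fin N → ℍ[ℝ]), (∀ l, z l ∈ Ω) ∧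
    negEigenvalueCount (kernelGram K z c) = κ)

/-! ### Generalized Carathéodory functions -/

/-- The kernel `∑ p^ℓ (φ(p) J + J φ(q)^*) q̄^ℓ`; the series is taken entrywise and converges
absolutely when `|p| |q| < 1`. -/
def caratheodoryKernel {N : ℕ} (J : Matrix (Fin N) (Fin N) ℍ[ℝ])
    (φ : ℍ[ℝ] → Matrix (Fin N) (Fin N) ℍ[ℝ]) (p q : ℍ[ℝ]) : Matrix (Fin N) (Fin N) ℍ[ℝ] :=
  Matrix.of fun i j => ∑' l : ℕ, p ^ l * (φ p * J + J * (φ q)ᴴ) i j * star q ^ l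

/-- The class `C_κ(J)` of functions in the neighbourhood `𝒱` of the origin. -/
def GeneralizedCaratheodory {N : ℕ} (κ : ℕ) (J : Matrix (Fin N) (Fin N) ℍ[ℝ]) (𝒱 : Set ℍ[ℝ])
    (φ : ℍ[ℝ] → Matrix (Fin N) (Fin N) ℍ[ℝ]) : Prop :=
  MatrixSliceHyperholomorphicOn φ 𝒱 ∧ HasNegativeSquares (caratheodoryKernel J φ) 𝒱 κ

/-! ### Quaternionic Pontryagin spaces -/

section Pontryagin

variable {P : Type*} [AddCommGroup P] [Module ℍ[ℝ]ᵐᵒᵖ P]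

/-- A Hermitian form: `[va, wb] = b̄ [v, w] a`, additive, and `[w, v]` is the conjugate of
`[v, w]`. -/
structure IsHermitianForm (B : P → P → ℍ[ℝ]) : Prop where
  add_left : ∀ u v w, B (u + v) w = B u w + B v w
  smul_left : ∀ (a : ℍ[ℝ]) (v w : P), B (op a • v) w = B v w * a
  star_eq : ∀ v w, star (B v w) = B w v

/-- The subspace `M` with the form `B` is a Hilbert space: positive definite and complete. -/
structure IsHilbertOn (B : P → P → ℍ[ℝ]) (M : Submodule ℍ[ℝ]ᵐᵒᵖ P) : Prop where
  pos : ∀ v ∈ M, v ≠ 0 → 0 < (B v v).re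
  complete : ∀ u : ℕ → P, (∀ n, u n ∈ M) →
    (∀ ε > 0, ∃ n₀, ∀ m ≥ n₀, ∀ n ≥ n₀, (B (u m - u n) (u m - u n)).re < ε) →
    ∃ v ∈ M, Tendsto (fun n => (B (u n - v) (u n - v)).re) atTop (𝓝 0)

/-- `P = Pp + Pm` is a fundamental decomposition. -/
structure IsFundamentalDecomposition (B : P → P → ℍ[ℝ]) (Pp Pm : Submodule ℍ[ℝ]ᵐᵒᵖ P) :
    Prop where
  isCompl : IsCompl Pp Pm
  orthogonal : ∀ v ∈ Pp, ∀ w ∈ Pm, B v w = 0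
  hilbert_pos : IsHilbertOn B Pp
  hilbert_neg : IsHilbertOn (fun v w => -B v w) Pm
  finite_neg : Module.Finite ℍ[ℝ]ᵐᵒᵖ Pm

/-- `P` with the form `B` is a right quaternionic Pontryagin space of index `κ`. -/
structure IsPontryaginSpace (B : P → P → ℍ[ℝ]) (κ : ℕ) : Prop where
  hermitian : IsHermitianForm B
  decomposition : ∃ Pp Pm : Submodule ℍ[ℝ]ᵐᵒᵖ P, IsFundamentalDecomposition B Pp Pm ∧
    Module.finrank ℍ[ℝ]ᵐᵒᵖ Pm = κ

/-- The squared Hilbert norm `[v₊, v₊] - [v₋, v₋]` of a fundamental decomposition. -/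
def fundamentalNormSq {B : P → P → ℍ[ℝ]} {Pp Pm : Submodule ℍ[ℝ]ᵐᵒᵖ P}
    (h : IsFundamentalDecomposition B Pp Pm) (v : P) : ℝ :=
  (B (Pp.projectionOnto Pm h.isCompl v) (Pp.projectionOnto Pm h.isCompl v)).re
    - (B (Pm.projectionOnto Pp h.isCompl.symm v) (Pm.projectionOnto Pp h.isCompl.symm v)).re

/-- Boundedness of an operator of `P` (all fundamental decompositions give equivalent norms). -/
def IsBoundedEnd (B : P → P → ℍ[ℝ]) (V : Module.End ℍ[ℝ]ᵐᵒᵖ P) : Prop :=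
  ∃ (Pp Pm : Submodule ℍ[ℝ]ᵐᵒᵖ P) (h : IsFundamentalDecomposition B Pp Pm) (M : ℝ),
    ∀ v, fundamentalNormSq h (V v) ≤ M * fundamentalNormSq h v

/-- Boundedness of an operator from `P` to the columns with their Euclidean norm. -/
def IsBoundedToColumns {N : ℕ} (B : P → P → ℍ[ℝ]) (C : P →ₗ[ℍ[ℝ]ᵐᵒᵖ] (Fin N → ℍ[ℝ])) : Prop :=
  ∃ (Pp Pm : Submodule ℍ[ℝ]ᵐᵒᵖ P) (h : IsFundamentalDecomposition B Pp Pm) (M : ℝ),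
    ∀ v, ∑ i, ‖C v i‖ ^ 2 ≤ M * fundamentalNormSq h v

/-- `V'` is the adjoint of the operator `V` of `P`. -/
def IsAdjointEnd (B : P → P → ℍ[ℝ]) (V V' : Module.End ℍ[ℝ]ᵐᵒᵖ P) : Prop :=
  ∀ v w, B (V v) w = B v (V' w)

/-- `C'` is the adjoint of `C`, the columns carrying the form `[x, y] = y^* x`. -/
def IsAdjointToColumns {N : ℕ} (B : P → P → ℍ[ℝ]) (C : P →ₗ[ℍ[ℝ]ᵐᵒᵖ] (Fin N → ℍ[ℝ]))
    (C' : (Fin N → ℍ[ℝ]) →ₗ[ℍ[ℝ]ᵐᵒᵖ] P) : Prop :=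
  ∀ v h, star h ⬝ᵥ C v = B v (C' h)

/-- `V` is a co-isometry: it is bounded, and `V V^* = I`. -/
def IsCoisometry (B : P → P → ℍ[ℝ]) (V : Module.End ℍ[ℝ]ᵐᵒᵖ P) : Prop :=
  IsBoundedEnd B V ∧ ∃ V' : Module.End ℍ[ℝ]ᵐᵒᵖ P, IsAdjointEnd B V V' ∧ V * V' = 1

/-- The pair `(C, V)` is observable: the kernels of all `C V^n` have intersection `0`. -/
def IsObservable {N : ℕ} (C : P →ₗ[ℍ[ℝ]ᵐᵒᵖ] (Fin N → ℍ[ℝ])) (V : Module.End ℍ[ℝ]ᵐᵒᵖ P) : Prop :=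
  ∀ v : P, (∀ n : ℕ, C ((V ^ n) v) = 0) → v = 0

/-- Multiplication by a real number, a right linear operator. -/
def realScalar (t : ℝ) : Module.End ℍ[ℝ]ᵐᵒᵖ P where
  toFun v := op (t : ℍ[ℝ]) • v
  map_add' := smul_add _
  map_smul' := by
    intro a v
    rw [RingHom.id_apply, smul_smul, smul_smul]
    congr 1
    rw [← op_unop a, ← op_mul, ← op_mul, Quaternion.coe_commutes]

/-- The operator `|p|² V² - 2 Re(p) V + I`. -/
def spherePencil (V : Module.End ℍ[ℝ]ᵐᵒᵖ P) (p : ℍ[ℝ]) : Module.End ℍ[ℝ]ᵐᵒᵖ P :=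
  realScalar (‖p‖ ^ 2) * V ^ 2 - realScalar (2 * p.re) * V + 1

/-- `C ⋆ (I - pV)^{-⋆} = (C - p̄ C V) (|p|² V² - 2 Re(p) V + I)⁻¹`. It is meaningful when
`spherePencil V p` is invertible, and equals `∑ p^n C V^n` for small `p`. -/
def starResolvent {N : ℕ} (C : P →ₗ[ℍ[ℝ]ᵐᵒᵖ] (Fin N → ℍ[ℝ])) (V : Module.End ℍ[ℝ]ᵐᵒᵖ P)
    (p : ℍ[ℝ]) : P →ₗ[ℍ[ℝ]ᵐᵒᵖ] (Fin N → ℍ[ℝ]) :=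
  (C - star p • (C ∘ₗ V)) ∘ₗ (Ring.inverse (spherePencil V p) : Module.End ℍ[ℝ]ᵐᵒᵖ P)

/-- `C ⋆ (I + pV) ⋆ (I - pV)^{-⋆} = (C + p C V) ⋆ (I - pV)^{-⋆}`. -/
def starCayley {N : ℕ} (C : P →ₗ[ℍ[ℝ]ᵐᵒᵖ] (Fin N → ℍ[ℝ])) (V : Module.End ℍ[ℝ]ᵐᵒᵖ P)
    (p : ℍ[ℝ]) : P →ₗ[ℍ[ℝ]ᵐᵒᵖ] (Fin N → ℍ[ℝ]) :=
  starResolvent C V p + p • starResolvent (C ∘ₗ V) V p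

end Pontryagin

end

/-!
A function `φ` of the class `C_κ(J)` is realized on the reproducing kernel space of its kernel,
with the backward shift as the co-isometry and the evaluation at the origin as `C`.

*From the function to the realization.* Finite families of points and columns carry the Hermitian
form defined by the kernel; it has a maximal negative definite subspace, of dimension `κ`
(`hasNegativeSquares_iff` translates the eigenvalue count into this statement through the spectral
theorem for quaternionic Hermitian matrices). Changing the sign of the form on that subspace gives
an inner product, whose completion is a Pontryagin space (`IsFrame.exists_model`). The series of
the kernel solves the Stein equation `K(p,q) = p K(p,q) q̄ + φ(p)J + Jφ(q)^*`, and this says exactly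
that `k(q) q̄c ↦ k(q)c - k(0)c` preserves the form. An isometry with dense domain is bounded,
because the domain contains a maximal negative definite subspace, which is carried to another one;
the adjoint `V` of its extension is the backward shift (`exists_isShiftModel`).

The pencil `Q(p) = |p|² V² - 2 Re(p) V + I` is invertible at every `p ∈ 𝒱`, and this is the part
of the argument that is special to the quaternions. It is injective: a function `f` in its kernel
satisfies `(q² - 2 Re(p) q + |p|²) f(q) = |p|² (a + q b) - 2 Re(p) q a` with `a = f(0)` and
`b = (V f)(0)`; evaluation at `p` and at another point of the sphere of `p` gives `a = b = 0`, so
that `f` vanishes off the zeros of the quadratic polynomial, hence everywhere by continuity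
(`eq_zero_of_pencil`; a real `p` is a double zero instead). It is surjective: on a subspace of
finite codimension `V` is a contraction, so up to a finite rank perturbation `Q(p)` is invertible,
and an injective finite rank perturbation of an invertible operator is surjective
(`quadratic_surjective_of_injective`). Then the resolvent at `p` is the evaluation at `p`
(`IsShiftModel.starResolvent_eq_eval`), from which both the formula for `φ` and the observability
of the pair follow.

*From the realization to the function.* The resolvents `E(p) = C ⋆ (I - pV)^{-⋆}` satisfy
`E(p) = C + p E(p) V`. Together with `V V^* = I` and the formula for `φ`, this shows that
`E(p) E(q)^*` solves the Stein equation, so it is the kernel. The vectors `E(q)^* c` span a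
dense subspace by observability, so the kernel has as many negative squares as the space
(`IsPontryaginModel.hasNegativeSquares_of_realization`). Every Pontryagin space is made a Hilbert
space by one of its fundamental decompositions (`IsPontryaginSpace.of_model`); boundedness of `V`
and `C` then comes from the closed graph theorem, since they have adjoints.

*Extension to the ball.* For `κ = 0` the operator `V` is a contraction, so the coefficients of
`∑ pⁿ C Vⁿ` are bounded and the series converges in the whole ball, to a slice hyperholomorphic
function.
-/

noncomputable section

/-! ### Right vector spaces over the quaternions -/

/-- The quaternions, as a right vector space over themselves. -/
def quaternionRightEquiv : ℍ[ℝ]ᵐᵒᵖ ≃ₗ[ℍ[ℝ]ᵐᵒᵖ] ℍ[ℝ] where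
  toFun a := unop a
  invFun a := op a
  map_add' _ _ := rfl
  map_smul' _ _ := rfl
  left_inv _ := rfl
  right_inv _ := rfl

instance finite_quaternion_right : Module.Finite ℍ[ℝ]ᵐᵒᵖ ℍ[ℝ] :=
  Module.Finite.equiv quaternionRightEquiv

theorem finrank_quaternion_right : Module.finrank ℍ[ℝ]ᵐᵒᵖ ℍ[ℝ] = 1 := by
  rw [← quaternionRightEquiv.finrank_eq, Module.finrank_self]

theorem finrank_columns (n : ℕ) : Module.finrank ℍ[ℝ]ᵐᵒᵖ (Fin n → ℍ[ℝ]) = n := by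
  rw [Module.finrank_pi_fintype]
  simp [finrank_quaternion_right]

/-- The right linear combination `v ↦ ∑ i, u i * v i` of a finite family. -/
def rightComb {ι X : Type*} [Fintype ι] [AddCommGroup X] [Module ℍ[ℝ]ᵐᵒᵖ X] (u : ι → X) :
    (ι → ℍ[ℝ]) →ₗ[ℍ[ℝ]ᵐᵒᵖ] X where
  toFun v := ∑ i, op (v i) • u i
  map_add' v w := by simp [add_smul, Finset.sum_add_distrib]
  map_smul' a v := by
    simp only [Pi.smul_apply, RingHom.id_apply, Finset.smul_sum, smul_smul]
    rfl

theorem rightComb_apply {ι X : Type*} [Fintype ι] [AddCommGroup X] [Module ℍ[ℝ]ᵐᵒᵖ X] (u : ι → X)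
    (v : ι → ℍ[ℝ]) : rightComb u v = ∑ i, op (v i) • u i := rfl

theorem map_rightComb {ι X Y : Type*} [Fintype ι] [AddCommGroup X] [Module ℍ[ℝ]ᵐᵒᵖ X]
    [AddCommGroup Y] [Module ℍ[ℝ]ᵐᵒᵖ Y] (T : X →ₗ[ℍ[ℝ]ᵐᵒᵖ] Y) (u : ι → X) (v : ι → ℍ[ℝ]) :
    T (rightComb u v) = rightComb (fun i => T (u i)) v := by
  simp [rightComb_apply]

theorem eq_rightComb_single {N : ℕ} (d : Fin N → ℍ[ℝ]) :
    d = rightComb (fun j => (Pi.single j 1 : Fin N → ℍ[ℝ])) d := by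
  ext1 i
  rw [rightComb_apply, Finset.sum_apply, Finset.sum_eq_single i]
  · simp
  · intro j _ hj
    simp [hj.symm]
  · simp

/-- The real number `r` acts as the quaternion `r` does. -/
theorem op_coe_smul {X : Type*} [AddCommGroup X] [Module ℝ X] [Module ℍ[ℝ]ᵐᵒᵖ X]
    [IsScalarTower ℝ ℍ[ℝ]ᵐᵒᵖ X] (r : ℝ) (f : X) : op (r : ℍ[ℝ]) • f = r • f := by
  have : op (r : ℍ[ℝ]) = r • (1 : ℍ[ℝ]ᵐᵒᵖ) := by
    rw [← op_one, ← op_smul, ← mul_one (r : ℍ[ℝ]), Quaternion.coe_mul_eq_smul]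
  rw [this, smul_assoc, one_smul]

theorem quaternion_coe_sum {ι : Type*} (s : Finset ι) (f : ι → ℝ) :
    ((∑ i ∈ s, f i : ℝ) : ℍ[ℝ]) = ∑ i ∈ s, (f i : ℍ[ℝ]) :=
  map_sum (algebraMap ℝ ℍ[ℝ]) f s

theorem quaternion_re_sum {ι : Type*} (s : Finset ι) (f : ι → ℍ[ℝ]) :
    (∑ i ∈ s, f i).re = ∑ i ∈ s, (f i).re := by
  classical
  induction s using Finset.induction_on with
  | empty => simp
  | insert i s hi ih => rw [Finset.sum_insert hi, Finset.sum_insert hi, Quaternion.re_add, ih]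

/-! ### Hermitian forms -/

namespace IsHermitianForm

variable {X : Type*} [AddCommGroup X] [Module ℍ[ℝ]ᵐᵒᵖ X] {B : X → X → ℍ[ℝ]}

theorem add_right (hB : IsHermitianForm B) (u v w : X) : B u (v + w) = B u v + B u w := by
  rw [← hB.star_eq, hB.add_left, star_add, hB.star_eq, hB.star_eq]

theorem smul_right (hB : IsHermitianForm B) (a : ℍ[ℝ]) (v w : X) :
    B v (op a • w) = star a * B v w := by
  rw [← hB.star_eq, hB.smul_left, star_mul, hB.star_eq]

theorem zero_left (hB : IsHermitianForm B) (w : X) : B 0 w = 0 := by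
  have := hB.smul_left 0 0 w
  simpa using this

theorem zero_right (hB : IsHermitianForm B) (w : X) : B w 0 = 0 := by
  rw [← hB.star_eq, hB.zero_left, star_zero]

theorem neg_left (hB : IsHermitianForm B) (v w : X) : B (-v) w = -B v w := by
  have := hB.add_left (-v) v w
  rw [neg_add_cancel, hB.zero_left] at this
  exact eq_neg_of_add_eq_zero_left this.symm

theorem neg_right (hB : IsHermitianForm B) (v w : X) : B v (-w) = -B v w := by
  rw [← hB.star_eq, hB.neg_left, star_neg, hB.star_eq]

theorem sub_left (hB : IsHermitianForm B) (u v w : X) : B (u - v) w = B u w - B v w := by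
  rw [sub_eq_add_neg, hB.add_left, hB.neg_left, sub_eq_add_neg]

theorem sub_right (hB : IsHermitianForm B) (u v w : X) : B u (v - w) = B u v - B u w := by
  rw [sub_eq_add_neg, hB.add_right, hB.neg_right, sub_eq_add_neg]

theorem sum_left (hB : IsHermitianForm B) {ι : Type*} (s : Finset ι) (f : ι → X) (w : X) :
    B (∑ i ∈ s, f i) w = ∑ i ∈ s, B (f i) w := by
  classical
  induction s using Finset.induction_on with
  | empty => simp [hB.zero_left]
  | insert i s hi ih => rw [Finset.sum_insert hi, Finset.sum_insert hi, hB.add_left, ih]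

theorem sum_right (hB : IsHermitianForm B) {ι : Type*} (s : Finset ι) (f : ι → X) (w : X) :
    B w (∑ i ∈ s, f i) = ∑ i ∈ s, B w (f i) := by
  rw [← hB.star_eq, hB.sum_left, star_sum]
  simp [hB.star_eq]

theorem comb_left (hB : IsHermitianForm B) {ι : Type*} [Fintype ι] (u : ι → X) (v : ι → ℍ[ℝ])
    (w : X) : B (rightComb u v) w = ∑ i, B (u i) w * v i := by
  rw [rightComb_apply, hB.sum_left]
  simp [hB.smul_left]

theorem comb_right (hB : IsHermitianForm B) {ι : Type*} [Fintype ι] (u : ι → X) (v : ι → ℍ[ℝ])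
    (w : X) : B w (rightComb u v) = ∑ i, star (v i) * B w (u i) := by
  rw [rightComb_apply, hB.sum_right]
  simp [hB.smul_right]

/-- The values of the form on the diagonal are real. -/
theorem self_eq_coe (hB : IsHermitianForm B) (v : X) : B v v = ((B v v).re : ℍ[ℝ]) :=
  Quaternion.star_eq_self.mp (hB.star_eq v v)

theorem re_symm (hB : IsHermitianForm B) (v w : X) : (B v w).re = (B w v).re := by
  rw [← hB.star_eq, Quaternion.re_star]

variable [Module ℝ X] [IsScalarTower ℝ ℍ[ℝ]ᵐᵒᵖ X]

theorem real_smul_left (hB : IsHermitianForm B) (r : ℝ) (v w : X) :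
    B (r • v) w = r • B v w := by
  rw [← op_coe_smul, hB.smul_left, Quaternion.mul_coe_eq_smul]

theorem real_smul_right (hB : IsHermitianForm B) (r : ℝ) (v w : X) :
    B v (r • w) = r • B v w := by
  rw [← op_coe_smul, hB.smul_right, Quaternion.star_coe, Quaternion.coe_mul_eq_smul]

end IsHermitianForm

/-- A quaternion is determined by the real parts of its right multiples. -/
theorem quaternion_ext_re_mul {a b : ℍ[ℝ]} (h : ∀ c : ℍ[ℝ], (a * c).re = (b * c).re) :
    a = b := by
  have := h (star (a - b))
  rw [← sub_eq_zero, ← Quaternion.re_sub, ← sub_mul, Quaternion.self_mul_star,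
    Quaternion.re_coe, Quaternion.normSq_eq_zero, sub_eq_zero] at this
  exact this

theorem star_mul_self_eq (a : ℍ[ℝ]) : star a * a = ((‖a‖ ^ 2 : ℝ) : ℍ[ℝ]) := by
  rw [Quaternion.star_mul_self, Quaternion.normSq_eq_norm_mul_self, sq]

theorem self_mul_star_eq (a : ℍ[ℝ]) : a * star a = ((‖a‖ ^ 2 : ℝ) : ℍ[ℝ]) := by
  rw [Quaternion.self_mul_star, Quaternion.normSq_eq_norm_mul_self, sq]

theorem add_star_eq (a : ℍ[ℝ]) : a + star a = ((2 * a.re : ℝ) : ℍ[ℝ]) := by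
  rw [Quaternion.self_add_star, Quaternion.coe_mul]; rfl

/-- The family `u` spans a negative definite subspace, of dimension the size of the family. -/
def NegDefFamily {ι X : Type*} [Fintype ι] [AddCommGroup X] [Module ℍ[ℝ]ᵐᵒᵖ X]
    (B : X → X → ℍ[ℝ]) (u : ι → X) : Prop :=
  ∀ v : ι → ℍ[ℝ], v ≠ 0 → (B (rightComb u v) (rightComb u v)).re < 0

/-- The family `e` is orthonormal for the form `-B`. -/
def NegOrthonormal {ι X : Type*} [DecidableEq ι] (B : X → X → ℍ[ℝ]) (e : ι → X) : Prop :=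
  ∀ i j, B (e i) (e j) = if i = j then -1 else 0

section NegFamilies

variable {X : Type*} [AddCommGroup X] [Module ℍ[ℝ]ᵐᵒᵖ X] {B : X → X → ℍ[ℝ]}

theorem NegOrthonormal.comb_left {ι : Type*} [Fintype ι] [DecidableEq ι] {e : ι → X}
    (hB : IsHermitianForm B) (he : NegOrthonormal B e) (v : ι → ℍ[ℝ]) (j : ι) :
    B (rightComb e v) (e j) = -v j := by
  rw [hB.comb_left]
  simp [he _ j]

theorem NegOrthonormal.comb_self {ι : Type*} [Fintype ι] [DecidableEq ι] {e : ι → X}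
    (hB : IsHermitianForm B) (he : NegOrthonormal B e) (v : ι → ℍ[ℝ]) :
    (B (rightComb e v) (rightComb e v)).re = -∑ i, ‖v i‖ ^ 2 := by
  rw [hB.comb_right]
  simp only [he.comb_left hB, mul_neg, star_mul_self_eq, Finset.sum_neg_distrib,
    Quaternion.re_neg]
  congr 1
  rw [← quaternion_coe_sum]
  rfl

theorem sum_norm_sq_pos {ι : Type*} [Fintype ι] {v : ι → ℍ[ℝ]} (hv : v ≠ 0) :
    0 < ∑ i, ‖v i‖ ^ 2 := by
  obtain ⟨i, hi⟩ := Function.ne_iff.mp hv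
  exact Finset.sum_pos' (fun _ _ => by positivity)
    ⟨i, Finset.mem_univ _, by have := norm_pos_iff.mpr hi; positivity⟩

theorem NegOrthonormal.negDefFamily {ι : Type*} [Fintype ι] [DecidableEq ι] {e : ι → X}
    (hB : IsHermitianForm B) (he : NegOrthonormal B e) : NegDefFamily B e := by
  intro v hv
  rw [he.comb_self hB]
  have := sum_norm_sq_pos hv
  linarith

/-- More columns than conditions: a subspace of dimension `m > j` contains a nonzero vector
orthogonal to `j` given vectors. -/
theorem exists_comb_orthogonal (hB : IsHermitianForm B) {m j : ℕ} (hj : j < m) (u : Fin m → X)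
    (e : Fin j → X) : ∃ v : Fin m → ℍ[ℝ], v ≠ 0 ∧ ∀ i, B (rightComb u v) (e i) = 0 := by
  let T : (Fin m → ℍ[ℝ]) →ₗ[ℍ[ℝ]ᵐᵒᵖ] (Fin j → ℍ[ℝ]) :=
    { toFun := fun v i => B (rightComb u v) (e i)
      map_add' := fun v w => by ext1 i; simp [hB.add_left]
      map_smul' := fun a v => by
        ext1 i
        rw [map_smul, ← op_unop a, hB.smul_left]
        rfl }
  have hT : LinearMap.ker T ≠ ⊥ := LinearMap.ker_ne_bot_of_finrank_lt (by
    rw [finrank_columns, finrank_columns]; exact hj)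
  obtain ⟨v, hv, hv0⟩ := Submodule.exists_mem_ne_zero_of_ne_bot hT
  exact ⟨v, hv0, fun i => congrFun (LinearMap.mem_ker.mp hv) i⟩

/-- An orthonormal family for `-B` is extended by a negative vector orthogonal to it. -/
theorem NegOrthonormal.snoc (hB : IsHermitianForm B) {j : ℕ} {e : Fin j → X}
    (he : NegOrthonormal B e) {w : X} (hw : (B w w).re < 0) (hwe : ∀ i, B w (e i) = 0) :
    ∃ r : ℝ, NegOrthonormal B (Fin.snoc e (op (r : ℍ[ℝ]) • w) : Fin (j + 1) → X) := by
  obtain ⟨r, hr⟩ : ∃ r : ℝ, r * (B w w).re * r = -1 := by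
    refine ⟨(√(-(B w w).re))⁻¹, ?_⟩
    have hs : √(-(B w w).re) * √(-(B w w).re) = -(B w w).re :=
      Real.mul_self_sqrt (by linarith)
    have hs0 : √(-(B w w).re) ≠ 0 := (Real.sqrt_pos.mpr (by linarith)).ne'
    generalize √(-(B w w).re) = x at hs hs0
    field_simp
    linarith [sq x]
  refine ⟨r, ?_⟩
  have hew : ∀ i, B (e i) w = 0 := fun i => by rw [← hB.star_eq, hwe, star_zero]
  intro a b
  induction a using Fin.lastCases with
  | last =>
    induction b using Fin.lastCases with
    | last =>
      simp only [Fin.snoc_last, if_true, hB.smul_left, hB.smul_right]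
      rw [hB.self_eq_coe w, Quaternion.star_coe, ← Quaternion.coe_mul, ← Quaternion.coe_mul,
        ← Quaternion.coe_one, ← Quaternion.coe_neg]
      exact congrArg _ hr
    | cast b =>
      have : Fin.last j ≠ b.castSucc := (Fin.castSucc_lt_last b).ne'
      simp [hB.smul_left, hwe, this]
  | cast a =>
    induction b using Fin.lastCases with
    | last =>
      have : a.castSucc ≠ Fin.last j := (Fin.castSucc_lt_last a).ne
      simp [hB.smul_right, hew, this]
    | cast b => simp [he a b, Fin.castSucc_inj]

/-- Gram–Schmidt: a negative definite subspace has a basis that is orthonormal for `-B`. -/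
theorem NegDefFamily.exists_negOrthonormal (hB : IsHermitianForm B) {m : ℕ} {u : Fin m → X}
    (hu : NegDefFamily B u) :
    ∃ e : Fin m → X, NegOrthonormal B e ∧ ∀ i, e i ∈ LinearMap.range (rightComb u) := by
  suffices h : ∀ j ≤ m, ∃ e : Fin j → X, NegOrthonormal B e ∧
      ∀ i, e i ∈ LinearMap.range (rightComb u) from h m le_rfl
  intro j
  induction j with
  | zero => exact fun _ => ⟨Fin.elim0, fun i => i.elim0, fun i => i.elim0⟩
  | succ j ih =>
    intro hj
    obtain ⟨e, he, heu⟩ := ih (by omega)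
    obtain ⟨v, hv, hve⟩ := exists_comb_orthogonal hB hj u e
    obtain ⟨r, hr⟩ := he.snoc hB (hu v hv) hve
    refine ⟨_, hr, fun i => ?_⟩
    induction i using Fin.lastCases with
    | last => rw [Fin.snoc_last]; exact Submodule.smul_mem _ _ (LinearMap.mem_range_self _ v)
    | cast i => rw [Fin.snoc_castSucc]; exact heu i

/-- An orthonormal family for `-B` of the largest possible size has a nonnegative orthogonal
complement. -/
theorem NegOrthonormal.nonneg_of_maximal (hB : IsHermitianForm B) {κ : ℕ} {e : Fin κ → X}
    (he : NegOrthonormal B e)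
    (hmax : ∀ (m : ℕ) (u : Fin m → X), NegDefFamily B u → m ≤ κ) {f : X}
    (hf : ∀ i, B f (e i) = 0) : 0 ≤ (B f f).re := by
  by_contra! h
  -- a negative vector in the complement would extend the family
  obtain ⟨r, hr⟩ := he.snoc hB h hf
  have := hmax _ _ (hr.negDefFamily hB)
  omega

end NegFamilies

/-! ### Counting the negative eigenvalues of a Hermitian matrix -/

section Matrix

variable {n : ℕ} {A : Matrix (Fin n) (Fin n) ℍ[ℝ]}

/-- The Hermitian form `w^* A v` on columns. -/
def matrixForm (A : Matrix (Fin n) (Fin n) ℍ[ℝ]) (v w : Fin n → ℍ[ℝ]) : ℍ[ℝ] :=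
  star w ⬝ᵥ (A *ᵥ v)

theorem star_dotProduct_quaternion (v w : Fin n → ℍ[ℝ]) :
    star (star v ⬝ᵥ w) = star w ⬝ᵥ v := by
  simp [dotProduct, star_sum]

theorem dotProduct_op_smul (v w : Fin n → ℍ[ℝ]) (a : ℍ[ℝ]) :
    v ⬝ᵥ (op a • w) = (v ⬝ᵥ w) * a := by
  simp [dotProduct, Finset.sum_mul, mul_assoc]

theorem star_mulVec_dotProduct (A : Matrix (Fin n) (Fin n) ℍ[ℝ]) (v w : Fin n → ℍ[ℝ]) :
    star (A *ᵥ v) ⬝ᵥ w = star v ⬝ᵥ (Aᴴ *ᵥ w) := by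
  rw [Matrix.star_mulVec, ← Matrix.dotProduct_mulVec]

theorem isHermitianForm_matrixForm (hA : Aᴴ = A) : IsHermitianForm (matrixForm A) where
  add_left u v w := by simp [matrixForm, Matrix.mulVec_add]
  smul_left a v w := by
    rw [matrixForm, Matrix.mulVec_smul, dotProduct_op_smul]; rfl
  star_eq v w := by
    rw [matrixForm, star_dotProduct_quaternion, star_mulVec_dotProduct, hA]; rfl

theorem mem_realEigenspace {t : ℝ} {v : Fin n → ℍ[ℝ]} :
    v ∈ realEigenspace A t ↔ A *ᵥ v = op (t : ℍ[ℝ]) • v := Iff.rfl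

theorem star_dotProduct_self (v : Fin n → ℍ[ℝ]) :
    star v ⬝ᵥ v = ((∑ i, ‖v i‖ ^ 2 : ℝ) : ℍ[ℝ]) := by
  rw [quaternion_coe_sum]
  exact Finset.sum_congr rfl fun i _ => star_mul_self_eq (v i)

/-- Eigenvectors of a Hermitian matrix for distinct real eigenvalues are orthogonal. -/
theorem matrixForm_eigenvectors (hA : Aᴴ = A) {s t : ℝ} {v w : Fin n → ℍ[ℝ]}
    (hv : v ∈ realEigenspace A s) (hw : w ∈ realEigenspace A t) (hst : s ≠ t) :
    matrixForm A v w = 0 := by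
  have h1 : matrixForm A v w = (star w ⬝ᵥ v) * (s : ℍ[ℝ]) := by
    rw [matrixForm, mem_realEigenspace.mp hv, dotProduct_op_smul]
  have h2 : matrixForm A v w = (star w ⬝ᵥ v) * (t : ℍ[ℝ]) := by
    rw [← (isHermitianForm_matrixForm hA).star_eq, matrixForm, mem_realEigenspace.mp hw,
      dotProduct_op_smul, star_mul, star_dotProduct_quaternion, Quaternion.star_coe,
      Quaternion.coe_commutes]
  have h3 : (star w ⬝ᵥ v) * ((s - t : ℝ) : ℍ[ℝ]) = 0 := by
    rw [Quaternion.coe_sub, mul_sub, ← h1, ← h2, sub_self]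
  have h4 : ((s - t : ℝ) : ℍ[ℝ]) ≠ 0 := by
    rw [← Quaternion.coe_zero, Ne, Quaternion.coe_inj]; exact sub_ne_zero.mpr hst
  rw [h1, (mul_eq_zero.mp h3).resolve_right h4, zero_mul]

/-- The form of a Hermitian matrix on a sum of eigenspaces. -/
theorem matrixForm_of_mem_iSup (hA : Aᴴ = A) (S : Set ℝ) {v : Fin n → ℍ[ℝ]}
    (hv : v ∈ (⨆ t : S, realEigenspace A t : Submodule ℍ[ℝ]ᵐᵒᵖ (Fin n → ℍ[ℝ]))) :
    ∃ f : S →₀ (Fin n → ℍ[ℝ]), (∑ t ∈ f.support, f t = v) ∧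
      (matrixForm A v v).re = ∑ t ∈ f.support, (t : ℝ) * ∑ i, ‖f t i‖ ^ 2 := by
  obtain ⟨f, hf, rfl⟩ := (Submodule.mem_iSup_iff_exists_finsupp _ _).mp hv
  have hH := isHermitianForm_matrixForm hA
  refine ⟨f, rfl, ?_⟩
  rw [Finsupp.sum, hH.sum_left]
  have : ∀ s ∈ f.support, matrixForm A (f s) (∑ t ∈ f.support, f t)
      = (((s : ℝ) * ∑ i, ‖f s i‖ ^ 2 : ℝ) : ℍ[ℝ]) := by
    intro s hs
    rw [hH.sum_right, Finset.sum_eq_single s]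
    · rw [matrixForm, mem_realEigenspace.mp (hf s), dotProduct_op_smul, star_dotProduct_self,
        ← Quaternion.coe_mul, mul_comm]
    · intro t _ hts
      exact matrixForm_eigenvectors hA (hf s) (hf t) fun h => hts (Subtype.ext h.symm)
    · exact fun h => absurd hs h
  rw [Finset.sum_congr rfl this, ← quaternion_coe_sum]
  rfl

/-- A Hermitian matrix is negative definite on the sum of its negative eigenspaces. -/
theorem matrixForm_neg (hA : Aᴴ = A) {v : Fin n → ℍ[ℝ]} (hv0 : v ≠ 0)
    (hv : v ∈ (⨆ t : {t : ℝ // t < 0}, realEigenspace A t :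
      Submodule ℍ[ℝ]ᵐᵒᵖ (Fin n → ℍ[ℝ]))) : (matrixForm A v v).re < 0 := by
  obtain ⟨f, hf, hsum⟩ := matrixForm_of_mem_iSup hA {t : ℝ | t < 0} hv
  rw [hsum]
  refine Finset.sum_neg (fun t ht => ?_) ?_
  · exact mul_neg_of_neg_of_pos t.2 (sum_norm_sq_pos (Finsupp.mem_support_iff.mp ht))
  · by_contra h
    rw [Finset.not_nonempty_iff_eq_empty.mp h, Finset.sum_empty] at hf
    exact hv0 hf.symm

theorem matrixForm_nonneg (hA : Aᴴ = A) {v : Fin n → ℍ[ℝ]}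
    (hv : v ∈ (⨆ t : {t : ℝ // 0 ≤ t}, realEigenspace A t :
      Submodule ℍ[ℝ]ᵐᵒᵖ (Fin n → ℍ[ℝ]))) : 0 ≤ (matrixForm A v v).re := by
  obtain ⟨f, -, hsum⟩ := matrixForm_of_mem_iSup hA {t : ℝ | 0 ≤ t} hv
  rw [hsum]
  exact Finset.sum_nonneg fun t _ =>
    mul_nonneg t.2 (Finset.sum_nonneg fun i _ => by positivity)

/-- The spectral theorem for Hermitian quaternionic matrices, obtained from the one for real
symmetric operators: the eigenspaces for real eigenvalues span. -/
theorem iSup_realEigenspace (hA : Aᴴ = A) :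
    (⨆ t : ℝ, realEigenspace A t : Submodule ℍ[ℝ]ᵐᵒᵖ (Fin n → ℍ[ℝ])) = ⊤ := by
  let E := PiLp 2 fun _ : Fin n => ℍ[ℝ]
  let T : E →ₗ[ℝ] E :=
    { toFun := fun v => WithLp.toLp 2 (A *ᵥ v.ofLp)
      map_add' := fun v w => congrArg (WithLp.toLp 2) (Matrix.mulVec_add A v.ofLp w.ofLp)
      map_smul' := fun r v => congrArg (WithLp.toLp 2) (Matrix.mulVec_smul A r v.ofLp) }
  have hinner : ∀ v w : E, inner ℝ v w = (star w.ofLp ⬝ᵥ v.ofLp).re := by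
    intro v w
    rw [PiLp.inner_apply, dotProduct, quaternion_re_sum]
    refine Finset.sum_congr rfl fun i _ => ?_
    rw [real_inner_comm, Quaternion.inner_def, ← Quaternion.re_star]
    simp only [star_mul, star_star, Pi.star_apply, Quaternion.re_mul, Quaternion.re_star,
      Quaternion.imI_star, Quaternion.imJ_star, Quaternion.imK_star]
    ring
  have hT : T.IsSymmetric := by
    intro v w
    rw [hinner, hinner]
    congr 1
    change star w.ofLp ⬝ᵥ (A *ᵥ v.ofLp) = star (A *ᵥ w.ofLp) ⬝ᵥ v.ofLp
    rw [star_mulVec_dotProduct, hA]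
  have htop : (⨆ μ, Module.End.eigenspace T μ) = ⊤ := by
    rw [← Submodule.orthogonal_eq_bot_iff]
    exact hT.orthogonalComplement_iSup_eigenspaces_eq_bot
  rw [eq_top_iff]
  rintro v -
  have hv : WithLp.toLp 2 v ∈ (⨆ μ, Module.End.eigenspace T μ) := by rw [htop]; trivial
  refine Submodule.iSup_induction (Module.End.eigenspace T)
    (motive := fun x : E => x.ofLp ∈ (⨆ t : ℝ, realEigenspace A t :
      Submodule ℍ[ℝ]ᵐᵒᵖ (Fin n → ℍ[ℝ]))) hv ?_ ?_ ?_
  · intro t x hx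
    refine Submodule.mem_iSup_of_mem t (mem_realEigenspace.mpr ?_)
    rw [op_coe_smul]
    exact congrArg WithLp.ofLp (Module.End.mem_eigenspace_iff.mp hx)
  · exact Submodule.zero_mem _
  · exact fun x y hx hy => Submodule.add_mem _ hx hy

/-- A subspace on which a Hermitian matrix is negative definite has dimension at most the number
of negative eigenvalues. -/
theorem le_negEigenvalueCount (hA : Aᴴ = A) {s : ℕ}
    (L : (Fin s → ℍ[ℝ]) →ₗ[ℍ[ℝ]ᵐᵒᵖ] (Fin n → ℍ[ℝ]))
    (hL : ∀ v, v ≠ 0 → (matrixForm A (L v) (L v)).re < 0) : s ≤ negEigenvalueCount A := by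
  set Wn : Submodule ℍ[ℝ]ᵐᵒᵖ (Fin n → ℍ[ℝ]) := ⨆ t : {t : ℝ // t < 0}, realEigenspace A t
    with hWn
  set Wp : Submodule ℍ[ℝ]ᵐᵒᵖ (Fin n → ℍ[ℝ]) := ⨆ t : {t : ℝ // 0 ≤ t}, realEigenspace A t
    with hWp
  have htop : Wn ⊔ Wp = ⊤ := by
    rw [eq_top_iff, ← iSup_realEigenspace hA]
    refine iSup_le fun t => ?_
    rcases lt_or_ge t 0 with h | h
    · exact (le_iSup (fun t : {t : ℝ // t < 0} => realEigenspace A t) ⟨t, h⟩).trans le_sup_left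
    · exact (le_iSup (fun t : {t : ℝ // 0 ≤ t} => realEigenspace A t) ⟨t, h⟩).trans le_sup_right
  have hinj : Function.Injective L := by
    rw [← LinearMap.ker_eq_bot, LinearMap.ker_eq_bot']
    intro v hv
    by_contra h
    have := hL v h
    rw [hv, (isHermitianForm_matrixForm hA).zero_left] at this
    simp at this
  -- a dimension count against the sum of the nonnegative eigenspaces
  have hdisj : LinearMap.range L ⊓ Wp = ⊥ := by
    rw [eq_bot_iff]
    rintro x ⟨⟨v, rfl⟩, hx⟩
    by_contra h
    have h1 := hL v (by rintro rfl; exact h (by simp))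
    have h2 := matrixForm_nonneg hA hx
    linarith
  have e1 := Submodule.finrank_sup_add_finrank_inf_eq (LinearMap.range L) Wp
  have e2 := Submodule.finrank_add_le_finrank_add_finrank Wn Wp
  have e3 := Submodule.finrank_le (LinearMap.range L ⊔ Wp)
  rw [hdisj, finrank_bot, LinearMap.finrank_range_of_inj hinj, finrank_columns] at e1
  rw [htop, finrank_top] at e2
  have e4 : negEigenvalueCount A = Module.finrank ℍ[ℝ]ᵐᵒᵖ Wn := rfl
  omega

/-- Negative eigenvalues produce a negative definite subspace. -/
theorem exists_negDefFamily_matrixForm (hA : Aᴴ = A) :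
    ∃ w : Fin (negEigenvalueCount A) → (Fin n → ℍ[ℝ]), NegDefFamily (matrixForm A) w := by
  let W : Submodule ℍ[ℝ]ᵐᵒᵖ (Fin n → ℍ[ℝ]) := ⨆ t : {t : ℝ // t < 0}, realEigenspace A t
  let b : Module.Basis (Fin (negEigenvalueCount A)) ℍ[ℝ]ᵐᵒᵖ W := Module.finBasis _ _
  refine ⟨fun i => b i, fun v hv => ?_⟩
  have hW : rightComb (fun i => (b i : Fin n → ℍ[ℝ])) v = W.subtype (rightComb b v) := by
    rw [map_rightComb]; rfl
  refine matrixForm_neg hA ?_ (by rw [hW]; exact (rightComb b v).2)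
  rw [hW]
  intro h
  have h0 : ∑ i, op (v i) • b i = 0 := Subtype.ext h
  refine hv (funext fun i => ?_)
  exact op_injective (Fintype.linearIndependent_iff.mp b.linearIndependent _ h0 i)

end Matrix

/-! ### The form defined by a kernel on finitely supported columns -/

section KernelForm

variable {N : ℕ} {K : ℍ[ℝ] → ℍ[ℝ] → Matrix (Fin N) (Fin N) ℍ[ℝ]} {Ω : Set ℍ[ℝ]}

/-- The form `∑ g(p)^* K(p, q) f(q)` on finitely supported families of columns; the family
supported at `q` with value `c` stands for the function `K(·, q) c`. -/
def kernelForm (K : ℍ[ℝ] → ℍ[ℝ] → Matrix (Fin N) (Fin N) ℍ[ℝ]) (Ω : Set ℍ[ℝ])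
    (f g : Ω →₀ (Fin N → ℍ[ℝ])) : ℍ[ℝ] :=
  g.sum fun p d => f.sum fun q c => star d ⬝ᵥ (K p q *ᵥ c)

theorem kernelForm_single (p q : Ω) (c d : Fin N → ℍ[ℝ]) :
    kernelForm K Ω (Finsupp.single q c) (Finsupp.single p d) = star d ⬝ᵥ (K p q *ᵥ c) := by
  rw [kernelForm, Finsupp.sum_single_index, Finsupp.sum_single_index] <;> simp

theorem isHermitianForm_kernelForm (hK : ∀ z ∈ Ω, ∀ w ∈ Ω, K z w = (K w z)ᴴ) :
    IsHermitianForm (kernelForm K Ω) where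
  add_left u v w := by
    simp only [kernelForm]
    rw [← Finsupp.sum_add]
    refine Finsupp.sum_congr fun p _ => ?_
    rw [Finsupp.sum_add_index'] <;> simp [Matrix.mulVec_add]
  smul_left a v w := by
    simp only [kernelForm, Finsupp.sum, Finset.sum_mul]
    refine Finset.sum_congr rfl fun p _ => ?_
    rw [Finset.sum_subset (Finsupp.support_smul (b := op a) (g := v))]
    · refine Finset.sum_congr rfl fun q _ => ?_
      rw [Finsupp.smul_apply, Matrix.mulVec_smul, dotProduct_op_smul]
    · intro q _ hq
      rw [Finsupp.notMem_support_iff.mp hq]; simp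
  star_eq v w := by
    simp only [kernelForm, Finsupp.sum, star_sum]
    rw [Finset.sum_comm]
    refine Finset.sum_congr rfl fun p _ => Finset.sum_congr rfl fun q _ => ?_
    rw [star_dotProduct_quaternion, star_mulVec_dotProduct, ← hK p p.2 q q.2]

/-- The Gram matrices of the kernel are those of the form. -/
theorem kernelForm_rightComb (hK : ∀ z ∈ Ω, ∀ w ∈ Ω, K z w = (K w z)ᴴ) {n : ℕ}
    (z : Fin n → Ω) (c : Fin n → Fin N → ℍ[ℝ]) (v w : Fin n → ℍ[ℝ]) :
    kernelForm K Ω (rightComb (fun j => Finsupp.single (z j) (c j)) v)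
      (rightComb (fun j => Finsupp.single (z j) (c j)) w)
      = matrixForm (kernelGram K (fun j => z j) c) v w := by
  have hB := isHermitianForm_kernelForm hK
  rw [hB.comb_right, matrixForm, dotProduct]
  refine Finset.sum_congr rfl fun i _ => ?_
  rw [hB.comb_left]
  simp only [kernelForm_single]
  rfl

theorem kernelGram_conjTranspose (hK : ∀ z ∈ Ω, ∀ w ∈ Ω, K z w = (K w z)ᴴ) {n : ℕ}
    (z : Fin n → ℍ[ℝ]) (hz : ∀ l, z l ∈ Ω) (c : Fin n → Fin N → ℍ[ℝ]) :
    (kernelGram K z c)ᴴ = kernelGram K z c := by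
  ext1 i j
  rw [Matrix.conjTranspose_apply]
  simp only [kernelGram, Matrix.of_apply]
  rw [star_dotProduct_quaternion, star_mulVec_dotProduct, ← hK _ (hz i) _ (hz j)]

/-- Negative eigenvalues of a Gram matrix produce a negative definite family. -/
theorem exists_negDefFamily_kernelForm (hK : ∀ z ∈ Ω, ∀ w ∈ Ω, K z w = (K w z)ᴴ) {n : ℕ}
    (z : Fin n → ℍ[ℝ]) (hz : ∀ l, z l ∈ Ω) (c : Fin n → Fin N → ℍ[ℝ]) :
    ∃ u : Fin (negEigenvalueCount (kernelGram K z c)) → (Ω →₀ (Fin N → ℍ[ℝ])),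
      NegDefFamily (kernelForm K Ω) u := by
  obtain ⟨w, hw⟩ := exists_negDefFamily_matrixForm (kernelGram_conjTranspose hK z hz c)
  let δ : Fin n → (Ω →₀ (Fin N → ℍ[ℝ])) := fun j => Finsupp.single ⟨z j, hz j⟩ (c j)
  refine ⟨fun i => rightComb δ (w i), fun v hv => ?_⟩
  rw [← map_rightComb, kernelForm_rightComb hK]
  exact hw v hv

/-- A negative definite family forces negative eigenvalues of some Gram matrix. -/
theorem exists_le_negEigenvalueCount (hK : ∀ z ∈ Ω, ∀ w ∈ Ω, K z w = (K w z)ᴴ) {s : ℕ}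
    {u : Fin s → (Ω →₀ (Fin N → ℍ[ℝ]))} (hu : NegDefFamily (kernelForm K Ω) u) :
    ∃ (n : ℕ) (z : Fin n → ℍ[ℝ]) (c : Fin n → Fin N → ℍ[ℝ]), (∀ l, z l ∈ Ω) ∧
      s ≤ negEigenvalueCount (kernelGram K z c) := by
  classical
  -- one sample point and column for each member of the family and each point of the supports
  let U : Finset Ω := Finset.univ.biUnion fun i => (u i).support
  let eq : Fin (Fintype.card (Fin s × U)) ≃ Fin s × U := (Fintype.equivFin _).symm
  let z : Fin (Fintype.card (Fin s × U)) → Ω := fun j => (eq j).2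
  let c : Fin (Fintype.card (Fin s × U)) → Fin N → ℍ[ℝ] := fun j => u (eq j).1 (eq j).2
  let L : (Fin s → ℍ[ℝ]) →ₗ[ℍ[ℝ]ᵐᵒᵖ] (Fin (Fintype.card (Fin s × U)) → ℍ[ℝ]) :=
    { toFun := fun v j => v (eq j).1
      map_add' := fun _ _ => rfl
      map_smul' := fun _ _ => rfl }
  have hL : ∀ v, rightComb (fun j => Finsupp.single (z j) (c j)) (L v) = rightComb u v := by
    intro v
    rw [rightComb_apply, rightComb_apply]
    change ∑ j, op (v (eq j).1) •
      Finsupp.single ((eq j).2 : Ω) (u (eq j).1 (eq j).2) = _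
    rw [eq.sum_comp fun x : Fin s × U => op (v x.1) • Finsupp.single (x.2 : Ω) (u x.1 x.2),
      Fintype.sum_prod_type]
    refine Finset.sum_congr rfl fun i _ => ?_
    dsimp only
    rw [← Finset.smul_sum, Finset.sum_coe_sort U fun p => Finsupp.single p (u i p)]
    congr 1
    conv_rhs => rw [← Finsupp.sum_single (u i)]
    refine (Finsupp.sum_of_support_subset _ ?_ _ (by simp)).symm
    exact Finset.subset_biUnion_of_mem (fun i => (u i).support) (Finset.mem_univ i)
  refine ⟨_, fun j => z j, c, fun l => (z l).2, ?_⟩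
  refine le_negEigenvalueCount (kernelGram_conjTranspose hK _ (fun l => (z l).2) c) L ?_
  intro v hv
  rw [← kernelForm_rightComb hK, hL]
  exact hu v hv

/-- The number of negative squares of a kernel is the largest dimension of a negative definite
subspace for the associated form. -/
theorem hasNegativeSquares_iff {κ : ℕ} :
    HasNegativeSquares K Ω κ ↔ (∀ z ∈ Ω, ∀ w ∈ Ω, K z w = (K w z)ᴴ) ∧
      (∀ (m : ℕ) (u : Fin m → (Ω →₀ (Fin N → ℍ[ℝ]))),
        NegDefFamily (kernelForm K Ω) u → m ≤ κ) ∧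
      ∃ u : Fin κ → (Ω →₀ (Fin N → ℍ[ℝ])), NegDefFamily (kernelForm K Ω) u := by
  refine and_congr_right fun hK => ?_
  constructor
  · rintro ⟨h1, n, z, c, hz, h2⟩
    refine ⟨fun m u hu => ?_, ?_⟩
    · obtain ⟨n, z, c, hz, h⟩ := exists_le_negEigenvalueCount hK hu
      exact h.trans (h1 n z c hz)
    · rw [← h2]
      exact exists_negDefFamily_kernelForm hK z hz c
  · rintro ⟨h1, u, hu⟩
    have h3 : ∀ (n : ℕ) (z : Fin n → ℍ[ℝ]) (c : Fin n → Fin N → ℍ[ℝ]), (∀ l, z l ∈ Ω) →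
        negEigenvalueCount (kernelGram K z c) ≤ κ := by
      intro n z c hz
      obtain ⟨w, hw⟩ := exists_negDefFamily_kernelForm hK z hz c
      exact h1 _ w hw
    obtain ⟨n, z, c, hz, h⟩ := exists_le_negEigenvalueCount hK hu
    exact ⟨h3, n, z, c, hz, le_antisymm (h3 n z c hz) h⟩

end KernelForm

/-! ### Hilbert norms of indefinite forms -/

theorem quaternion_re_mul_comm (a b : ℍ[ℝ]) : (a * b).re = (b * a).re := by
  rw [Quaternion.re_mul, Quaternion.re_mul]; ring

/-- The form obtained from `B` by changing its sign on the span of a family `e` that is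
orthonormal for `-B`. -/
def frameForm {X : Type*} {κ : ℕ} (B : X → X → ℍ[ℝ]) (e : Fin κ → X) (f g : X) : ℍ[ℝ] :=
  B f g + (2 : ℝ) • ∑ i, star (B g (e i)) * B f (e i)

theorem frameForm_frame {X : Type*} {B : X → X → ℍ[ℝ]} {κ : ℕ} {e : Fin κ → X}
    (he : NegOrthonormal B e) (f : X) (j : Fin κ) :
    frameForm B e f (e j) = -B f (e j) := by
  rw [frameForm, Finset.sum_eq_single j]
  · rw [he j j, if_pos rfl, star_neg, star_one, neg_one_mul, smul_neg, two_smul]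
    abel
  · intro i _ hij
    rw [he j i, if_neg hij.symm, star_zero, zero_mul]
  · simp

theorem frameForm_re_self {X : Type*} {B : X → X → ℍ[ℝ]} {κ : ℕ} {e : Fin κ → X} (f : X) :
    (frameForm B e f f).re = (B f f).re + 2 * ∑ i, ‖B f (e i)‖ ^ 2 := by
  simp only [frameForm, star_mul_self_eq]
  rw [Quaternion.re_add, Quaternion.re_smul, ← quaternion_coe_sum, smul_eq_mul]
  rfl

section Frame

variable {X : Type*} [AddCommGroup X] [Module ℍ[ℝ]ᵐᵒᵖ X] {B : X → X → ℍ[ℝ]} {κ : ℕ}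
  {e : Fin κ → X}

theorem isHermitianForm_frameForm (hB : IsHermitianForm B) (e : Fin κ → X) :
    IsHermitianForm (frameForm B e) where
  add_left u v w := by
    simp only [frameForm, hB.add_left, mul_add, Finset.sum_add_distrib, smul_add]
    abel
  smul_left a v w := by
    simp only [frameForm, hB.smul_left, add_mul, smul_mul_assoc, Finset.sum_mul, mul_assoc]
  star_eq v w := by
    simp [frameForm, hB.star_eq]

/-- The component orthogonal to the frame. -/
theorem sub_comb_orthogonal (hB : IsHermitianForm B) (he : NegOrthonormal B e) (f : X)
    (j : Fin κ) : B (f - rightComb e (fun i => -B f (e i))) (e j) = 0 := by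
  rw [hB.sub_left, he.comb_left hB, neg_neg, sub_self]

/-- A frame: an orthonormal family for `-B` whose orthogonal complement is nonnegative. -/
structure IsFrame (B : X → X → ℍ[ℝ]) (e : Fin κ → X) : Prop where
  neg : NegOrthonormal B e
  nonneg : ∀ f, (∀ i, B f (e i) = 0) → 0 ≤ (B f f).re

/-- The sum of the form on the two components of a vector. -/
theorem re_self_decompose (hB : IsHermitianForm B) (he : NegOrthonormal B e) (f : X) :
    (B f f).re = (B (f - rightComb e (fun i => -B f (e i)))
      (f - rightComb e (fun i => -B f (e i)))).re - ∑ i, ‖B f (e i)‖ ^ 2 := by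
  set f₁ := rightComb e (fun i => -B f (e i)) with hf₁
  have h1 : B (f - f₁) f₁ = 0 := by
    nth_rewrite 2 [hf₁]
    rw [hB.comb_right]
    exact Finset.sum_eq_zero fun i _ => by rw [hf₁, sub_comb_orthogonal hB he, mul_zero]
  have h2 : B f₁ (f - f₁) = 0 := by rw [← hB.star_eq, h1, star_zero]
  have h3 := he.comb_self hB (fun i => -B f (e i))
  simp only [norm_neg] at h3
  rw [← hf₁] at h3
  have h4 : B f f = B (f - f₁) (f - f₁) + B f₁ f₁ := by
    have : f = (f - f₁) + f₁ := by abel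
    conv_lhs => rw [this]
    rw [hB.add_left, hB.add_right, hB.add_right, h1, h2]
    abel
  rw [h4, Quaternion.re_add, h3, ← sub_eq_add_neg]

theorem IsFrame.frameForm_nonneg (hB : IsHermitianForm B) (he : IsFrame B e) (f : X) :
    0 ≤ (frameForm B e f f).re := by
  have h1 := re_self_decompose hB he.neg f
  have h2 := he.nonneg _ (sub_comb_orthogonal hB he.neg f)
  have h3 : 0 ≤ ∑ i, ‖B f (e i)‖ ^ 2 := Finset.sum_nonneg fun i _ => by positivity
  rw [frameForm_re_self]
  linarith

/-- The (possibly degenerate) real inner product of a frame. -/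
@[reducible]
def IsFrame.core [Module ℝ X] [IsScalarTower ℝ ℍ[ℝ]ᵐᵒᵖ X] (hB : IsHermitianForm B)
    (he : IsFrame B e) : PreInnerProductSpace.Core ℝ X where
  inner f g := (frameForm B e f g).re
  conj_inner_symm f g := (isHermitianForm_frameForm hB e).re_symm _ _
  re_inner_nonneg f := he.frameForm_nonneg hB f
  add_left f g h := by
    rw [(isHermitianForm_frameForm hB e).add_left, Quaternion.re_add]
  smul_left f g r := by
    rw [(isHermitianForm_frameForm hB e).real_smul_left, Quaternion.re_smul]; rfl

end Frame

/-- A (semi)normed space with a Hermitian form `B` and a family `e` orthonormal for `-B`, whose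
real inner product is the one obtained from `B` by changing its sign on the span of `e`. When the
space is complete this is the standard model of a Pontryagin space. -/
structure IsPontryaginModel {κ : ℕ} {E : Type*} [SeminormedAddCommGroup E] [InnerProductSpace ℝ E]
    [Module ℍ[ℝ]ᵐᵒᵖ E] (B : E → E → ℍ[ℝ]) (e : Fin κ → E) : Prop where
  hermitian : IsHermitianForm B
  neg : NegOrthonormal B e
  inner_eq : ∀ f g : E, inner ℝ f g = (frameForm B e f g).re

namespace IsPontryaginModel

section Seminormed

variable {κ : ℕ} {E : Type*} [SeminormedAddCommGroup E] [InnerProductSpace ℝ E]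
  [Module ℍ[ℝ]ᵐᵒᵖ E] {B : E → E → ℍ[ℝ]} {e : Fin κ → E}

theorem frameHermitian (h : IsPontryaginModel B e) : IsHermitianForm (frameForm B e) :=
  isHermitianForm_frameForm h.hermitian e

theorem norm_sq (h : IsPontryaginModel B e) (f : E) :
    ‖f‖ ^ 2 = (B f f).re + 2 * ∑ i, ‖B f (e i)‖ ^ 2 := by
  rw [← real_inner_self_eq_norm_sq, h.inner_eq, frameForm_re_self]

theorem norm_op_smul (h : IsPontryaginModel B e) (a : ℍ[ℝ]) (f : E) :
    ‖op a • f‖ = ‖a‖ * ‖f‖ := by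
  have hsq : ‖op a • f‖ ^ 2 = (‖a‖ * ‖f‖) ^ 2 := by
    rw [← real_inner_self_eq_norm_sq, h.inner_eq, h.frameHermitian.smul_left,
      h.frameHermitian.smul_right, mul_pow, ← real_inner_self_eq_norm_sq f, h.inner_eq,
      quaternion_re_mul_comm, ← mul_assoc, self_mul_star_eq, Quaternion.coe_mul_eq_smul,
      Quaternion.re_smul, smul_eq_mul]
  exact (sq_eq_sq₀ (norm_nonneg _) (by positivity)).mp hsq

theorem isBoundedSMul (h : IsPontryaginModel B e) : IsBoundedSMul ℍ[ℝ]ᵐᵒᵖ E :=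
  IsBoundedSMul.of_norm_smul_le fun a f => by
    rw [← op_unop a, h.norm_op_smul, MulOpposite.norm_op]

theorem norm_frameForm_le (h : IsPontryaginModel B e) (f g : E) :
    ‖frameForm B e f g‖ ≤ ‖f‖ * ‖g‖ := by
  have h1 : ‖frameForm B e f g‖ * ‖frameForm B e f g‖ ≤ ‖frameForm B e f g‖ * (‖f‖ * ‖g‖) := by
    calc ‖frameForm B e f g‖ * ‖frameForm B e f g‖
        = inner ℝ (op (star (frameForm B e f g)) • f) g := by
          rw [h.inner_eq, h.frameHermitian.smul_left, self_mul_star_eq, sq]; rfl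
      _ ≤ ‖op (star (frameForm B e f g)) • f‖ * ‖g‖ := real_inner_le_norm _ _
      _ = _ := by rw [h.norm_op_smul, norm_star, mul_assoc]
  rcases (norm_nonneg (frameForm B e f g)).eq_or_lt with h0 | h0
  · rw [← h0]; positivity
  · exact le_of_mul_le_mul_left h1 h0

theorem norm_frame (h : IsPontryaginModel B e) (i : Fin κ) : ‖e i‖ = 1 := by
  have : ‖e i‖ ^ 2 = 1 := by
    rw [← real_inner_self_eq_norm_sq, h.inner_eq, frameForm_frame h.neg,
      h.neg i i, if_pos rfl, neg_neg, Quaternion.re_one]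
  exact (pow_eq_one_iff_of_nonneg (norm_nonneg _) two_ne_zero).mp this

theorem norm_form_frame_le (h : IsPontryaginModel B e) (f : E) (i : Fin κ) :
    ‖B f (e i)‖ ≤ ‖f‖ := by
  have := h.norm_frameForm_le f (e i)
  rwa [frameForm_frame h.neg, norm_neg, h.norm_frame, mul_one] at this

theorem norm_form_le (h : IsPontryaginModel B e) (f g : E) :
    ‖B f g‖ ≤ (1 + 2 * κ) * ‖f‖ * ‖g‖ := by
  have h1 : B f g = frameForm B e f g - (2 : ℝ) • ∑ i, star (B g (e i)) * B f (e i) := by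
    rw [frameForm, add_sub_cancel_right]
  have h2 : ‖∑ i, star (B g (e i)) * B f (e i)‖ ≤ κ * (‖f‖ * ‖g‖) := by
    refine (norm_sum_le _ _).trans ?_
    refine (Finset.sum_le_card_nsmul _ _ (‖f‖ * ‖g‖) fun i _ => ?_).trans_eq (by simp)
    rw [norm_mul, norm_star, mul_comm]
    exact mul_le_mul (h.norm_form_frame_le f i) (h.norm_form_frame_le g i) (norm_nonneg _)
      (norm_nonneg _)
  rw [h1]
  refine (norm_sub_le _ _).trans ?_
  rw [norm_smul, Real.norm_ofNat]
  have := h.norm_frameForm_le f g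
  linarith

theorem continuous_form [IsScalarTower ℝ ℍ[ℝ]ᵐᵒᵖ E] (h : IsPontryaginModel B e) :
    Continuous fun p : E × E => B p.1 p.2 := by
  have : IsBoundedBilinearMap ℝ fun p : E × E => B p.1 p.2 :=
    { add_left := h.hermitian.add_left
      smul_left := h.hermitian.real_smul_left
      add_right := h.hermitian.add_right
      smul_right := h.hermitian.real_smul_right
      bound := ⟨1 + 2 * κ, by positivity, h.norm_form_le⟩ }
  exact this.continuous

theorem continuous_form_left [IsScalarTower ℝ ℍ[ℝ]ᵐᵒᵖ E] (h : IsPontryaginModel B e) (g : E) :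
    Continuous fun f => B f g :=
  h.continuous_form.comp (continuous_id.prodMk continuous_const)

theorem nonneg_of_orthogonal (h : IsPontryaginModel B e) {f : E} (hf : ∀ i, B f (e i) = 0) :
    (B f f).re = ‖f‖ ^ 2 := by
  rw [h.norm_sq]
  simp [hf]

/-- Negative definite subspaces of the model have dimension at most `κ`. -/
theorem le_of_negDefFamily (h : IsPontryaginModel B e) {m : ℕ} {u : Fin m → E}
    (hu : NegDefFamily B u) : m ≤ κ := by
  by_contra! hm
  obtain ⟨v, hv, hve⟩ := exists_comb_orthogonal h.hermitian hm u e
  have := hu v hv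
  rw [h.nonneg_of_orthogonal hve] at this
  have := sq_nonneg ‖rightComb u v‖
  linarith

end Seminormed

end IsPontryaginModel

/-- The Cauchy–Schwarz inequality for the norm of a frame. -/
theorem IsFrame.norm_form_sq_le {X : Type*} [AddCommGroup X] [Module ℝ X] [Module ℍ[ℝ]ᵐᵒᵖ X]
    [IsScalarTower ℝ ℍ[ℝ]ᵐᵒᵖ X] {B : X → X → ℍ[ℝ]} {κ : ℕ} {t : Fin κ → X}
    (hB : IsHermitianForm B) (ht : IsFrame B t) (f g : X) :
    ‖B f g‖ ^ 2 ≤ (1 + 2 * κ) ^ 2 * (frameForm B t f f).re * (frameForm B t g g).re := by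
  let c := ht.core hB
  let _ : SeminormedAddCommGroup X :=
    @InnerProductSpace.Core.toSeminormedAddCommGroup ℝ X _ _ _ c
  let _ : InnerProductSpace ℝ X := InnerProductSpace.ofCore c
  have h : IsPontryaginModel B t := ⟨hB, ht.neg, fun f g => rfl⟩
  rw [← h.inner_eq, ← h.inner_eq, real_inner_self_eq_norm_sq, real_inner_self_eq_norm_sq,
    ← mul_pow, ← mul_pow]
  exact pow_le_pow_left₀ (norm_nonneg _) (h.norm_form_le f g) 2

/-- The norm of the model is dominated by the norm of any other frame. -/
theorem IsPontryaginModel.norm_sq_le_of_frame {κ : ℕ} {E : Type*} [SeminormedAddCommGroup E]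
    [InnerProductSpace ℝ E] [Module ℍ[ℝ]ᵐᵒᵖ E] [IsScalarTower ℝ ℍ[ℝ]ᵐᵒᵖ E] {B : E → E → ℍ[ℝ]}
    {e : Fin κ → E} (h : IsPontryaginModel B e) {t : Fin κ → E} (ht : IsFrame B t) :
    ∃ c : ℝ, 0 ≤ c ∧ ∀ f : E, ‖f‖ ^ 2 ≤ c * ((B f f).re + 2 * ∑ i, ‖B f (t i)‖ ^ 2) := by
  have h0 : ∀ f, 0 ≤ (frameForm B t f f).re := ht.frameForm_nonneg h.hermitian
  refine ⟨1 + 2 * ∑ i, (1 + 2 * κ) ^ 2 * (frameForm B t (e i) (e i)).re, ?_, fun f => ?_⟩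
  · have : 0 ≤ ∑ i, (1 + 2 * (κ : ℝ)) ^ 2 * (frameForm B t (e i) (e i)).re :=
      Finset.sum_nonneg fun i _ => mul_nonneg (by positivity) (h0 _)
    linarith
  · have h1 : ∑ i, ‖B f (e i)‖ ^ 2 ≤
        (∑ i, (1 + 2 * (κ : ℝ)) ^ 2 * (frameForm B t (e i) (e i)).re) *
          (frameForm B t f f).re := by
      rw [Finset.sum_mul]
      refine Finset.sum_le_sum fun i _ => (ht.norm_form_sq_le h.hermitian f (e i)).trans_eq ?_
      ring
    have h2 : 0 ≤ ∑ i, ‖B f (t i)‖ ^ 2 := Finset.sum_nonneg fun i _ => by positivity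
    have h3 := frameForm_re_self (B := B) (e := t) f
    rw [h.norm_sq, ← h3, add_mul, one_mul, mul_assoc]
    linarith

/-! ### Completion -/

/-- The imaginary units of the standard basis. -/
def quaternionUnit : Fin 3 → ℍ[ℝ] := ![⟨0, 1, 0, 0⟩, ⟨0, 0, 1, 0⟩, ⟨0, 0, 0, 1⟩]

/-- The quaternionic inner product defined by a real one. -/
def quaternionInner {E : Type*} [SeminormedAddCommGroup E] [InnerProductSpace ℝ E]
    [Module ℍ[ℝ]ᵐᵒᵖ E] (f g : E) : ℍ[ℝ] :=
  ⟨inner ℝ f g, -inner ℝ (op (quaternionUnit 0) • f) g,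
    -inner ℝ (op (quaternionUnit 1) • f) g, -inner ℝ (op (quaternionUnit 2) • f) g⟩

theorem quaternion_eq_mk_re_mul (q : ℍ[ℝ]) :
    (⟨q.re, -(q * quaternionUnit 0).re, -(q * quaternionUnit 1).re,
      -(q * quaternionUnit 2).re⟩ : ℍ[ℝ]) = q := by
  ext <;> simp only [Quaternion.re_mul, quaternionUnit] <;> simp

theorem IsPontryaginModel.quaternionInner_eq {κ : ℕ} {E : Type*} [SeminormedAddCommGroup E]
    [InnerProductSpace ℝ E] [Module ℍ[ℝ]ᵐᵒᵖ E] {B : E → E → ℍ[ℝ]} {e : Fin κ → E}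
    (h : IsPontryaginModel B e) (f g : E) : quaternionInner f g = frameForm B e f g := by
  simp only [quaternionInner, h.inner_eq, h.frameHermitian.smul_left]
  exact quaternion_eq_mk_re_mul _

theorem continuous_quaternionInner {E : Type*} [SeminormedAddCommGroup E]
    [InnerProductSpace ℝ E] [Module ℍ[ℝ]ᵐᵒᵖ E] [ContinuousConstSMul ℍ[ℝ]ᵐᵒᵖ E] :
    Continuous fun p : E × E => quaternionInner p.1 p.2 := by
  have h1 : ∀ a : ℍ[ℝ], Continuous fun p : E × E => inner ℝ (op a • p.1) p.2 := fun a =>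
    (continuous_fst.const_smul (op a)).inner continuous_snd
  have h2 : ∀ p : E × E, quaternionInner p.1 p.2 = Quaternion.linearIsometryEquivTuple.symm
    (WithLp.toLp 2 ![inner ℝ p.1 p.2, -inner ℝ (op (quaternionUnit 0) • p.1) p.2,
    -inner ℝ (op (quaternionUnit 1) • p.1) p.2, -inner ℝ (op (quaternionUnit 2) • p.1) p.2])
    := fun p => rfl
  simp only [h2]
  refine Quaternion.linearIsometryEquivTuple.symm.continuous.comp
    ((PiLp.continuous_toLp 2 _).comp (continuous_pi fun i => ?_))
  fin_cases i
  · exact continuous_fst.inner continuous_snd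
  · exact (h1 _).neg
  · exact (h1 _).neg
  · exact (h1 _).neg

theorem isHermitianForm_of_denseRange {X E : Type*} [AddCommGroup X] [Module ℍ[ℝ]ᵐᵒᵖ X]
    [AddCommGroup E] [Module ℍ[ℝ]ᵐᵒᵖ E] [TopologicalSpace E] [ContinuousAdd E]
    [ContinuousConstSMul ℍ[ℝ]ᵐᵒᵖ E] {B : X → X → ℍ[ℝ]} (hB : IsHermitianForm B)
    {B' : E → E → ℍ[ℝ]} (hc : Continuous fun p : E × E => B' p.1 p.2) {ι : X →ₗ[ℍ[ℝ]ᵐᵒᵖ] E}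
    (hι : DenseRange ι) (hB' : ∀ f g, B' (ι f) (ι g) = B f g) : IsHermitianForm B' where
  add_left u v w := by
    refine hι.induction_on₃ (p := fun u v w => B' (u + v) w = B' u w + B' v w) ?_ ?_ u v w
    · exact isClosed_eq (hc.comp ((continuous_fst.add continuous_snd.fst).prodMk
        continuous_snd.snd)) ((hc.comp (continuous_fst.prodMk continuous_snd.snd)).add
        (hc.comp (continuous_snd.fst.prodMk continuous_snd.snd)))
    · intro u v w
      rw [← map_add, hB', hB', hB', hB.add_left]
  smul_left a v w := by
    refine hι.induction_on₂ (p := fun v w => B' (op a • v) w = B' v w * a) ?_ ?_ v w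
    · exact isClosed_eq (hc.comp ((continuous_fst.const_smul (op a)).prodMk continuous_snd))
        (hc.mul continuous_const)
    · intro v w
      rw [← map_smul, hB', hB', hB.smul_left]
  star_eq v w := by
    refine hι.induction_on₂ (p := fun v w => star (B' v w) = B' w v) ?_ ?_ v w
    · exact isClosed_eq hc.star (hc.comp (continuous_snd.prodMk continuous_fst))
    · intro v w
      rw [hB', hB', hB.star_eq]

open UniformSpace in
/-- A seminormed model completes to a complete one. -/
theorem IsPontryaginModel.exists_completion {X : Type} [SeminormedAddCommGroup X]
    [InnerProductSpace ℝ X] [Module ℍ[ℝ]ᵐᵒᵖ X] [IsScalarTower ℝ ℍ[ℝ]ᵐᵒᵖ X] {B : X → X → ℍ[ℝ]}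
    {κ : ℕ} {e : Fin κ → X} (h : IsPontryaginModel B e) :
    ∃ (E : Type) (_ : NormedAddCommGroup E) (_ : InnerProductSpace ℝ E) (_ : CompleteSpace E)
      (_ : Module ℍ[ℝ]ᵐᵒᵖ E) (_ : IsScalarTower ℝ ℍ[ℝ]ᵐᵒᵖ E) (B' : E → E → ℍ[ℝ])
      (ι : X →ₗ[ℍ[ℝ]ᵐᵒᵖ] E), DenseRange ι ∧ (∀ f g, B' (ι f) (ι g) = B f g) ∧
      IsPontryaginModel B' (fun i => ι (e i)) := by
  have := h.isBoundedSMul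
  let ι : X →ₗ[ℍ[ℝ]ᵐᵒᵖ] Completion X :=
    { toFun := fun x => x
      map_add' := fun x y => Completion.coe_add x y
      map_smul' := fun a x => Completion.coe_smul a x }
  have hι : DenseRange ι := Completion.denseRange_coe
  have hFc : Continuous fun p : Completion X × Completion X => quaternionInner p.1 p.2 :=
    continuous_quaternionInner
  have hF : ∀ f g : X, quaternionInner (ι f) (ι g) = frameForm B e f g := by
    intro f g
    rw [← h.quaternionInner_eq]
    change quaternionInner (f : Completion X) (g : Completion X) = _
    simp only [quaternionInner, ← Completion.coe_smul, Completion.inner_coe]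
    rfl
  obtain ⟨B', hc, hB'⟩ : ∃ B' : Completion X → Completion X → ℍ[ℝ],
      (Continuous fun p : Completion X × Completion X => B' p.1 p.2) ∧
      ∀ f g : X, B' (ι f) (ι g) = B f g := by
    -- `B` is recovered from the inner product by changing the sign on the frame again
    refine ⟨fun f g => quaternionInner f g -
      (2 : ℝ) • ∑ i, star (quaternionInner g (ι (e i))) * quaternionInner f (ι (e i)), ?_, ?_⟩
    · refine hFc.sub (Continuous.fun_const_smul (continuous_finsetSum _ fun i _ => ?_) _)
      exact (hFc.comp (continuous_snd.prodMk continuous_const)).star.mul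
        (hFc.comp (continuous_fst.prodMk continuous_const))
    · intro f g
      simp only [hF, frameForm_frame h.neg, star_neg, neg_mul_neg]
      rw [frameForm, add_sub_cancel_right]
  refine ⟨Completion X, inferInstance, inferInstance, inferInstance, inferInstance,
    inferInstance, B', ι, hι, hB', isHermitianForm_of_denseRange h.hermitian hc hι hB',
    fun i j => ?_, fun f g => ?_⟩
  · rw [hB', h.neg i j]
  · refine hι.induction_on₂
      (p := fun f g => inner ℝ f g = (frameForm B' (fun i => ι (e i)) f g).re) ?_ ?_ f g
    · refine isClosed_eq (continuous_fst.inner continuous_snd) (Quaternion.continuous_re.comp ?_)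
      refine hc.add (Continuous.fun_const_smul (continuous_finsetSum _ fun i _ => ?_) _)
      exact (hc.comp (continuous_snd.prodMk continuous_const)).star.mul
        (hc.comp (continuous_fst.prodMk continuous_const))
    · intro f g
      change inner ℝ (f : Completion X) (g : Completion X) = _
      rw [Completion.inner_coe, h.inner_eq]
      simp only [frameForm, hB']

/-- A space with a Hermitian form that has a frame maps with dense range into a complete
model. -/
theorem IsFrame.exists_model {X : Type} [AddCommGroup X] [Module ℝ X] [Module ℍ[ℝ]ᵐᵒᵖ X]
    [IsScalarTower ℝ ℍ[ℝ]ᵐᵒᵖ X] {B : X → X → ℍ[ℝ]} {κ : ℕ} {e : Fin κ → X}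
    (hB : IsHermitianForm B) (he : IsFrame B e) :
    ∃ (E : Type) (_ : NormedAddCommGroup E) (_ : InnerProductSpace ℝ E) (_ : CompleteSpace E)
      (_ : Module ℍ[ℝ]ᵐᵒᵖ E) (_ : IsScalarTower ℝ ℍ[ℝ]ᵐᵒᵖ E) (B' : E → E → ℍ[ℝ])
      (ι : X →ₗ[ℍ[ℝ]ᵐᵒᵖ] E), DenseRange ι ∧ (∀ f g, B' (ι f) (ι g) = B f g) ∧
      IsPontryaginModel B' (fun i => ι (e i)) := by
  let c := he.core hB
  let _ : SeminormedAddCommGroup X := @InnerProductSpace.Core.toSeminormedAddCommGroup ℝ X _ _ _ c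
  let _ : InnerProductSpace ℝ X := InnerProductSpace.ofCore c
  exact IsPontryaginModel.exists_completion (e := e) (B := B) ⟨hB, he.neg, fun f g => rfl⟩

/-! ### Complete models are Pontryagin spaces -/

/-- The closed graph theorem, for a map whose compositions with a separating family of
continuous maps are continuous. -/
theorem LinearMap.continuous_of_separating {E F Y ι : Type*} [NormedAddCommGroup E]
    [NormedSpace ℝ E] [CompleteSpace E] [NormedAddCommGroup F] [NormedSpace ℝ F] [CompleteSpace F]
    [TopologicalSpace Y] [T2Space Y] (T : E →ₗ[ℝ] F) (ψ : ι → F → Y)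
    (hψ : ∀ i, Continuous (ψ i)) (hsep : ∀ x y, (∀ i, ψ i x = ψ i y) → x = y)
    (hT : ∀ i, Continuous fun x => ψ i (T x)) : Continuous T := by
  refine T.continuous_of_isClosed_graph ?_
  have : (T.graph : Set (E × F)) = ⋂ i, {p | ψ i p.2 = ψ i (T p.1)} := by
    ext p
    simp only [SetLike.mem_coe, LinearMap.mem_graph_iff, Set.mem_iInter, Set.mem_ofPred_eq]
    exact ⟨fun h i => by rw [h], fun h => hsep _ _ h⟩
  rw [this]
  exact isClosed_iInter fun i =>
    isClosed_eq ((hψ i).comp continuous_snd) ((hT i).comp continuous_fst)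

theorem star_dotProduct_single {N : ℕ} (i : Fin N) (x : Fin N → ℍ[ℝ]) :
    star (Pi.single i 1 : Fin N → ℍ[ℝ]) ⬝ᵥ x = x i := by
  rw [dotProduct, Finset.sum_eq_single i]
  · simp
  · intro j _ hj
    simp [hj]
  · simp

theorem eq_of_star_dotProduct {N : ℕ} {x y : Fin N → ℍ[ℝ]}
    (h : ∀ d : Fin N → ℍ[ℝ], star d ⬝ᵥ x = star d ⬝ᵥ y) : x = y := by
  ext1 i
  rw [← star_dotProduct_single i x, h, star_dotProduct_single]

theorem continuous_star_dotProduct {N : ℕ} (d : Fin N → ℍ[ℝ]) :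
    Continuous fun x : Fin N → ℍ[ℝ] => star d ⬝ᵥ x :=
  continuous_finsetSum _ fun i _ => continuous_const.mul (continuous_apply i)

namespace IsPontryaginModel

variable {κ : ℕ} {E : Type*} [NormedAddCommGroup E] [InnerProductSpace ℝ E]
  [Module ℍ[ℝ]ᵐᵒᵖ E] {B : E → E → ℍ[ℝ]} {e : Fin κ → E}

theorem eq_zero_of_form (h : IsPontryaginModel B e) {f : E} (hf : ∀ g, B f g = 0) : f = 0 := by
  have := h.norm_sq f
  simp only [hf] at this
  simpa using this

theorem eq_of_form (h : IsPontryaginModel B e) {f g : E} (hfg : ∀ w, B w f = B w g) : f = g := by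
  rw [← sub_eq_zero]
  refine h.eq_zero_of_form fun w => ?_
  rw [h.hermitian.sub_left, ← h.hermitian.star_eq, hfg, h.hermitian.star_eq, sub_self]

theorem eq_of_form_left (h : IsPontryaginModel B e) {f g : E} (hfg : ∀ w, B f w = B g w) :
    f = g :=
  h.eq_of_form fun w => by rw [← h.hermitian.star_eq, hfg, h.hermitian.star_eq]

/-- The orthogonal complement of the frame. -/
def posPart (h : IsPontryaginModel B e) : Submodule ℍ[ℝ]ᵐᵒᵖ E where
  carrier := {f | ∀ i, B f (e i) = 0}
  add_mem' hf hg i := by rw [h.hermitian.add_left, hf i, hg i, add_zero]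
  zero_mem' i := h.hermitian.zero_left _
  smul_mem' a f hf i := by rw [← op_unop a, h.hermitian.smul_left, hf i, zero_mul]

theorem mem_posPart (h : IsPontryaginModel B e) {f : E} :
    f ∈ h.posPart ↔ ∀ i, B f (e i) = 0 := Iff.rfl

/-- The span of the frame. -/
def negPart (_ : IsPontryaginModel B e) : Submodule ℍ[ℝ]ᵐᵒᵖ E := LinearMap.range (rightComb e)

theorem mem_negPart (h : IsPontryaginModel B e) {f : E} :
    f ∈ h.negPart ↔ rightComb e (fun i => -B f (e i)) = f := by
  constructor
  · rintro ⟨v, rfl⟩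
    congr 1
    ext1 i
    rw [h.neg.comb_left h.hermitian, neg_neg]
  · intro hf
    rw [← hf]
    exact LinearMap.mem_range_self _ _

theorem finrank_negPart (h : IsPontryaginModel B e) :
    Module.finrank ℍ[ℝ]ᵐᵒᵖ h.negPart = κ := by
  rw [negPart, LinearMap.finrank_range_of_inj, finrank_columns]
  rw [← LinearMap.ker_eq_bot, LinearMap.ker_eq_bot']
  intro v hv
  ext1 i
  have := h.neg.comb_left h.hermitian v i
  rw [hv, h.hermitian.zero_left] at this
  simpa using this.symm

theorem form_pos_neg (h : IsPontryaginModel B e) {f g : E} (hf : f ∈ h.posPart)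
    (hg : g ∈ h.negPart) : B f g = 0 := by
  obtain ⟨v, rfl⟩ := hg
  rw [h.hermitian.comb_right]
  exact Finset.sum_eq_zero fun i _ => by rw [hf i, mul_zero]

theorem norm_sq_of_mem_negPart (h : IsPontryaginModel B e) {f : E} (hf : f ∈ h.negPart) :
    ‖f‖ ^ 2 = -(B f f).re := by
  have h1 := h.neg.comb_self h.hermitian (fun i => -B f (e i))
  rw [h.mem_negPart.mp hf] at h1
  simp only [norm_neg] at h1
  rw [h.norm_sq, h1]
  ring

theorem isCompl (h : IsPontryaginModel B e) : IsCompl h.posPart h.negPart := by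
  refine ⟨Submodule.disjoint_def.mpr fun f hf hg => ?_, codisjoint_iff.mpr ?_⟩
  · rw [← h.mem_negPart.mp hg]
    have : (fun i => -B f (e i)) = 0 := by ext1 i; rw [hf i, neg_zero]; rfl
    rw [this, map_zero]
  · rw [eq_top_iff]
    rintro f -
    rw [← sub_add_cancel f (rightComb e (fun i => -B f (e i)))]
    exact Submodule.add_mem_sup (fun j => sub_comb_orthogonal h.hermitian h.neg f j)
      (LinearMap.mem_range_self _ _)

variable [IsScalarTower ℝ ℍ[ℝ]ᵐᵒᵖ E]

theorem continuous_form_comp (h : IsPontryaginModel B e) {Y : Type*} [TopologicalSpace Y]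
    {u v : Y → E} (hu : Continuous u) (hv : Continuous v) : Continuous fun y => B (u y) (v y) :=
  h.continuous_form.comp (hu.prodMk hv)

section Complete

variable [CompleteSpace E]

/-- The Riesz representation theorem for the indefinite form. -/
theorem exists_form_eq (h : IsPontryaginModel B e) (l : E →ₗ[ℍ[ℝ]ᵐᵒᵖ] ℍ[ℝ])
    (hl : Continuous l) : ∃ g, ∀ f, B f g = l f := by
  let lr : StrongDual ℝ E :=
    { toFun := fun f => (l f).re
      map_add' := fun f g => by rw [map_add, Quaternion.re_add]
      map_smul' := fun r f => by
        rw [← op_coe_smul, map_smul, MulOpposite.smul_eq_mul_unop, unop_op,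
          Quaternion.mul_coe_eq_smul, Quaternion.re_smul]
        rfl
      cont := Quaternion.continuous_re.comp hl }
  let g₀ := (InnerProductSpace.toDual ℝ E).symm lr
  have hg₀ : ∀ f, inner ℝ g₀ f = (l f).re := fun f => by
    rw [InnerProductSpace.toDual_symm_apply]; rfl
  -- the vector that represents for `B` what `g₀` represents for the inner product
  refine ⟨g₀ + (2 : ℝ) • rightComb e fun i => B g₀ (e i), fun f => ?_⟩
  have hB : ∀ f, B f (g₀ + (2 : ℝ) • rightComb e fun i => B g₀ (e i)) = frameForm B e f g₀ := by
    intro f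
    rw [h.hermitian.add_right, h.hermitian.real_smul_right, h.hermitian.comb_right, frameForm]
  refine quaternion_ext_re_mul fun c => ?_
  rw [← h.hermitian.smul_left, hB, ← h.inner_eq, real_inner_comm, hg₀, map_smul,
    MulOpposite.smul_eq_mul_unop, unop_op]

/-- An operator that has an adjoint is bounded. -/
theorem continuous_of_isAdjointEnd (h : IsPontryaginModel B e) {T T' : Module.End ℍ[ℝ]ᵐᵒᵖ E}
    (hT : IsAdjointEnd B T T') : Continuous T :=
  (T.restrictScalars ℝ).continuous_of_separating (fun (g f : E) => B f g)
    (fun g => h.continuous_form_left g) (fun _ _ hxy => h.eq_of_form_left hxy)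
    (fun g => by
      simpa only [LinearMap.coe_restrictScalars, hT _ g] using h.continuous_form_left (T' g))

/-- An operator to the columns that has an adjoint is bounded. -/
theorem continuous_of_isAdjointToColumns (h : IsPontryaginModel B e) {N : ℕ}
    {C : E →ₗ[ℍ[ℝ]ᵐᵒᵖ] (Fin N → ℍ[ℝ])} {C' : (Fin N → ℍ[ℝ]) →ₗ[ℍ[ℝ]ᵐᵒᵖ] E}
    (hC : IsAdjointToColumns B C C') : Continuous C :=
  (C.restrictScalars ℝ).continuous_of_separating (fun d x => star d ⬝ᵥ x)
    continuous_star_dotProduct (fun _ _ hxy => eq_of_star_dotProduct hxy)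
    (fun d => by
      simpa only [LinearMap.coe_restrictScalars, hC _ d] using h.continuous_form_left (C' d))

/-- A bounded operator is the adjoint of an operator. -/
theorem exists_isAdjointEnd (h : IsPontryaginModel B e) {T : Module.End ℍ[ℝ]ᵐᵒᵖ E}
    (hT : Continuous T) : ∃ V : Module.End ℍ[ℝ]ᵐᵒᵖ E, IsAdjointEnd B V T := by
  have key : ∀ f, ∃ g, ∀ w, B w g = B (T w) f := fun f => by
    let l : E →ₗ[ℍ[ℝ]ᵐᵒᵖ] ℍ[ℝ] :=
      { toFun := fun w => B (T w) f
        map_add' := fun v w => by rw [map_add, h.hermitian.add_left]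
        map_smul' := fun a w => by
          rw [map_smul, ← op_unop a, h.hermitian.smul_left]; rfl }
    exact h.exists_form_eq l ((h.continuous_form_left f).comp hT)
  choose V hV using key
  refine ⟨{ toFun := V, map_add' := fun f g => ?_, map_smul' := fun a f => ?_ }, fun f w => ?_⟩
  · refine h.eq_of_form fun w => ?_
    rw [hV, h.hermitian.add_right, h.hermitian.add_right, hV, hV]
  · refine h.eq_of_form fun w => ?_
    rw [RingHom.id_apply, hV, ← op_unop a, h.hermitian.smul_right, h.hermitian.smul_right, hV]
  · change B (V f) w = B f (T w)
    rw [← h.hermitian.star_eq, hV, h.hermitian.star_eq]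

end Complete

theorem isClosed_posPart (h : IsPontryaginModel B e) : IsClosed (h.posPart : Set E) := by
  have : (h.posPart : Set E) = ⋂ i, {f | B f (e i) = 0} := by
    ext f; simp [mem_posPart]
  rw [this]
  exact isClosed_iInter fun i => isClosed_eq (h.continuous_form_left _) continuous_const

theorem isClosed_negPart (h : IsPontryaginModel B e) : IsClosed (h.negPart : Set E) := by
  have : (h.negPart : Set E) = {f | rightComb e (fun i => -B f (e i)) = f} := by
    ext f; exact h.mem_negPart
  rw [this]
  have := h.isBoundedSMul
  simp only [rightComb_apply]
  refine isClosed_eq (continuous_finsetSum _ fun i _ => ?_) continuous_id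
  exact (continuous_op.comp (h.continuous_form_left _).neg).smul continuous_const

/-- A closed subspace on which a form is the square of the norm is a Hilbert space. -/
theorem isHilbertOn_of_isClosed {E : Type*} [NormedAddCommGroup E] [CompleteSpace E]
    [Module ℍ[ℝ]ᵐᵒᵖ E] {B : E → E → ℍ[ℝ]} {M : Submodule ℍ[ℝ]ᵐᵒᵖ E} (hM : IsClosed (M : Set E))
    (hB : ∀ f ∈ M, (B f f).re = ‖f‖ ^ 2) : IsHilbertOn B M where
  pos f hf hf0 := by
    rw [hB f hf]
    have := norm_pos_iff.mpr hf0
    positivity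
  complete u hu hc := by
    have hcauchy : CauchySeq u := by
      refine Metric.cauchySeq_iff.mpr fun ε hε => ?_
      obtain ⟨n₀, hn₀⟩ := hc (ε ^ 2) (by positivity)
      refine ⟨n₀, fun m hm n hn => ?_⟩
      have := hn₀ m hm n hn
      rw [hB _ (M.sub_mem (hu m) (hu n))] at this
      rw [dist_eq_norm]
      exact lt_of_pow_lt_pow_left₀ 2 hε.le this
    obtain ⟨v, hv⟩ := cauchySeq_tendsto_of_complete hcauchy
    have hvM : v ∈ M := hM.mem_of_tendsto hv (Eventually.of_forall hu)
    refine ⟨v, hvM, ?_⟩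
    have h1 : Tendsto (fun n => ‖u n - v‖ ^ 2) atTop (𝓝 0) := by
      have := (tendsto_iff_norm_sub_tendsto_zero.mp hv).pow 2
      simpa using this
    refine h1.congr fun n => ?_
    rw [hB _ (M.sub_mem (hu n) hvM)]

variable [CompleteSpace E]

theorem isFundamentalDecomposition (h : IsPontryaginModel B e) :
    IsFundamentalDecomposition B h.posPart h.negPart where
  isCompl := h.isCompl
  orthogonal _ hv _ hw := h.form_pos_neg hv hw
  hilbert_pos := isHilbertOn_of_isClosed h.isClosed_posPart fun _ hf =>
    h.nonneg_of_orthogonal hf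
  hilbert_neg := isHilbertOn_of_isClosed h.isClosed_negPart fun f hf => by
    rw [Quaternion.re_neg, h.norm_sq_of_mem_negPart hf]
  finite_neg := by rw [negPart]; infer_instance

theorem isPontryaginSpace (h : IsPontryaginModel B e) : IsPontryaginSpace B κ :=
  ⟨h.hermitian, _, _, h.isFundamentalDecomposition, h.finrank_negPart⟩

theorem fundamentalNormSq_eq (h : IsPontryaginModel B e) (f : E) :
    fundamentalNormSq h.isFundamentalDecomposition f = ‖f‖ ^ 2 := by
  have hsum := Submodule.projection_add_projection_eq_self h.isCompl f
  simp only [← Submodule.coe_projectionOnto_apply] at hsum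
  rw [fundamentalNormSq]
  set p := h.posPart.projectionOnto h.negPart h.isCompl f
  set q := h.negPart.projectionOnto h.posPart h.isCompl.symm f
  have h1 : B (p : E) (q : E) = 0 := h.form_pos_neg p.2 q.2
  have h2 : B (q : E) (p : E) = 0 := by rw [← h.hermitian.star_eq, h1, star_zero]
  have h3 := h.norm_sq_of_mem_negPart q.2
  have h4 := h.norm_sq (q : E)
  rw [h.norm_sq f, ← hsum]
  simp only [h.hermitian.add_left, h.hermitian.add_right, h1, h2, h.mem_posPart.mp p.2,
    Quaternion.re_add, add_zero, zero_add]
  linarith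

theorem isBoundedEnd (h : IsPontryaginModel B e) {T : Module.End ℍ[ℝ]ᵐᵒᵖ E}
    (hT : Continuous T) : IsBoundedEnd B T := by
  let T' : E →L[ℝ] E := ⟨T.restrictScalars ℝ, hT⟩
  refine ⟨_, _, h.isFundamentalDecomposition, ‖T'‖ ^ 2, fun f => ?_⟩
  rw [h.fundamentalNormSq_eq, h.fundamentalNormSq_eq, ← mul_pow]
  exact pow_le_pow_left₀ (norm_nonneg _) (T'.le_opNorm f) 2

theorem isBoundedToColumns (h : IsPontryaginModel B e) {N : ℕ}
    {C : E →ₗ[ℍ[ℝ]ᵐᵒᵖ] (Fin N → ℍ[ℝ])} (hC : Continuous C) : IsBoundedToColumns B C := by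
  let T' : E →L[ℝ] (Fin N → ℍ[ℝ]) := ⟨C.restrictScalars ℝ, hC⟩
  refine ⟨_, _, h.isFundamentalDecomposition, N * ‖T'‖ ^ 2, fun f => ?_⟩
  rw [h.fundamentalNormSq_eq, mul_assoc, ← mul_pow]
  refine (Finset.sum_le_card_nsmul _ _ ((‖T'‖ * ‖f‖) ^ 2) fun i _ => ?_).trans_eq (by simp)
  exact pow_le_pow_left₀ (norm_nonneg _) ((norm_le_pi_norm (C f) i).trans (T'.le_opNorm f)) 2

omit [CompleteSpace E] in
/-- Negative definiteness is an open condition, so that a dense range contains a negative definite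
family of the largest possible size. -/
theorem exists_negDefFamily_of_denseRange (h : IsPontryaginModel B e) {X : Type*}
    [AddCommGroup X] [Module ℍ[ℝ]ᵐᵒᵖ X] (Ψ : X →ₗ[ℍ[ℝ]ᵐᵒᵖ] E) (hΨ : DenseRange Ψ) :
    ∃ u : Fin κ → X, NegDefFamily (fun f g => B (Ψ f) (Ψ g)) u := by
  let Φ : (Fin κ → E) × (Fin κ → ℍ[ℝ]) → ℝ := fun p =>
    (B (rightComb p.1 p.2) (rightComb p.1 p.2)).re
  have hΦ : Continuous Φ := by
    have h1 : Φ = fun p => (∑ i, star (p.2 i) * ∑ j, B (p.1 j) (p.1 i) * p.2 j).re := by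
      ext1 p
      simp only [Φ]
      rw [h.hermitian.comb_right]
      simp only [h.hermitian.comb_left]
    rw [h1]
    refine Quaternion.continuous_re.comp (continuous_finsetSum _ fun i _ => ?_)
    refine ((continuous_apply i).comp continuous_snd).star.mul
      (continuous_finsetSum _ fun j _ => ?_)
    refine Continuous.mul ?_ ((continuous_apply j).comp continuous_snd)
    exact h.continuous_form_comp ((continuous_apply j).comp continuous_fst)
      ((continuous_apply i).comp continuous_fst)
  -- negativity on the compact unit sphere of coefficients persists near `e`
  have hev : ∀ᶠ d in 𝓝 e, ∀ v ∈ Metric.sphere (0 : Fin κ → ℍ[ℝ]) 1, Φ (d, v) < 0 := by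
    refine (isCompact_sphere _ _).eventually_forall_of_forall_eventually fun v hv => ?_
    have hv0 : v ≠ 0 := by
      rintro rfl
      simp at hv
    exact hΦ.continuousAt.eventually_lt_const (h.neg.negDefFamily h.hermitian v hv0)
  have hdense : DenseRange fun u : Fin κ → X => fun i => Ψ (u i) :=
    DenseRange.piMap fun _ => hΨ
  obtain ⟨_, hd, u, rfl⟩ := (mem_closure_iff_nhds.mp (hdense e)) _ hev
  refine ⟨u, fun v hv => ?_⟩
  have hn : ‖v‖ ≠ 0 := norm_ne_zero_iff.mpr hv
  have h1 := hd ((‖v‖⁻¹ : ℝ) • v) (by simp [norm_smul, hn])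
  simp only [Φ] at h1
  rw [← op_coe_smul, map_smul, op_coe_smul, h.hermitian.real_smul_left, h.hermitian.real_smul_right,
    Quaternion.re_smul, Quaternion.re_smul, smul_eq_mul, smul_eq_mul, ← mul_assoc] at h1
  have h2 : 0 < ‖v‖⁻¹ * ‖v‖⁻¹ := by positivity
  have h3 := (pos_iff_neg_of_mul_neg h1).mp h2
  change (B (Ψ (rightComb u v)) (Ψ (rightComb u v))).re < 0
  rw [map_rightComb]
  exact h3

end IsPontryaginModel

/-! ### Pontryagin spaces are complete models -/

theorem IsPontryaginModel.norm_sq_add_comb {κ : ℕ} {E : Type*} [NormedAddCommGroup E]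
    [InnerProductSpace ℝ E] [Module ℍ[ℝ]ᵐᵒᵖ E] {B : E → E → ℍ[ℝ]} {e : Fin κ → E}
    (h : IsPontryaginModel B e) {p : E} (hp : p ∈ h.posPart) (a : Fin κ → ℍ[ℝ]) :
    ‖p + rightComb e a‖ ^ 2 = (B p p).re + ∑ i, ‖a i‖ ^ 2 := by
  have h1 : B p (rightComb e a) = 0 := h.form_pos_neg hp (LinearMap.mem_range_self _ _)
  have h2 : B (rightComb e a) p = 0 := by rw [← h.hermitian.star_eq, h1, star_zero]
  have h3 := h.neg.comb_self h.hermitian a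
  rw [h.norm_sq]
  simp only [h.hermitian.add_left, h.hermitian.add_right, h1, h2, h.mem_posPart.mp hp,
    h.neg.comb_left h.hermitian, Quaternion.re_add, add_zero, zero_add, norm_neg]
  rw [h3]
  ring

/-- A model is complete as soon as the orthogonal complement of its frame is. -/
theorem IsPontryaginModel.completeSpace {κ : ℕ} {E : Type*} [NormedAddCommGroup E]
    [InnerProductSpace ℝ E] [Module ℍ[ℝ]ᵐᵒᵖ E] {B : E → E → ℍ[ℝ]} {e : Fin κ → E}
    (h : IsPontryaginModel B e) (hp : IsHilbertOn B h.posPart) : CompleteSpace E := by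
  refine Metric.complete_of_cauchySeq_tendsto fun u hu => ?_
  let p : ℕ → E := fun n => u n - rightComb e fun i => -B (u n) (e i)
  have hpp : ∀ n, p n ∈ h.posPart := fun n => sub_comb_orthogonal h.hermitian h.neg (u n)
  have hup : ∀ n, u n = p n + rightComb e fun i => -B (u n) (e i) := fun n => by simp [p]
  have hdiff : ∀ m n, (B (p m - p n) (p m - p n)).re ≤ ‖u m - u n‖ ^ 2 := by
    intro m n
    have h1 : u m - u n = (p m - p n) + rightComb e
        ((fun i => -B (u m) (e i)) - fun i => -B (u n) (e i)) := by
      rw [map_sub]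
      conv_lhs => rw [hup m, hup n]
      abel
    rw [h1, h.norm_sq_add_comb (h.posPart.sub_mem (hpp m) (hpp n))]
    have : 0 ≤ ∑ i, ‖((fun i => -B (u m) (e i)) - fun i => -B (u n) (e i)) i‖ ^ 2 :=
      Finset.sum_nonneg fun i _ => by positivity
    linarith
  obtain ⟨q, hq, hlim⟩ := hp.complete p hpp (by
    intro ε hε
    obtain ⟨n₀, hn₀⟩ := Metric.cauchySeq_iff.mp hu (√ε) (Real.sqrt_pos.mpr hε)
    refine ⟨n₀, fun m hm n hn => (hdiff m n).trans_lt ?_⟩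
    have := hn₀ m hm n hn
    rw [dist_eq_norm] at this
    rw [← Real.sq_sqrt hε.le]
    exact pow_lt_pow_left₀ this (norm_nonneg _) two_ne_zero)
  have hcoef : ∀ i, ∃ a, Tendsto (fun n => -B (u n) (e i)) atTop (𝓝 a) := by
    intro i
    refine cauchySeq_tendsto_of_complete (Metric.cauchySeq_iff.mpr fun ε hε => ?_)
    obtain ⟨n₀, hn₀⟩ := Metric.cauchySeq_iff.mp hu ε hε
    refine ⟨n₀, fun m hm n hn => lt_of_le_of_lt ?_ (hn₀ m hm n hn)⟩
    have := h.norm_form_frame_le (u m - u n) i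
    rw [h.hermitian.sub_left] at this
    rwa [dist_neg_neg, dist_eq_norm, dist_eq_norm]
  choose a ha using hcoef
  refine ⟨q + rightComb e a, tendsto_iff_norm_sub_tendsto_zero.mpr ?_⟩
  have h2 : ∀ n, ‖u n - (q + rightComb e a)‖ ^ 2 =
      (B (p n - q) (p n - q)).re + ∑ i, ‖-B (u n) (e i) - a i‖ ^ 2 := by
    intro n
    have h1 : u n - (q + rightComb e a) = (p n - q) + rightComb e
        ((fun i => -B (u n) (e i)) - a) := by
      rw [map_sub]
      conv_lhs => rw [hup n]
      abel
    rw [h1, h.norm_sq_add_comb (h.posPart.sub_mem (hpp n) hq)]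
    rfl
  have h3 : Tendsto (fun n => ‖u n - (q + rightComb e a)‖ ^ 2) atTop (𝓝 0) := by
    simp only [h2]
    have : ∀ i ∈ Finset.univ, Tendsto (fun n => ‖-B (u n) (e i) - a i‖ ^ 2) atTop (𝓝 0) := by
      intro i _
      simpa using (tendsto_iff_norm_sub_tendsto_zero.mp (ha i)).pow 2
    simpa using hlim.add (tendsto_finsetSum _ this)
  have h4 := (Real.continuous_sqrt.tendsto 0).comp h3
  rw [Real.sqrt_zero] at h4
  refine h4.congr fun n => ?_
  simp [Real.sqrt_sq (norm_nonneg _)]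

/-- The negative part of a fundamental decomposition has an orthonormal basis, whose orthogonal
complement is the positive part. -/
theorem IsFundamentalDecomposition.exists_negOrthonormal {P : Type*} [AddCommGroup P]
    [Module ℍ[ℝ]ᵐᵒᵖ P] {B : P → P → ℍ[ℝ]} {Pp Pm : Submodule ℍ[ℝ]ᵐᵒᵖ P}
    (hB : IsHermitianForm B) (h : IsFundamentalDecomposition B Pp Pm) {κ : ℕ}
    (hκ : Module.finrank ℍ[ℝ]ᵐᵒᵖ Pm = κ) :
    ∃ e : Fin κ → P, NegOrthonormal B e ∧ ∀ f, (∀ i, B f (e i) = 0) ↔ f ∈ Pp := by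
  have := h.finite_neg
  let b : Module.Basis (Fin κ) ℍ[ℝ]ᵐᵒᵖ Pm := Module.finBasisOfFinrankEq _ _ hκ
  have hb : ∀ v, rightComb (fun i => (b i : P)) v = Pm.subtype (rightComb b v) := by
    intro v; rw [map_rightComb]; rfl
  have hneg : NegDefFamily B (fun i => (b i : P)) := by
    intro v hv
    have h0 : rightComb b v ≠ 0 := by
      intro h0
      refine hv (funext fun i => ?_)
      exact op_injective (Fintype.linearIndependent_iff.mp b.linearIndependent
        (fun i => op (v i)) h0 i)
    have h1 := h.hilbert_neg.pos _ (rightComb b v).2 (by simpa using h0)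
    rw [Quaternion.re_neg] at h1
    rw [hb]
    exact neg_pos.mp h1
  obtain ⟨e, he, heb⟩ := hneg.exists_negOrthonormal hB
  have hePm : ∀ i, e i ∈ Pm := by
    intro i
    obtain ⟨v, hv⟩ := heb i
    rw [← hv, hb]
    exact (rightComb b v).2
  have hrange : LinearMap.range (rightComb e) = Pm := by
    refine Submodule.eq_of_le_of_finrank_eq ?_ ?_
    · rintro _ ⟨v, rfl⟩
      rw [rightComb_apply]
      exact Submodule.sum_mem _ fun i _ => Submodule.smul_mem _ _ (hePm i)
    · rw [LinearMap.finrank_range_of_inj, finrank_columns, hκ]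
      rw [← LinearMap.ker_eq_bot, LinearMap.ker_eq_bot']
      intro v hv
      ext1 i
      have := he.comb_left hB v i
      rw [hv, hB.zero_left] at this
      simpa using this.symm
  refine ⟨e, he, fun f => ⟨fun hf => ?_, fun hf i => h.orthogonal f hf _ (hePm i)⟩⟩
  have hsum := Submodule.projection_add_projection_eq_self h.isCompl f
  simp only [← Submodule.coe_projectionOnto_apply] at hsum
  set p := Pp.projectionOnto Pm h.isCompl f
  set q := Pm.projectionOnto Pp h.isCompl.symm f
  obtain ⟨v, hv⟩ : (q : P) ∈ LinearMap.range (rightComb e) := by rw [hrange]; exact q.2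
  have hv0 : v = 0 := by
    ext1 i
    have h1 := hf i
    rw [← hsum, hB.add_left, h.orthogonal _ p.2 _ (hePm i), zero_add, ← hv,
      he.comb_left hB] at h1
    simpa using h1
  rw [← hsum, ← hv, hv0, map_zero, add_zero]
  exact p.2

/-- A property of all complete models holds for all Pontryagin spaces. -/
theorem IsPontryaginSpace.of_model {κ : ℕ} {P : Type} [i₁ : AddCommGroup P]
    [i₂ : Module ℍ[ℝ]ᵐᵒᵖ P] {B : P → P → ℍ[ℝ]} (h : IsPontryaginSpace B κ)
    (motive : ∀ (E : Type) [AddCommGroup E] [Module ℍ[ℝ]ᵐᵒᵖ E], (E → E → ℍ[ℝ]) → Prop)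
    (hm : ∀ (E : Type) [NormedAddCommGroup E] [InnerProductSpace ℝ E] [CompleteSpace E]
      [Module ℍ[ℝ]ᵐᵒᵖ E] [IsScalarTower ℝ ℍ[ℝ]ᵐᵒᵖ E] (B : E → E → ℍ[ℝ]) (e : Fin κ → E),
      IsPontryaginModel B e → motive E B) : motive P B := by
  obtain ⟨hB, Pp, Pm, hd, hκ⟩ := h
  obtain ⟨e, he, heP⟩ := hd.exists_negOrthonormal hB hκ
  have hnonneg : ∀ f ∈ Pp, 0 ≤ (B f f).re := by
    intro f hf
    by_cases hf0 : f = 0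
    · rw [hf0, hB.zero_left, Quaternion.re_zero]
    · exact (hd.hilbert_pos.pos f hf hf0).le
  have hframe : IsFrame B e := ⟨he, fun f hf => hnonneg f ((heP f).mp hf)⟩
  let _ : Module ℝ P := Module.compHom P (algebraMap ℝ ℍ[ℝ]ᵐᵒᵖ)
  have _ : IsScalarTower ℝ ℍ[ℝ]ᵐᵒᵖ P := ⟨fun r a f => by
    rw [Algebra.smul_def, mul_smul]; rfl⟩
  let c : InnerProductSpace.Core ℝ P :=
    { hframe.core hB with
      definite := fun f hf => by
        have h0 : (frameForm B e f f).re = 0 := hf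
        have h1 := re_self_decompose hB he f
        set p := f - rightComb e (fun i => -B f (e i)) with hp
        have hpP : p ∈ Pp := (heP p).mp (sub_comb_orthogonal hB he f)
        have h2 := hnonneg p hpP
        have h3 : 0 ≤ ∑ i, ‖B f (e i)‖ ^ 2 := Finset.sum_nonneg fun i _ => by positivity
        rw [frameForm_re_self] at h0
        have h4 : ∑ i, ‖B f (e i)‖ ^ 2 = 0 := by linarith
        have h5 : ∀ i, B f (e i) = 0 := fun i => by
          have := (Finset.sum_eq_zero_iff_of_nonneg fun i _ => by positivity).mp h4 i
            (Finset.mem_univ i)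
          simpa using this
        by_contra hf0
        have := hd.hilbert_pos.pos f ((heP f).mp h5) hf0
        linarith }
  let _ : NormedAddCommGroup P := @InnerProductSpace.Core.toNormedAddCommGroup ℝ P _ _ _ c
  let _ : InnerProductSpace ℝ P := InnerProductSpace.ofCore c.toCore
  have hmodel : IsPontryaginModel B e := ⟨hB, he, fun f g => rfl⟩
  have hpos : hmodel.posPart = Pp := by
    ext f; exact heP f
  have : CompleteSpace P := hmodel.completeSpace (by rw [hpos]; exact hd.hilbert_pos)
  exact hm P B e hmodel

/-! ### The star resolvent -/

section StarResolvent

variable {P : Type*} [AddCommGroup P] [Module ℍ[ℝ]ᵐᵒᵖ P] {N : ℕ}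

theorem realScalar_apply (t : ℝ) (v : P) : realScalar t v = op (t : ℍ[ℝ]) • v := rfl

theorem spherePencil_apply (V : Module.End ℍ[ℝ]ᵐᵒᵖ P) (p : ℍ[ℝ]) (v : P) :
    spherePencil V p v = op ((‖p‖ ^ 2 : ℝ) : ℍ[ℝ]) • V (V v)
      - op ((2 * p.re : ℝ) : ℍ[ℝ]) • V v + v := by
  simp only [spherePencil, LinearMap.add_apply, LinearMap.sub_apply, Module.End.mul_apply,
    realScalar_apply, pow_two, Module.End.one_apply]

theorem spherePencil_commute (V : Module.End ℍ[ℝ]ᵐᵒᵖ P) (p : ℍ[ℝ]) (v : P) :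
    spherePencil V p (V v) = V (spherePencil V p v) := by
  simp only [spherePencil_apply, map_add, map_sub, map_smul]

/-- A vector in the range of the pencil, and the value of the resolvent there. -/
theorem starResolvent_spherePencil (C : P →ₗ[ℍ[ℝ]ᵐᵒᵖ] (Fin N → ℍ[ℝ])) {V : Module.End ℍ[ℝ]ᵐᵒᵖ P}
    {p : ℍ[ℝ]} (hp : IsUnit (spherePencil V p)) (v : P) :
    starResolvent C V p (spherePencil V p v) = C v - star p • C (V v) := by
  have h : (Ring.inverse (spherePencil V p)) (spherePencil V p v) = v := by
    rw [← Module.End.mul_apply, Ring.inverse_mul_cancel _ hp, Module.End.one_apply]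
  rw [starResolvent, LinearMap.comp_apply, h]
  rfl

theorem exists_spherePencil_eq {V : Module.End ℍ[ℝ]ᵐᵒᵖ P} {p : ℍ[ℝ]}
    (hp : IsUnit (spherePencil V p)) (f : P) : ∃ v, spherePencil V p v = f :=
  ((Module.End.isUnit_iff _).mp hp).2 f

theorem starResolvent_comp (C : P →ₗ[ℍ[ℝ]ᵐᵒᵖ] (Fin N → ℍ[ℝ])) {V : Module.End ℍ[ℝ]ᵐᵒᵖ P}
    {p : ℍ[ℝ]} (hp : IsUnit (spherePencil V p)) (f : P) :
    starResolvent (C ∘ₗ V) V p f = starResolvent C V p (V f) := by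
  obtain ⟨v, rfl⟩ := exists_spherePencil_eq hp f
  rw [← spherePencil_commute, starResolvent_spherePencil _ hp, starResolvent_spherePencil _ hp]
  rfl

/-- The relation `E = C + p E V` for the resolvent `E = C ⋆ (I - pV)^{-⋆}`. -/
theorem starResolvent_eq (C : P →ₗ[ℍ[ℝ]ᵐᵒᵖ] (Fin N → ℍ[ℝ])) {V : Module.End ℍ[ℝ]ᵐᵒᵖ P}
    {p : ℍ[ℝ]} (hp : IsUnit (spherePencil V p)) (f : P) :
    starResolvent C V p f = C f + p • starResolvent C V p (V f) := by
  obtain ⟨v, rfl⟩ := exists_spherePencil_eq hp f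
  rw [← spherePencil_commute, starResolvent_spherePencil _ hp, starResolvent_spherePencil _ hp,
    spherePencil_apply]
  ext1 i
  simp only [map_add, map_sub, map_smul, Pi.add_apply, Pi.sub_apply, Pi.smul_apply, smul_eq_mul,
    MulOpposite.smul_eq_mul_unop, unop_op]
  rw [← self_mul_star_eq, ← add_star_eq]
  have h1 : C (V (V v)) i * (p * star p) = p * (star p * C (V (V v)) i) := by
    rw [self_mul_star_eq, ← Quaternion.coe_commutes, ← self_mul_star_eq, mul_assoc]
  have h2 : C (V v) i * (p + star p) = p * C (V v) i + star p * C (V v) i := by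
    rw [add_star_eq, ← Quaternion.coe_commutes, ← add_star_eq, add_mul]
  rw [h1, h2, mul_sub]
  abel

theorem starCayley_eq (C : P →ₗ[ℍ[ℝ]ᵐᵒᵖ] (Fin N → ℍ[ℝ])) {V : Module.End ℍ[ℝ]ᵐᵒᵖ P}
    {p : ℍ[ℝ]} (hp : IsUnit (spherePencil V p)) (f : P) :
    starCayley C V p f = (2 : ℝ) • starResolvent C V p f - C f := by
  rw [starCayley, LinearMap.add_apply, LinearMap.smul_apply, starResolvent_comp _ hp, two_smul]
  nth_rewrite 3 [starResolvent_eq C hp f]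
  abel

end StarResolvent

/-! ### The kernel as the solution of a Stein equation -/

theorem summable_stein {p q r : ℍ[ℝ]} (hpq : ‖p‖ * ‖q‖ < 1) :
    Summable fun l : ℕ => p ^ l * r * q ^ l := by
  refine Summable.of_norm_bounded (g := fun l => ‖r‖ * (‖p‖ * ‖q‖) ^ l)
    ((summable_geometric_of_lt_one (by positivity) hpq).mul_left _) fun l => ?_
  rw [norm_mul, norm_mul, norm_pow, norm_pow, mul_pow]
  exact le_of_eq (by ring)

/-- The Stein equation `x = p x q + r` has a unique solution, given by a series. -/
theorem hasSum_of_stein {p q x r : ℍ[ℝ]} (hpq : ‖p‖ * ‖q‖ < 1) (hx : x = p * x * q + r) :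
    HasSum (fun l : ℕ => p ^ l * r * q ^ l) x := by
  have hpartial : ∀ n : ℕ, ∑ l ∈ Finset.range n, p ^ l * r * q ^ l = x - p ^ n * x * q ^ n := by
    intro n
    induction n with
    | zero => simp
    | succ n ih =>
      rw [Finset.sum_range_succ, ih]
      have : p ^ n * x * q ^ n = p ^ (n + 1) * x * q ^ (n + 1) + p ^ n * r * q ^ n := by
        conv_lhs => rw [hx]
        rw [pow_succ, pow_succ', mul_add, add_mul]
        simp only [mul_assoc]
      rw [this]
      abel
  refine ((summable_stein hpq).hasSum_iff_tendsto_nat).mpr ?_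
  simp only [hpartial]
  have h0 : Tendsto (fun n : ℕ => p ^ n * x * q ^ n) atTop (𝓝 0) := by
    refine squeeze_zero_norm (a := fun n => ‖x‖ * (‖p‖ * ‖q‖) ^ n) (fun n => ?_) ?_
    · rw [norm_mul, norm_mul, norm_pow, norm_pow, mul_pow]
      exact le_of_eq (by ring)
    · simpa using (tendsto_pow_atTop_nhds_zero_of_lt_one (by positivity) hpq).const_mul ‖x‖
  simpa using tendsto_const_nhds.sub h0

theorem caratheodoryKernel_apply_eq {N : ℕ} {J : Matrix (Fin N) (Fin N) ℍ[ℝ]}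
    {φ : ℍ[ℝ] → Matrix (Fin N) (Fin N) ℍ[ℝ]} {p q x : ℍ[ℝ]} (hpq : ‖p‖ * ‖q‖ < 1) {i j : Fin N}
    (hx : x = p * x * star q + (φ p * J + J * (φ q)ᴴ) i j) :
    caratheodoryKernel J φ p q i j = x := by
  rw [caratheodoryKernel, Matrix.of_apply]
  exact (hasSum_of_stein (by rwa [norm_star]) hx).tsum_eq

theorem norm_mul_norm_lt_one {p q : ℍ[ℝ]} (hp : p ∈ Metric.ball (0 : ℍ[ℝ]) 1)
    (hq : q ∈ Metric.ball (0 : ℍ[ℝ]) 1) : ‖p‖ * ‖q‖ < 1 := by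
  rw [mem_ball_zero_iff] at hp hq
  exact mul_lt_one_of_nonneg_of_lt_one_left (norm_nonneg _) hp hq.le

theorem caratheodoryKernel_conjTranspose {N : ℕ} {J : Matrix (Fin N) (Fin N) ℍ[ℝ]}
    (hJ : Jᴴ = J) (φ : ℍ[ℝ] → Matrix (Fin N) (Fin N) ℍ[ℝ]) (p q : ℍ[ℝ]) :
    caratheodoryKernel J φ p q = (caratheodoryKernel J φ q p)ᴴ := by
  ext1 i j
  have h1 : (φ p * J + J * (φ q)ᴴ) i j = star ((φ q * J + J * (φ p)ᴴ) j i) := by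
    rw [← Matrix.conjTranspose_apply, Matrix.conjTranspose_add, Matrix.conjTranspose_mul,
      Matrix.conjTranspose_mul, hJ, Matrix.conjTranspose_conjTranspose, add_comm]
  rw [Matrix.conjTranspose_apply]
  simp only [caratheodoryKernel, Matrix.of_apply]
  rw [tsum_star]
  refine tsum_congr fun l => ?_
  rw [h1]
  simp [mul_assoc]

/-! ### Families of vectors indexed by a set of points -/

/-- A right linear map between columns, read off from the unit columns. -/
theorem columns_map_eq_mulVec {N : ℕ} (T : (Fin N → ℍ[ℝ]) →ₗ[ℍ[ℝ]ᵐᵒᵖ] (Fin N → ℍ[ℝ]))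
    (c : Fin N → ℍ[ℝ]) :
    T c = (Matrix.of fun i j => T (Pi.single j 1) i) *ᵥ c := by
  conv_lhs => rw [eq_rightComb_single c]
  rw [map_rightComb, rightComb_apply]
  ext1 i
  simp [Matrix.mulVec, dotProduct]

theorem star_dotProduct_smul {N : ℕ} (q : ℍ[ℝ]) (c x : Fin N → ℍ[ℝ]) :
    star c ⬝ᵥ (q • x) = star (star q • c) ⬝ᵥ x := by
  simp [dotProduct, mul_assoc]

theorem smul_single_eq_op_smul {N : ℕ} (q : ℍ[ℝ]) (j : Fin N) :
    q • (Pi.single j 1 : Fin N → ℍ[ℝ]) = op q • (Pi.single j 1 : Fin N → ℍ[ℝ]) := by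
  ext1 i
  by_cases h : i = j
  · subst h; simp
  · simp [h]

theorem form_lsum_eq_kernelForm {N : ℕ} {E : Type*} [AddCommGroup E] [Module ℍ[ℝ]ᵐᵒᵖ E]
    {B : E → E → ℍ[ℝ]} (hB : IsHermitianForm B)
    {K : ℍ[ℝ] → ℍ[ℝ] → Matrix (Fin N) (Fin N) ℍ[ℝ]} {Ω : Set ℍ[ℝ]}
    (k : Ω → (Fin N → ℍ[ℝ]) →ₗ[ℍ[ℝ]ᵐᵒᵖ] E)
    (hk : ∀ (p q : Ω) (c d : Fin N → ℍ[ℝ]), B (k q c) (k p d) = star d ⬝ᵥ (K p q *ᵥ c))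
    (f g : Ω →₀ (Fin N → ℍ[ℝ])) :
    B (Finsupp.lsum ℕ k f) (Finsupp.lsum ℕ k g) = kernelForm K Ω f g := by
  simp only [Finsupp.lsum_apply, Finsupp.sum, kernelForm]
  rw [hB.sum_right]
  refine Finset.sum_congr rfl fun p _ => ?_
  rw [hB.sum_left]
  exact Finset.sum_congr rfl fun q _ => hk p q _ _

theorem IsPontryaginModel.continuous_spherePencil {κ : ℕ} {E : Type*} [NormedAddCommGroup E]
    [InnerProductSpace ℝ E] [Module ℍ[ℝ]ᵐᵒᵖ E] {B : E → E → ℍ[ℝ]} {e : Fin κ → E}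
    (h : IsPontryaginModel B e) {V : Module.End ℍ[ℝ]ᵐᵒᵖ E}
    (hV : Continuous V) (p : ℍ[ℝ]) : Continuous (spherePencil V p) := by
  have : (spherePencil V p : E → E) = fun v => op ((‖p‖ ^ 2 : ℝ) : ℍ[ℝ]) • V (V v)
      - op ((2 * p.re : ℝ) : ℍ[ℝ]) • V v + v := by
    ext1 v; exact spherePencil_apply V p v
  rw [this]
  have := h.isBoundedSMul
  exact (((hV.comp hV).const_smul _).sub (hV.const_smul _)).add continuous_id

/-- The resolvent at small real points is bounded uniformly. -/
theorem exists_bound_starResolvent {E : Type*} [NormedAddCommGroup E] [NormedSpace ℝ E]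
    [Module ℍ[ℝ]ᵐᵒᵖ E] [IsScalarTower ℝ ℍ[ℝ]ᵐᵒᵖ E] {N : ℕ}
    {V : Module.End ℍ[ℝ]ᵐᵒᵖ E} (hV : Continuous V) {C : E →ₗ[ℍ[ℝ]ᵐᵒᵖ] (Fin N → ℍ[ℝ])}
    (hC : Continuous C) (g : E) :
    ∃ c : ℝ, ∀ᶠ t : ℝ in 𝓝 0, IsUnit (spherePencil V (t : ℍ[ℝ])) →
      ‖starResolvent C V (t : ℍ[ℝ]) g‖ ≤ c := by
  let V' : E →L[ℝ] E := ⟨V.restrictScalars ℝ, hV⟩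
  let C' : E →L[ℝ] (Fin N → ℍ[ℝ]) := ⟨C.restrictScalars ℝ, hC⟩
  have hV' : ∀ f, ‖V f‖ ≤ ‖V'‖ * ‖f‖ := V'.le_opNorm
  have hC' : ∀ f, ‖C f‖ ≤ ‖C'‖ * ‖f‖ := C'.le_opNorm
  set m := ‖V'‖
  have hm : 0 ≤ m := norm_nonneg _
  refine ⟨‖C'‖ * (1 + m) * (2 * ‖g‖), ?_⟩
  have hev : ∀ᶠ t : ℝ in 𝓝 0, t ^ 2 * m ^ 2 + 2 * |t| * m < 1 / 2 ∧ |t| < 1 := by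
    have c1 : Continuous fun t : ℝ => t ^ 2 * m ^ 2 + 2 * |t| * m := by fun_prop
    have c2 : Continuous fun t : ℝ => |t| := continuous_abs
    exact (c1.continuousAt.eventually_lt_const (by simp)).and
      (c2.continuousAt.eventually_lt_const (by simp))
  filter_upwards [hev] with t ht hunit
  obtain ⟨v, rfl⟩ := exists_spherePencil_eq hunit g
  set g := spherePencil V (t : ℍ[ℝ]) v with hg
  have hv : ‖v‖ ≤ 2 * ‖g‖ := by
    have h1 : v = g - t ^ 2 • V (V v) + (2 * t) • V v := by
      rw [hg, spherePencil_apply, op_coe_smul, op_coe_smul, Quaternion.norm_coe,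
        Quaternion.re_coe, Real.norm_eq_abs, sq_abs]
      abel
    have h2 : ‖v‖ ≤ ‖g‖ + t ^ 2 * (m * (m * ‖v‖)) + 2 * |t| * (m * ‖v‖) := by
      calc ‖v‖ = ‖g - t ^ 2 • V (V v) + (2 * t) • V v‖ := by rw [← h1]
        _ ≤ ‖g‖ + ‖t ^ 2 • V (V v)‖ + ‖(2 * t) • V v‖ :=
          (norm_add_le _ _).trans (by gcongr; exact norm_sub_le _ _)
        _ ≤ _ := by
          rw [norm_smul, norm_smul, Real.norm_eq_abs, Real.norm_eq_abs, abs_of_nonneg (sq_nonneg t),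
            abs_mul, abs_two]
          gcongr
          · exact (hV' _).trans (by gcongr; exact hV' v)
          · exact hV' v
    have h3 : (t ^ 2 * m ^ 2 + 2 * |t| * m) * ‖v‖ ≤ 1 / 2 * ‖v‖ :=
      mul_le_mul_of_nonneg_right ht.1.le (norm_nonneg _)
    have h4 : t ^ 2 * (m * (m * ‖v‖)) + 2 * |t| * (m * ‖v‖)
        = (t ^ 2 * m ^ 2 + 2 * |t| * m) * ‖v‖ := by ring
    linarith
  rw [starResolvent_spherePencil _ hunit]
  calc ‖C v - star (t : ℍ[ℝ]) • C (V v)‖ ≤ ‖C v‖ + ‖star (t : ℍ[ℝ]) • C (V v)‖ := norm_sub_le _ _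
    _ ≤ ‖C'‖ * ‖v‖ + 1 * (‖C'‖ * (m * ‖v‖)) := by
      rw [norm_smul, norm_star, Quaternion.norm_coe, Real.norm_eq_abs]
      gcongr
      · exact hC' v
      · exact ht.2.le
      · exact (hC' _).trans (by gcongr; exact hV' v)
    _ = ‖C'‖ * (1 + m) * ‖v‖ := by ring
    _ ≤ _ := by gcongr

/-- For an observable pair, a vector annihilated by the resolvents at all points near the origin
vanishes. -/
theorem eq_zero_of_starResolvent {E : Type*} [NormedAddCommGroup E] [NormedSpace ℝ E]
    [Module ℍ[ℝ]ᵐᵒᵖ E] [IsScalarTower ℝ ℍ[ℝ]ᵐᵒᵖ E] {N : ℕ}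
    {V : Module.End ℍ[ℝ]ᵐᵒᵖ E} (hV : Continuous V) {C : E →ₗ[ℍ[ℝ]ᵐᵒᵖ] (Fin N → ℍ[ℝ])}
    (hC : Continuous C) (hobs : IsObservable C V)
    (hunit : ∀ᶠ t : ℝ in 𝓝 0, IsUnit (spherePencil V (t : ℍ[ℝ]))) {f : E}
    (hf : ∀ᶠ t : ℝ in 𝓝[≠] 0, starResolvent C V (t : ℍ[ℝ]) f = 0) : f = 0 := by
  -- `E(t) g = C g + t E(t) V g`, and the last term tends to zero with `t`
  have step : ∀ g, (∀ᶠ t : ℝ in 𝓝[≠] 0, starResolvent C V (t : ℍ[ℝ]) g = 0) →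
      C g = 0 ∧ ∀ᶠ t : ℝ in 𝓝[≠] 0, starResolvent C V (t : ℍ[ℝ]) (V g) = 0 := by
    intro g hg
    have hunit' : ∀ᶠ t : ℝ in 𝓝[≠] 0, IsUnit (spherePencil V (t : ℍ[ℝ])) :=
      hunit.filter_mono nhdsWithin_le_nhds
    have h0 : C g = 0 := by
      obtain ⟨c, hc⟩ := exists_bound_starResolvent hV hC (V g)
      have h1 : ∀ᶠ t : ℝ in 𝓝[≠] 0, ‖C g‖ ≤ |t| * c := by
        filter_upwards [hg, hunit', hc.filter_mono nhdsWithin_le_nhds] with t h1 h2 h3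
        rw [starResolvent_eq C h2, add_eq_zero_iff_eq_neg] at h1
        rw [h1, norm_neg, norm_smul, Quaternion.norm_coe, Real.norm_eq_abs]
        exact mul_le_mul_of_nonneg_left (h3 h2) (abs_nonneg t)
      have h2 : Tendsto (fun t : ℝ => |t| * c) (𝓝[≠] 0) (𝓝 0) := by
        have : Continuous fun t : ℝ => |t| * c := by fun_prop
        simpa using (this.tendsto 0).mono_left nhdsWithin_le_nhds
      exact norm_le_zero_iff.mp (ge_of_tendsto h2 h1)
    refine ⟨h0, ?_⟩
    filter_upwards [hg, hunit', self_mem_nhdsWithin] with t h1 h2 h3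
    rw [starResolvent_eq C h2, h0, zero_add] at h1
    exact (smul_eq_zero.mp h1).resolve_left fun h4 => h3 (Quaternion.coe_injective h4)
  refine hobs f fun n => ?_
  have : ∀ n : ℕ, ∀ᶠ t : ℝ in 𝓝[≠] 0, starResolvent C V (t : ℍ[ℝ]) ((V ^ n) f) = 0 := by
    intro n
    induction n with
    | zero => simpa using hf
    | succ n ih =>
      rw [pow_succ']
      exact (step _ ih).2
  exact (step _ (this n)).1

namespace IsPontryaginModel

variable {κ : ℕ} {E : Type*} [NormedAddCommGroup E] [InnerProductSpace ℝ E]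
  [Module ℍ[ℝ]ᵐᵒᵖ E] [IsScalarTower ℝ ℍ[ℝ]ᵐᵒᵖ E] [CompleteSpace E]
  {B : E → E → ℍ[ℝ]} {e : Fin κ → E}

/-- A bounded operator to the columns has an adjoint. -/
theorem exists_isAdjointToColumns (h : IsPontryaginModel B e) {N : ℕ}
    {T : E →ₗ[ℍ[ℝ]ᵐᵒᵖ] (Fin N → ℍ[ℝ])} (hT : Continuous T) :
    ∃ T' : (Fin N → ℍ[ℝ]) →ₗ[ℍ[ℝ]ᵐᵒᵖ] E, IsAdjointToColumns B T T' := by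
  have key : ∀ d : Fin N → ℍ[ℝ], ∃ g, ∀ w, B w g = star d ⬝ᵥ T w := fun d => by
    let l : E →ₗ[ℍ[ℝ]ᵐᵒᵖ] ℍ[ℝ] :=
      { toFun := fun w => star d ⬝ᵥ T w
        map_add' := fun v w => by rw [map_add, dotProduct_add]
        map_smul' := fun a w => by
          rw [map_smul, ← op_unop a, dotProduct_op_smul]; rfl }
    exact h.exists_form_eq l ((continuous_star_dotProduct d).comp hT)
  choose T' hT' using key
  refine ⟨{ toFun := T', map_add' := fun f g => ?_, map_smul' := fun a f => ?_ }, fun f d => ?_⟩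
  · refine h.eq_of_form fun w => ?_
    rw [hT', h.hermitian.add_right, hT', hT', star_add, add_dotProduct]
  · refine h.eq_of_form fun w => ?_
    rw [RingHom.id_apply, hT', ← op_unop a, h.hermitian.smul_right, hT',
      ← star_dotProduct_quaternion, dotProduct_op_smul, star_mul, star_dotProduct_quaternion]
  · exact (hT' d f).symm

/-- A right linear map whose range has trivial orthogonal complement has dense range. -/
theorem denseRange_of_total (h : IsPontryaginModel B e) {X : Type*} [AddCommGroup X]
    [Module ℍ[ℝ]ᵐᵒᵖ X] (Ψ : X →ₗ[ℍ[ℝ]ᵐᵒᵖ] E) (hΨ : ∀ g, (∀ f, B (Ψ f) g = 0) → g = 0) :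
    DenseRange Ψ := by
  let M : Submodule ℝ E := (LinearMap.range Ψ).restrictScalars ℝ
  have hM : Mᗮ = ⊥ := by
    rw [eq_bot_iff]
    intro g hg
    have h1 : ∀ f, frameForm B e f g = B f (g + (2 : ℝ) • rightComb e fun i => B g (e i)) := by
      intro f
      rw [h.hermitian.add_right, h.hermitian.real_smul_right, h.hermitian.comb_right, frameForm]
    have h2 : g + (2 : ℝ) • rightComb e (fun i => B g (e i)) = 0 := by
      refine hΨ _ fun f => quaternion_ext_re_mul fun a => ?_
      rw [← h.hermitian.smul_left, ← h1, ← h.inner_eq, zero_mul, Quaternion.re_zero]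
      exact hg _ ⟨op a • f, map_smul _ _ _⟩
    have h3 : inner ℝ g g = 0 := by
      rw [h.inner_eq, h1, h2, h.hermitian.zero_right, Quaternion.re_zero]
    exact (Submodule.mem_bot ℝ).mpr (inner_self_eq_zero.mp h3)
  have := (Submodule.topologicalClosure_eq_top_iff (K := M)).mpr hM
  rw [DenseRange, dense_iff_closure_eq]
  exact congrArg (fun S : Submodule ℝ E => (S : Set E)) this

/-- The resolvent is bounded, by the open mapping theorem. -/
theorem continuous_starResolvent (h : IsPontryaginModel B e) {N : ℕ}
    {V : Module.End ℍ[ℝ]ᵐᵒᵖ E} (hV : Continuous V) {C : E →ₗ[ℍ[ℝ]ᵐᵒᵖ] (Fin N → ℍ[ℝ])}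
    (hC : Continuous C) {p : ℍ[ℝ]} (hp : IsUnit (spherePencil V p)) :
    Continuous (starResolvent C V p) := by
  have hbij := (Module.End.isUnit_iff _).mp hp
  let Q := LinearEquiv.ofBijective ((spherePencil V p).restrictScalars ℝ) hbij
  have hQ : Continuous Q.symm := Q.continuous_symm (h.continuous_spherePencil hV p)
  have h1 : ∀ f, starResolvent C V p f = C (Q.symm f) - star p • C (V (Q.symm f)) := by
    intro f
    rw [← starResolvent_spherePencil C hp]
    congr 1
    exact (Q.apply_symm_apply f).symm
  have h2 : (starResolvent C V p : E → Fin N → ℍ[ℝ]) =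
      fun f => C (Q.symm f) - star p • C (V (Q.symm f)) := funext h1
  rw [h2]
  exact (hC.comp hQ).sub ((hC.comp (hV.comp hQ)).fun_const_smul _)

/-- A function with a realization by an observable co-isometric pair in a model of index `κ` has a
kernel with `κ` negative squares: the kernel is the Gram kernel of the adjoints of the
resolvents. -/
theorem hasNegativeSquares_of_realization (h : IsPontryaginModel B e) {N : ℕ}
    {J : Matrix (Fin N) (Fin N) ℍ[ℝ]} (hJ : IsSignatureMatrix J) {𝒱 : Set ℍ[ℝ]}
    (h𝒱 : 𝒱 ∈ 𝓝 (0 : ℍ[ℝ])) (h𝒱_ball : 𝒱 ⊆ Metric.ball (0 : ℍ[ℝ]) 1)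
    {φ : ℍ[ℝ] → Matrix (Fin N) (Fin N) ℍ[ℝ]} {V V' : Module.End ℍ[ℝ]ᵐᵒᵖ E}
    {C : E →ₗ[ℍ[ℝ]ᵐᵒᵖ] (Fin N → ℍ[ℝ])} {C' : (Fin N → ℍ[ℝ]) →ₗ[ℍ[ℝ]ᵐᵒᵖ] E}
    (hV : IsAdjointEnd B V V') (hVV' : V * V' = 1) (hC : IsAdjointToColumns B C C')
    (hobs : IsObservable C V)
    (hφ : ∀ p ∈ 𝒱, IsUnit (spherePencil V p) ∧ ∀ c : Fin N → ℍ[ℝ],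
      φ p *ᵥ c = (1 / 2 : ℝ) • starCayley C V p (C' (J *ᵥ c))
        + (1 / 2 : ℝ) • ((φ 0 - J * (φ 0)ᴴ * J) *ᵥ c)) :
    HasNegativeSquares (caratheodoryKernel J φ) 𝒱 κ := by
  have hVc := h.continuous_of_isAdjointEnd hV
  have hCc := h.continuous_of_isAdjointToColumns hC
  have hk : ∀ p : 𝒱, ∃ k : (Fin N → ℍ[ℝ]) →ₗ[ℍ[ℝ]ᵐᵒᵖ] E,
      IsAdjointToColumns B (starResolvent C V p) k := fun p =>
    h.exists_isAdjointToColumns (h.continuous_starResolvent hVc hCc (hφ p p.2).1)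
  choose k hk using hk
  -- the adjoint form of the relation `E = C + p E V`
  have hkrec : ∀ (q : 𝒱) c, k q c = C' c + V' (k q (star (q : ℍ[ℝ]) • c)) := by
    intro q c
    refine h.eq_of_form fun f => ?_
    rw [h.hermitian.add_right, ← hV, ← hk, ← hC, ← hk, starResolvent_eq C (hφ q q.2).1,
      dotProduct_add, star_dotProduct_smul]
  have hV'B : ∀ f g, B (V' f) (V' g) = B f g := by
    intro f g
    rw [← hV, ← Module.End.mul_apply, hVV', Module.End.one_apply]
  -- since `V'` is isometric, the Gram kernel of the vectors `k q c` solves a Stein equation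
  have hgram : ∀ (p q : 𝒱) c d, B (k q c) (k p d) =
      B (k q (star (q : ℍ[ℝ]) • c)) (k p (star (p : ℍ[ℝ]) • d))
      + (star d ⬝ᵥ starResolvent C V p (C' c) + star (star c ⬝ᵥ starResolvent C V q (C' d))
        - star d ⬝ᵥ C (C' c)) := by
    intro p q c d
    rw [hk, hk, h.hermitian.star_eq, hC]
    have h1 : B (k q c) (k p d) = B (k q c) (C' d)
        + B (V' (k q (star (q : ℍ[ℝ]) • c))) (V' (k p (star (p : ℍ[ℝ]) • d)))
        + B (C' c) (V' (k p (star (p : ℍ[ℝ]) • d))) := by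
      conv_lhs => rw [hkrec p d, h.hermitian.add_right]
      nth_rewrite 2 [hkrec q c]
      rw [h.hermitian.add_left]
      abel
    have h2 : B (C' c) (k p d) = B (C' c) (C' d)
        + B (C' c) (V' (k p (star (p : ℍ[ℝ]) • d))) := by
      conv_lhs => rw [hkrec p d, h.hermitian.add_right]
    rw [h1, h2, hV'B]
    abel
  -- the skew-Hermitian constant that cancels in `φ(p) J + J φ(q)^*`
  set A := φ 0 * J - J * (φ 0)ᴴ with hA
  have hAskew : ∀ i j, star (A j i) = -A i j := by
    intro i j
    rw [← Matrix.conjTranspose_apply, hA, Matrix.conjTranspose_sub, Matrix.conjTranspose_mul,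
      Matrix.conjTranspose_mul, hJ.1, Matrix.conjTranspose_conjTranspose]
    simp
  have hφJ : ∀ (p : 𝒱) i j, (φ p * J) i j = starResolvent C V p (C' (Pi.single j 1)) i
      - (1 / 2 : ℝ) • C (C' (Pi.single j 1)) i + (1 / 2 : ℝ) • A i j := by
    intro p i j
    have h1 : (φ p * J) i j = (φ p *ᵥ (J *ᵥ Pi.single j 1)) i := by
      rw [Matrix.mulVec_mulVec, Matrix.mulVec_single_one]; rfl
    have h2 : ((φ 0 - J * (φ 0)ᴴ * J) *ᵥ (J *ᵥ Pi.single j 1)) i = A i j := by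
      rw [Matrix.mulVec_mulVec, Matrix.sub_mul, Matrix.mul_assoc (J * (φ 0)ᴴ), hJ.2,
        Matrix.mul_one, Matrix.mulVec_single_one]; rfl
    rw [h1, (hφ p p.2).2, Pi.add_apply, Pi.smul_apply, Pi.smul_apply, h2, Matrix.mulVec_mulVec,
      hJ.2, Matrix.one_mulVec, starCayley_eq C (hφ p p.2).1, Pi.sub_apply, Pi.smul_apply,
      smul_sub, smul_smul]
    norm_num
  have hR : ∀ (p q : 𝒱) i j, (φ p * J + J * (φ q)ᴴ) i j =
      starResolvent C V p (C' (Pi.single j 1)) i + star (starResolvent C V q (C' (Pi.single i 1)) j)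
        - C (C' (Pi.single j 1)) i := by
    intro p q i j
    have h1 : (J * (φ q)ᴴ) i j = star ((φ q * J) j i) := by
      rw [← Matrix.conjTranspose_apply, Matrix.conjTranspose_mul, hJ.1]
    have h2 : star (C (C' (Pi.single i 1)) j) = C (C' (Pi.single j 1)) i := by
      rw [← star_dotProduct_single j (C _), hC, h.hermitian.star_eq, ← hC, star_dotProduct_single]
    rw [Matrix.add_apply, h1, hφJ, hφJ, star_add, star_sub, Quaternion.star_smul,
      Quaternion.star_smul, hAskew, h2]
    simp only [smul_neg]
    have h3 : ∀ x : ℍ[ℝ], x = (1 / 2 : ℝ) • x + (1 / 2 : ℝ) • x := fun x => by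
      rw [← add_smul]; norm_num
    conv_rhs => rw [h3 (C (C' (Pi.single j 1)) i)]
    abel
  have hker : ∀ (p q : 𝒱) i j, caratheodoryKernel J φ p q i j =
      starResolvent C V p (k q (Pi.single j 1)) i := by
    intro p q i j
    refine caratheodoryKernel_apply_eq
      (norm_mul_norm_lt_one (h𝒱_ball p.2) (h𝒱_ball q.2)) ?_
    have h1 := hgram p q (Pi.single j 1) (Pi.single i 1)
    rw [← hk, ← hk, ← star_dotProduct_smul, smul_single_eq_op_smul] at h1
    simp only [star_dotProduct_single] at h1
    rw [map_smul, map_smul, Pi.smul_apply, Pi.smul_apply, smul_eq_mul,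
      MulOpposite.smul_eq_mul_unop, unop_op, ← mul_assoc] at h1
    rw [hR]
    exact h1
  have hkK : ∀ (p q : 𝒱) (c d : Fin N → ℍ[ℝ]),
      B (k q c) (k p d) = star d ⬝ᵥ (caratheodoryKernel J φ p q *ᵥ c) := by
    intro p q c d
    rw [← hk]
    congr 1
    have h1 := columns_map_eq_mulVec (starResolvent C V p ∘ₗ k q) c
    rw [LinearMap.comp_apply] at h1
    rw [h1]
    congr 1
    ext1 i j
    exact (hker p q i j).symm
  let Ψ : (𝒱 →₀ (Fin N → ℍ[ℝ])) →ₗ[ℍ[ℝ]ᵐᵒᵖ] E := Finsupp.lsum ℕ k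
  have hΨ : ∀ f g, B (Ψ f) (Ψ g) = kernelForm (caratheodoryKernel J φ) 𝒱 f g :=
    form_lsum_eq_kernelForm h.hermitian k hkK
  have h𝒱real : ∀ᶠ t : ℝ in 𝓝 0, (t : ℍ[ℝ]) ∈ 𝒱 := by
    have := Quaternion.continuous_coe.tendsto (0 : ℝ)
    exact this h𝒱
  have hdense : DenseRange Ψ := by
    refine h.denseRange_of_total Ψ fun g hg => ?_
    refine eq_zero_of_starResolvent hVc hCc hobs (h𝒱real.mono fun t ht => (hφ _ ht).1) ?_
    refine (h𝒱real.mono fun t ht => ?_).filter_mono nhdsWithin_le_nhds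
    refine eq_of_star_dotProduct fun d => ?_
    have h1 := hg (Finsupp.single ⟨_, ht⟩ d)
    rw [Finsupp.lsum_single, ← h.hermitian.star_eq, ← hk, star_eq_zero] at h1
    rw [h1, dotProduct_zero]
  refine hasNegativeSquares_iff.mpr
    ⟨fun p _ q _ => caratheodoryKernel_conjTranspose hJ.1 φ p q, fun m u hu => ?_, ?_⟩
  · refine h.le_of_negDefFamily (u := fun i => Ψ (u i)) fun v hv => ?_
    rw [← map_rightComb, hΨ]
    exact hu v hv
  · obtain ⟨u, hu⟩ := h.exists_negDefFamily_of_denseRange Ψ hdense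
    refine ⟨u, fun v hv => ?_⟩
    rw [← hΨ]
    exact hu v hv

end IsPontryaginModel

/-! ### Quadratic pencils of contractions up to finite rank -/

/-- The quadratic pencil `r² w² - 2 x w + 1` with roots off the closed unit disc is invertible
for every `w` of norm at most one. The product of the pencils for `x` and `-x` is a
pencil in `w²` with `r` squared, so that finitely many steps reduce to a Neumann series. -/
theorem isUnit_quadratic_of_norm_le_one {A : Type*} [NormedRing A] [NormedAlgebra ℝ A]
    [CompleteSpace A] {x r : ℝ} (hx : |x| ≤ r) (hr : r < 1) {w : A} (hw : ‖w‖ ≤ 1) :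
    IsUnit (r ^ 2 • w ^ 2 - (2 * x) • w + 1) := by
  -- the exponent `n` counts the squarings that are enough to bring `r` below `1 / 4`
  have key : ∀ (n : ℕ) (x r : ℝ) (w : A), |x| ≤ r → r ^ 2 ^ n < 1 / 4 → ‖w‖ ≤ 1 →
      IsUnit (r ^ 2 • w ^ 2 - (2 * x) • w + 1) := by
    intro n
    induction n with
    | zero =>
      intro x r w hx hr hw
      have hr0 : 0 ≤ r := (abs_nonneg x).trans hx
      rw [pow_zero, pow_one] at hr
      have h1 : r ^ 2 • w ^ 2 - (2 * x) • w + 1 = 1 - ((2 * x) • w - r ^ 2 • w ^ 2) := by abel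
      rw [h1]
      refine isUnit_one_sub_of_norm_lt_one ?_
      have h2 : ‖w ^ 2‖ ≤ 1 := by
        rw [pow_two]
        exact (norm_mul_le _ _).trans (mul_le_one₀ hw (norm_nonneg _) hw)
      calc ‖(2 * x) • w - r ^ 2 • w ^ 2‖ ≤ ‖(2 * x) • w‖ + ‖r ^ 2 • w ^ 2‖ := norm_sub_le _ _
        _ ≤ 2 * r * 1 + r ^ 2 * 1 := by
          rw [norm_smul, norm_smul, Real.norm_eq_abs, Real.norm_eq_abs, abs_mul, abs_two,
            abs_of_nonneg (sq_nonneg r)]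
          gcongr
        _ < 1 := by nlinarith
    | succ n ih =>
      intro x r w hx hr hw
      have hr0 : 0 ≤ r := (abs_nonneg x).trans hx
      have hxr : x ^ 2 ≤ r ^ 2 := sq_le_sq' (by linarith [abs_le.mp hx]) (abs_le.mp hx).2
      have h2 : ‖w ^ 2‖ ≤ 1 := by
        rw [pow_two]
        exact (norm_mul_le _ _).trans (mul_le_one₀ hw (norm_nonneg _) hw)
      have h3 := ih (2 * x ^ 2 - r ^ 2) (r ^ 2) (w ^ 2)
        (abs_le.mpr ⟨by nlinarith [sq_nonneg x], by linarith⟩)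
        (by rw [← pow_mul, ← pow_succ']; exact hr) h2
      have h4 : (r ^ 2 • w ^ 2 - (2 * x) • w + 1) * (r ^ 2 • w ^ 2 + (2 * x) • w + 1)
          = (r ^ 2) ^ 2 • (w ^ 2) ^ 2 - (2 * (2 * x ^ 2 - r ^ 2)) • w ^ 2 + 1 := by
        simp only [pow_two, add_mul, sub_mul, mul_add, smul_mul_assoc, mul_smul_comm, mul_one,
          one_mul, ← mul_assoc]
        module
      have h5 : Commute (r ^ 2 • w ^ 2 - (2 * x) • w + 1) (r ^ 2 • w ^ 2 + (2 * x) • w + 1) := by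
        change _ = _
        simp only [pow_two, add_mul, sub_mul, mul_add, mul_sub, smul_mul_assoc, mul_smul_comm,
          mul_one, one_mul, ← mul_assoc]
        module
      rw [← h4] at h3
      exact (h5.isUnit_mul_iff.mp h3).1
  have hr0 : 0 ≤ r := (abs_nonneg x).trans hx
  obtain ⟨m, hm⟩ := exists_pow_lt_of_lt_one (by norm_num : (0 : ℝ) < 1 / 4) hr
  refine key m x r w hx (lt_of_le_of_lt ?_ hm) hw
  exact pow_le_pow_of_le_one hr0 hr.le Nat.lt_two_pow_self.le

/-- The Fredholm alternative for a perturbation of an invertible operator by an operator with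
values in a finite-dimensional subspace. -/
theorem surjective_of_injective_of_finite_perturbation {E : Type*} [AddCommGroup E] [Module ℝ E]
    {D R : Module.End ℝ E} (hD : IsUnit D) {S : Submodule ℝ E} [FiniteDimensional ℝ S]
    (hR : ∀ f, R f ∈ S) (hinj : Function.Injective (D + R)) : Function.Surjective (D + R) := by
  obtain ⟨D, rfl⟩ := hD
  set D' : Module.End ℝ E := ((D⁻¹ : (Module.End ℝ E)ˣ) : Module.End ℝ E) with hD'
  have hDD' : ∀ f, (D : Module.End ℝ E) (D' f) = f := fun f => by
    rw [← Module.End.mul_apply, hD', Units.mul_inv, Module.End.one_apply]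
  have hD'D : ∀ f, D' ((D : Module.End ℝ E) f) = f := fun f => by
    rw [← Module.End.mul_apply, hD', Units.inv_mul, Module.End.one_apply]
  let S' : Submodule ℝ E := S.map D'
  -- `D + R = D T`, and `T` differs from the identity by a map into the finite-dimensional `S'`
  let T : Module.End ℝ E := 1 + D' * R
  have hT : ∀ f, T f = f + D' (R f) := fun f => rfl
  have hDT : ∀ f, (D : Module.End ℝ E) (T f) = ((D : Module.End ℝ E) + R) f := fun f => by
    rw [hT, map_add, hDD', LinearMap.add_apply]
  have hTS : ∀ f ∈ S', T f ∈ S' := fun f hf =>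
    S'.add_mem hf (Submodule.mem_map_of_mem (hR f))
  have hTinj : Function.Injective (T.restrict hTS) := by
    intro f g hfg
    refine Subtype.ext (hinj ?_)
    rw [← hDT, ← hDT]
    exact congrArg _ (congrArg Subtype.val hfg)
  have hTsurj : Function.Surjective (T.restrict hTS) := LinearMap.injective_iff_surjective.mp hTinj
  intro g
  set y := D' g
  obtain ⟨z, hz⟩ := hTsurj ⟨-D' (R y), S'.neg_mem (Submodule.mem_map_of_mem (hR y))⟩
  have hz' : T z = -D' (R y) := congrArg Subtype.val hz
  refine ⟨y + z, ?_⟩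
  rw [← hDT, map_add, hT y, hz', add_neg_cancel_right, hDD']

/-- A quadratic pencil with roots off the closed unit disc of an operator which is contractive on
a subspace of finite codimension is surjective as soon as it is injective. -/
theorem quadratic_surjective_of_injective {E F : Type*} [NormedAddCommGroup E]
    [InnerProductSpace ℝ E] [CompleteSpace E] [NormedAddCommGroup F] [NormedSpace ℝ F]
    [FiniteDimensional ℝ F] (V : E →L[ℝ] E) (G : E →L[ℝ] F)
    (hG : ∀ f, G f = 0 → ‖V f‖ ≤ ‖f‖) {x r : ℝ} (hx : |x| ≤ r) (hr : r < 1)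
    (hinj : ∀ f, r ^ 2 • V (V f) - (2 * x) • V f + f = 0 → f = 0) (g : E) :
    ∃ f, r ^ 2 • V (V f) - (2 * x) • V f + f = g := by
  let L : Submodule ℝ E := LinearMap.ker (G : E →ₗ[ℝ] F)
  have hLc : IsClosed (L : Set E) := G.isClosed_ker
  have : CompleteSpace L := hLc.completeSpace_coe
  have hLfin : FiniteDimensional ℝ Lᗮ := by
    refine Module.Finite.of_injective ((G : E →ₗ[ℝ] F) ∘ₗ Lᗮ.subtype) ?_
    rw [← LinearMap.ker_eq_bot, LinearMap.ker_eq_bot']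
    intro f hf
    have h1 : (f : E) ∈ L ⊓ Lᗮ := ⟨hf, f.2⟩
    rw [Submodule.inf_orthogonal_eq_bot] at h1
    exact Subtype.ext ((Submodule.mem_bot ℝ).mp h1)
  let pr : E →L[ℝ] E := L.starProjection
  have hpr : ∀ f, f - pr f ∈ Lᗮ := fun f => L.sub_starProjection_mem_orthogonal f
  let W : E →L[ℝ] E := V.comp pr
  have hW : ‖W‖ ≤ 1 := by
    refine ContinuousLinearMap.opNorm_le_bound _ zero_le_one fun f => ?_
    have h1 : ‖V (pr f)‖ ≤ ‖pr f‖ := hG _ (L.starProjection_apply_mem f)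
    have h2 : ‖pr f‖ ≤ ‖f‖ := L.norm_starProjection_apply_le f
    rw [one_mul]
    exact h1.trans h2
  let Q : (E →L[ℝ] E) → Module.End ℝ E := fun T =>
    ((r ^ 2 • T ^ 2 - (2 * x) • T + 1 : E →L[ℝ] E) : E →ₗ[ℝ] E)
  have hQ : ∀ T f, Q T f = r ^ 2 • T (T f) - (2 * x) • T f + f := fun T f => by
    simp [Q, pow_two]
  have hQW : IsUnit (Q W) := by
    have h1 := isUnit_quadratic_of_norm_le_one hx hr hW
    exact h1.map ContinuousLinearMap.toLinearMapRingHom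
  let S : Submodule ℝ E := Lᗮ.map (V : E →ₗ[ℝ] E) ⊔ Lᗮ.map ((V ∘L V : E →L[ℝ] E) : E →ₗ[ℝ] E)
  have hR : ∀ f, (Q V - Q W) f ∈ S := by
    intro f
    -- `V - V pr = V (1 - pr)` takes values in the image of a finite-dimensional space
    have h1 : (Q V - Q W) f = V (r ^ 2 • (W f - pr (W f)) - (2 * x) • (f - pr f))
        + (V ∘L V) (r ^ 2 • (f - pr f)) := by
      rw [LinearMap.sub_apply, hQ, hQ]
      simp only [W, ContinuousLinearMap.comp_apply, map_sub, map_smul]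
      module
    rw [h1, add_comm]
    refine Submodule.add_mem _ (Submodule.mem_sup_right ?_) (Submodule.mem_sup_left ?_)
    · exact Submodule.mem_map_of_mem (Lᗮ.smul_mem _ (hpr f))
    · exact Submodule.mem_map_of_mem
        (Lᗮ.sub_mem (Lᗮ.smul_mem _ (hpr _)) (Lᗮ.smul_mem _ (hpr f)))
  have h1 : Q W + (Q V - Q W) = Q V := by abel
  have h2 := surjective_of_injective_of_finite_perturbation hQW (S := S) hR (by
    rw [h1, ← LinearMap.ker_eq_bot, LinearMap.ker_eq_bot']
    intro f hf
    rw [hQ] at hf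
    exact hinj f hf)
  rw [h1] at h2
  obtain ⟨f, hf⟩ := h2 g
  rw [hQ] at hf
  exact ⟨f, hf⟩

/-- On a closed invariant subspace the restriction of such a pencil is surjective too. -/
theorem quadratic_surjectiveOn_of_injectiveOn {E F : Type*} [NormedAddCommGroup E]
    [InnerProductSpace ℝ E] [CompleteSpace E] [NormedAddCommGroup F] [NormedSpace ℝ F]
    [FiniteDimensional ℝ F] (V : E →L[ℝ] E) (G : E →L[ℝ] F)
    (hG : ∀ f, G f = 0 → ‖V f‖ ≤ ‖f‖) {x r : ℝ} (hx : |x| ≤ r) (hr : r < 1)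
    (hinj : ∀ f, r ^ 2 • V (V f) - (2 * x) • V f + f = 0 → f = 0) {M : Submodule ℝ E}
    (hMc : IsClosed (M : Set E)) (hMV : ∀ f ∈ M, V f ∈ M) {g : E} (hg : g ∈ M) :
    ∃ f ∈ M, r ^ 2 • V (V f) - (2 * x) • V f + f = g := by
  have : CompleteSpace M := hMc.completeSpace_coe
  let V' : M →L[ℝ] M := (V.comp M.subtypeL).codRestrict M fun f => hMV f f.2
  obtain ⟨f, hf⟩ := quadratic_surjective_of_injective V' (G.comp M.subtypeL)
    (fun f hf => hG f hf) hx hr (fun f hf => Subtype.ext (hinj f (congrArg Subtype.val hf)))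
    ⟨g, hg⟩
  exact ⟨f, f.2, congrArg Subtype.val hf⟩

/-! ### Continuity of the kernel -/

theorem tsum_stein {p q r : ℍ[ℝ]} (hpq : ‖p‖ * ‖q‖ < 1) :
    ∑' l : ℕ, p ^ l * r * q ^ l = p * (∑' l : ℕ, p ^ l * r * q ^ l) * q + r := by
  have hs := summable_stein (r := r) hpq
  conv_lhs => rw [hs.tsum_eq_zero_add]
  rw [← hs.tsum_mul_left, ← (hs.mul_left p).tsum_mul_right]
  simp only [pow_zero, one_mul, mul_one, pow_succ' p, pow_succ q, mul_assoc]
  rw [add_comm]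

theorem caratheodoryKernel_stein {N : ℕ} (J : Matrix (Fin N) (Fin N) ℍ[ℝ])
    (φ : ℍ[ℝ] → Matrix (Fin N) (Fin N) ℍ[ℝ]) {p q : ℍ[ℝ]} (hpq : ‖p‖ * ‖q‖ < 1) (i j : Fin N) :
    caratheodoryKernel J φ p q i j =
      p * caratheodoryKernel J φ p q i j * star q + (φ p * J + J * (φ q)ᴴ) i j := by
  simp only [caratheodoryKernel, Matrix.of_apply]
  exact tsum_stein (by rwa [norm_star])

/-- The solution of the Stein equation depends continuously on the data. -/
theorem continuousOn_caratheodoryKernel {N : ℕ} (J : Matrix (Fin N) (Fin N) ℍ[ℝ])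
    {φ : ℍ[ℝ] → Matrix (Fin N) (Fin N) ℍ[ℝ]} {𝒱 : Set ℍ[ℝ]}
    (h𝒱 : 𝒱 ⊆ Metric.ball (0 : ℍ[ℝ]) 1)
    (hφ : ∀ i j, ContinuousOn (fun p => φ p i j) 𝒱) (i j : Fin N) :
    ContinuousOn (fun z : ℍ[ℝ] × ℍ[ℝ] => caratheodoryKernel J φ z.1 z.2 i j) (𝒱 ×ˢ 𝒱) := by
  set K : ℍ[ℝ] × ℍ[ℝ] → ℍ[ℝ] := fun z => caratheodoryKernel J φ z.1 z.2 i j with hK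
  let R : ℍ[ℝ] × ℍ[ℝ] → ℍ[ℝ] := fun z => (φ z.1 * J + J * (φ z.2)ᴴ) i j
  have hR : ContinuousOn R (𝒱 ×ˢ 𝒱) := by
    have h1 : ∀ a b, ContinuousOn (fun z : ℍ[ℝ] × ℍ[ℝ] => φ z.1 a b) (𝒱 ×ˢ 𝒱) := fun a b =>
      (hφ a b).comp continuousOn_fst fun z hz => hz.1
    have h2 : ∀ a b, ContinuousOn (fun z : ℍ[ℝ] × ℍ[ℝ] => star (φ z.2 a b)) (𝒱 ×ˢ 𝒱) := fun a b =>
      ((hφ a b).comp continuousOn_snd fun z hz => hz.2).star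
    simp only [R, Matrix.add_apply, Matrix.mul_apply, Matrix.conjTranspose_apply]
    exact (continuousOn_finsetSum _ fun a _ => (h1 i a).mul continuousOn_const).add
      (continuousOn_finsetSum _ fun a _ => continuousOn_const.mul (h2 j a))
  have hstein : ∀ z ∈ 𝒱 ×ˢ 𝒱, K z = z.1 * K z * star z.2 + R z := fun z hz =>
    caratheodoryKernel_stein J φ (norm_mul_norm_lt_one (h𝒱 hz.1) (h𝒱 hz.2)) i j
  intro w hw
  let D : ℍ[ℝ] × ℍ[ℝ] → ℍ[ℝ] := fun z =>
    (z.1 * K w * star z.2 + R z) - (w.1 * K w * star w.2 + R w)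
  have hbound : ∀ z ∈ 𝒱 ×ˢ 𝒱, ‖K z - K w‖ ≤ ‖D z‖ / (1 - ‖z.1‖ * ‖z.2‖) := by
    intro z hz
    have h1 : 0 < 1 - ‖z.1‖ * ‖z.2‖ := by
      linarith [norm_mul_norm_lt_one (h𝒱 hz.1) (h𝒱 hz.2)]
    rw [le_div_iff₀ h1]
    have h2 : K z - K w = z.1 * (K z - K w) * star z.2 + D z := by
      have h3 := hstein z hz
      have h4 := hstein w hw
      simp only [D]
      rw [← h4, mul_sub, sub_mul]
      nth_rewrite 1 [h3]
      abel
    have h3 : ‖K z - K w‖ ≤ ‖z.1‖ * ‖K z - K w‖ * ‖z.2‖ + ‖D z‖ := by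
      conv_lhs => rw [h2]
      refine (norm_add_le _ _).trans ?_
      rw [norm_mul, norm_mul, norm_star]
    linarith
  have hD : Tendsto D (𝓝[𝒱 ×ˢ 𝒱] w) (𝓝 0) := by
    have h1 : ContinuousOn D (𝒱 ×ˢ 𝒱) := by
      refine ContinuousOn.sub (ContinuousOn.add ?_ hR) continuousOn_const
      exact Continuous.continuousOn (by fun_prop)
    have h2 := h1 w hw
    rwa [ContinuousWithinAt, show D w = 0 from sub_self _] at h2
  have hden : Tendsto (fun z : ℍ[ℝ] × ℍ[ℝ] => 1 - ‖z.1‖ * ‖z.2‖) (𝓝[𝒱 ×ˢ 𝒱] w)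
      (𝓝 (1 - ‖w.1‖ * ‖w.2‖)) :=
    (Continuous.tendsto (by fun_prop) w).mono_left nhdsWithin_le_nhds
  have hw1 : 1 - ‖w.1‖ * ‖w.2‖ ≠ 0 := by
    linarith [norm_mul_norm_lt_one (h𝒱 hw.1) (h𝒱 hw.2)]
  have hlim := hD.norm.div hden hw1
  rw [norm_zero, zero_div] at hlim
  refine tendsto_iff_norm_sub_tendsto_zero.mpr (squeeze_zero' (Eventually.of_forall fun _ =>
    norm_nonneg _) ?_ hlim)
  filter_upwards [self_mem_nhdsWithin] with z hz using hbound z hz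

/-! ### The reproducing kernel Pontryagin space and its backward shift -/

/-- A realization of the kernel `K` on `Ω` in a model: the vectors `k q c` stand for the functions
`K(·, q) c`, the space is the closed span of these vectors, and `V` is the backward shift, whose
adjoint `V'` is the isometry with `V' (k q (q̄ c)) = k q c - k 0 c`. -/
structure IsShiftModel {N κ : ℕ} {E : Type*} [NormedAddCommGroup E] [InnerProductSpace ℝ E]
    [Module ℍ[ℝ]ᵐᵒᵖ E] (B : E → E → ℍ[ℝ]) (e : Fin κ → E)
    (K : ℍ[ℝ] → ℍ[ℝ] → Matrix (Fin N) (Fin N) ℍ[ℝ]) (Ω : Set ℍ[ℝ])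
    (k : ℍ[ℝ] → (Fin N → ℍ[ℝ]) →ₗ[ℍ[ℝ]ᵐᵒᵖ] E) (V V' : Module.End ℍ[ℝ]ᵐᵒᵖ E) : Prop where
  model : IsPontryaginModel B e
  gram : ∀ p ∈ Ω, ∀ q ∈ Ω, ∀ c d : Fin N → ℍ[ℝ], B (k q c) (k p d) = star d ⬝ᵥ (K p q *ᵥ c)
  total : ∀ g, (∀ q ∈ Ω, ∀ c, B g (k q c) = 0) → g = 0
  continuousOn : ∀ c, ContinuousOn (fun q => k q c) Ω
  adjoint : IsAdjointEnd B V V'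
  coisometry : V * V' = 1
  shift : ∀ q ∈ Ω, ∀ c, V' (k q (star q • c)) = k q c - k 0 c

section Construction

variable {N κ : ℕ} {J : Matrix (Fin N) (Fin N) ℍ[ℝ]} {𝒱 : Set ℍ[ℝ]}
  {φ : ℍ[ℝ] → Matrix (Fin N) (Fin N) ℍ[ℝ]}

/-- Multiplication of the coefficient at `q` by `q̄`. -/
def conjPointMap (N : ℕ) (𝒱 : Set ℍ[ℝ]) :
    (𝒱 →₀ (Fin N → ℍ[ℝ])) →ₗ[ℍ[ℝ]ᵐᵒᵖ] (𝒱 →₀ (Fin N → ℍ[ℝ])) :=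
  Finsupp.lsum ℕ fun q : 𝒱 => Finsupp.lsingle q ∘ₗ
    { toFun := fun c : Fin N → ℍ[ℝ] => star (q : ℍ[ℝ]) • c
      map_add' := fun _ _ => smul_add _ _ _
      map_smul' := fun _ _ => smul_comm _ _ _ }

theorem conjPointMap_single (q : 𝒱) (c : Fin N → ℍ[ℝ]) :
    conjPointMap N 𝒱 (Finsupp.single q c) = Finsupp.single q (star (q : ℍ[ℝ]) • c) := by
  rw [conjPointMap, Finsupp.lsum_single]
  rfl

/-- The map that subtracts from a family its sum, placed at the origin. -/
def subOriginMap (N : ℕ) {𝒱 : Set ℍ[ℝ]} (h0 : (0 : ℍ[ℝ]) ∈ 𝒱) :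
    (𝒱 →₀ (Fin N → ℍ[ℝ])) →ₗ[ℍ[ℝ]ᵐᵒᵖ] (𝒱 →₀ (Fin N → ℍ[ℝ])) :=
  Finsupp.lsum ℕ fun q : 𝒱 => Finsupp.lsingle q - Finsupp.lsingle ⟨0, h0⟩

theorem subOriginMap_single (h0 : (0 : ℍ[ℝ]) ∈ 𝒱) (q : 𝒱) (c : Fin N → ℍ[ℝ]) :
    subOriginMap N h0 (Finsupp.single q c)
      = Finsupp.single q c - Finsupp.single ⟨0, h0⟩ c := by
  rw [subOriginMap, Finsupp.lsum_single]
  rfl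

theorem caratheodoryKernel_stein_form {p q : ℍ[ℝ]} (hpq : ‖p‖ * ‖q‖ < 1) (c d : Fin N → ℍ[ℝ]) :
    star d ⬝ᵥ (caratheodoryKernel J φ p q *ᵥ c)
      = star (star p • d) ⬝ᵥ (caratheodoryKernel J φ p q *ᵥ (star q • c))
        + star d ⬝ᵥ ((φ p * J + J * (φ q)ᴴ) *ᵥ c) := by
  rw [← star_dotProduct_smul, ← dotProduct_add]
  congr 1
  ext1 i
  simp only [Matrix.mulVec, dotProduct, Pi.add_apply, Pi.smul_apply, smul_eq_mul, Finset.mul_sum]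
  rw [← Finset.sum_add_distrib]
  refine Finset.sum_congr rfl fun j _ => ?_
  conv_lhs => rw [caratheodoryKernel_stein J φ hpq i j]
  rw [add_mul]
  simp only [mul_assoc]

theorem caratheodoryKernel_zero_right (p : ℍ[ℝ]) :
    caratheodoryKernel J φ p 0 = φ p * J + J * (φ 0)ᴴ := by
  ext1 i j
  rw [caratheodoryKernel_stein J φ (by simp)]
  simp

theorem caratheodoryKernel_zero_left (q : ℍ[ℝ]) :
    caratheodoryKernel J φ 0 q = φ 0 * J + J * (φ q)ᴴ := by
  ext1 i j
  rw [caratheodoryKernel_stein J φ (by simp)]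
  simp

/-- Two additive-in-each-variable expressions agree once they agree on single points. -/
theorem IsHermitianForm.ext_single {B₁ B₂ : (𝒱 →₀ (Fin N → ℍ[ℝ])) → (𝒱 →₀ (Fin N → ℍ[ℝ])) → ℍ[ℝ]}
    (h₁ : IsHermitianForm B₁) (h₂ : IsHermitianForm B₂)
    (h : ∀ q c p d, B₁ (Finsupp.single q c) (Finsupp.single p d)
      = B₂ (Finsupp.single q c) (Finsupp.single p d)) (f g : 𝒱 →₀ (Fin N → ℍ[ℝ])) :
    B₁ f g = B₂ f g := by
  induction f using Finsupp.induction_linear with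
  | zero => rw [h₁.zero_left, h₂.zero_left]
  | add f₁ f₂ hf₁ hf₂ => rw [h₁.add_left, h₂.add_left, hf₁, hf₂]
  | single q c =>
    induction g using Finsupp.induction_linear with
    | zero => rw [h₁.zero_right, h₂.zero_right]
    | add g₁ g₂ hg₁ hg₂ => rw [h₁.add_right, h₂.add_right, hg₁, hg₂]
    | single p d => exact h q c p d

theorem IsHermitianForm.comp {X Y : Type*} [AddCommGroup X] [Module ℍ[ℝ]ᵐᵒᵖ X] [AddCommGroup Y]
    [Module ℍ[ℝ]ᵐᵒᵖ Y] {B : Y → Y → ℍ[ℝ]} (hB : IsHermitianForm B) (T : X →ₗ[ℍ[ℝ]ᵐᵒᵖ] Y) :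
    IsHermitianForm fun f g => B (T f) (T g) where
  add_left u v w := by rw [map_add, hB.add_left]
  smul_left a v w := by rw [map_smul, hB.smul_left]
  star_eq v w := hB.star_eq _ _

/-- The Stein equation says that `conjPointMap` and `subOriginMap` pull the form of the kernel back
to the same form. -/
theorem kernelForm_subOriginMap (hJ : Jᴴ = J) (h0 : (0 : ℍ[ℝ]) ∈ 𝒱)
    (h𝒱 : 𝒱 ⊆ Metric.ball (0 : ℍ[ℝ]) 1) (f g : 𝒱 →₀ (Fin N → ℍ[ℝ])) :
    kernelForm (caratheodoryKernel J φ) 𝒱 (subOriginMap N h0 f) (subOriginMap N h0 g)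
      = kernelForm (caratheodoryKernel J φ) 𝒱 (conjPointMap N 𝒱 f) (conjPointMap N 𝒱 g) := by
  have hB : IsHermitianForm (kernelForm (caratheodoryKernel J φ) 𝒱) :=
    isHermitianForm_kernelForm fun p _ q _ => caratheodoryKernel_conjTranspose hJ φ p q
  refine (hB.comp (subOriginMap N h0)).ext_single (hB.comp (conjPointMap N 𝒱)) ?_ f g
  intro q c p d
  rw [subOriginMap_single, subOriginMap_single, conjPointMap_single, conjPointMap_single,
    hB.sub_left, hB.sub_right, hB.sub_right]
  simp only [kernelForm_single, caratheodoryKernel_zero_left, caratheodoryKernel_zero_right]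
  rw [caratheodoryKernel_stein_form (norm_mul_norm_lt_one (h𝒱 p.2) (h𝒱 q.2))]
  simp only [Matrix.add_mulVec, dotProduct_add]
  abel

end Construction

theorem quaternion_abs_re_le_norm (a : ℍ[ℝ]) : |a.re| ≤ ‖a‖ := by
  refine abs_le_of_sq_le_sq ?_ (norm_nonneg a)
  rw [sq ‖a‖, ← Quaternion.normSq_eq_norm_mul_self, Quaternion.normSq_def']
  nlinarith [sq_nonneg a.imI, sq_nonneg a.imJ, sq_nonneg a.imK]

/-- The norm of the opposite quaternions is multiplicative; with this, bounded right linear maps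
extend from dense subspaces. -/
instance : NormedDivisionRing ℍ[ℝ]ᵐᵒᵖ where
  __ := (inferInstance : NormedRing ℍ[ℝ]ᵐᵒᵖ)
  __ := (inferInstance : DivisionRing ℍ[ℝ]ᵐᵒᵖ)
  norm_mul a b := by
    rw [← norm_unop, unop_mul, norm_mul, norm_unop, norm_unop, mul_comm]

section Construction

variable {N κ : ℕ} {J : Matrix (Fin N) (Fin N) ℍ[ℝ]} {𝒱 : Set ℍ[ℝ]}
  {φ : ℍ[ℝ] → Matrix (Fin N) (Fin N) ℍ[ℝ]}

/-- Continuity of a map into a model, tested with the form. -/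
theorem IsPontryaginModel.continuousWithinAt {E : Type*} [NormedAddCommGroup E]
    [InnerProductSpace ℝ E] [Module ℍ[ℝ]ᵐᵒᵖ E] {B : E → E → ℍ[ℝ]} {e : Fin κ → E}
    (h : IsPontryaginModel B e) {Y : Type*} [TopologicalSpace Y] {s : Set Y} {y : Y} {u : Y → E}
    (h1 : ContinuousWithinAt (fun x => B (u x) (u x)) s y)
    (h2 : ContinuousWithinAt (fun x => B (u x) (u y)) s y)
    (h3 : ∀ i, ContinuousWithinAt (fun x => B (u x) (e i)) s y) : ContinuousWithinAt u s y := by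
  have key : ∀ x, ‖u x - u y‖ ^ 2 = (B (u x) (u x) - B (u x) (u y) - star (B (u x) (u y))
      + B (u y) (u y)).re + 2 * ∑ i, ‖B (u x) (e i) - B (u y) (e i)‖ ^ 2 := by
    intro x
    rw [h.norm_sq]
    simp only [h.hermitian.sub_left, h.hermitian.sub_right, h.hermitian.star_eq]
    congr 2
    abel
  have hc : ContinuousWithinAt (fun x => ‖u x - u y‖ ^ 2) s y := by
    simp only [key]
    refine (Quaternion.continuous_re.continuousAt.comp_continuousWithinAt
      (((h1.sub h2).sub h2.star).add continuousWithinAt_const)).add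
      (continuousWithinAt_const.mul ?_)
    exact tendsto_finsetSum _ fun i _ =>
      ((h3 i).sub continuousWithinAt_const).norm.pow 2
  have hc' := hc.sqrt
  simp only [Real.sqrt_sq (norm_nonneg _)] at hc'
  refine tendsto_iff_norm_sub_tendsto_zero.mpr ?_
  simpa [ContinuousWithinAt] using hc'

theorem continuousOn_star_dotProduct_mulVec {s : Set ℍ[ℝ]}
    {M : ℍ[ℝ] → Matrix (Fin N) (Fin N) ℍ[ℝ]} (hM : ∀ i j, ContinuousOn (fun q => M q i j) s)
    (c d : Fin N → ℍ[ℝ]) : ContinuousOn (fun q => star d ⬝ᵥ (M q *ᵥ c)) s := by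
  simp only [dotProduct, Matrix.mulVec]
  exact continuousOn_finsetSum _ fun i _ => continuousOn_const.mul
    (continuousOn_finsetSum _ fun j _ => (hM i j).mul continuousOn_const)

theorem tendsto_coe_nhdsNE_zero : Tendsto (fun t : ℝ => (t : ℍ[ℝ])) (𝓝[≠] 0) (𝓝 0) := by
  have := Quaternion.continuous_coe.tendsto (0 : ℝ)
  exact this.mono_left nhdsWithin_le_nhds

/-- A Hermitian kernel with `κ` negative squares is realized in a model. If the kernel is
continuous, then so is the realization. -/
theorem exists_model_of_kernel {K : ℍ[ℝ] → ℍ[ℝ] → Matrix (Fin N) (Fin N) ℍ[ℝ]} {Ω : Set ℍ[ℝ]}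
    (hneg : HasNegativeSquares K Ω κ)
    (hc1 : ∀ p ∈ Ω, ∀ i j, ContinuousOn (fun q => K p q i j) Ω)
    (hc2 : ∀ i j, ContinuousOn (fun q => K q q i j) Ω) :
    ∃ (E : Type) (_ : NormedAddCommGroup E) (_ : InnerProductSpace ℝ E) (_ : CompleteSpace E)
      (_ : Module ℍ[ℝ]ᵐᵒᵖ E) (_ : IsScalarTower ℝ ℍ[ℝ]ᵐᵒᵖ E) (B : E → E → ℍ[ℝ]) (e : Fin κ → E)
      (ι : (Ω →₀ (Fin N → ℍ[ℝ])) →ₗ[ℍ[ℝ]ᵐᵒᵖ] E), IsPontryaginModel B e ∧ DenseRange ι ∧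
      (∀ f g, B (ι f) (ι g) = kernelForm K Ω f g) ∧
      ∀ c, Continuous fun q : Ω => ι (Finsupp.single q c) := by
  obtain ⟨hKherm, hmax, u₀, hu₀⟩ := hasNegativeSquares_iff.mp hneg
  have hBX : IsHermitianForm (kernelForm K Ω) := isHermitianForm_kernelForm hKherm
  obtain ⟨u, hu, -⟩ := hu₀.exists_negOrthonormal hBX
  have hframe : IsFrame (kernelForm K Ω) u :=
    ⟨hu, fun f hf => hu.nonneg_of_maximal hBX hmax hf⟩
  obtain ⟨E, _, _, _, _, _, B, ι, hι, hBι, hmodel⟩ := hframe.exists_model hBX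
  have hB := hmodel.hermitian
  have hcont1 : ∀ c f, Continuous fun q : Ω => B (ι (Finsupp.single q c)) (ι f) := by
    intro c f
    induction f using Finsupp.induction_linear with
    | zero =>
      simp only [map_zero, hB.zero_right]
      exact continuous_const
    | add f g hf hg =>
      simp only [map_add, hB.add_right]
      exact hf.add hg
    | single p d =>
      simp only [hBι, kernelForm_single]
      exact continuousOn_iff_continuous_domRestrict.mp
        (continuousOn_star_dotProduct_mulVec (hc1 p p.2) c d)
  have hcont2 : ∀ c, Continuous fun q : Ω =>
      B (ι (Finsupp.single q c)) (ι (Finsupp.single q c)) := by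
    intro c
    simp only [hBι, kernelForm_single]
    exact continuousOn_iff_continuous_domRestrict.mp (continuousOn_star_dotProduct_mulVec hc2 c c)
  refine ⟨E, _, _, inferInstance, _, inferInstance, B, _, ι, hmodel, hι, hBι, fun c => ?_⟩
  refine continuous_iff_continuousAt.mpr fun q => continuousWithinAt_univ _ _ |>.mp ?_
  exact hmodel.continuousWithinAt (hcont2 c).continuousAt.continuousWithinAt
    (hcont1 c _).continuousAt.continuousWithinAt
    fun i => (hcont1 c (u i)).continuousAt.continuousWithinAt

/-- The kernel of a generalized Carathéodory function is realized in a model. An isometry for the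
form with dense domain is bounded: it carries a frame inside its domain to another frame. -/
theorem exists_isShiftModel (hJ : Jᴴ = J) (h𝒱 : 𝒱 ∈ 𝓝 (0 : ℍ[ℝ]))
    (h𝒱_ball : 𝒱 ⊆ Metric.ball (0 : ℍ[ℝ]) 1) (hφ : ∀ i j, ContinuousOn (fun p => φ p i j) 𝒱)
    (hneg : HasNegativeSquares (caratheodoryKernel J φ) 𝒱 κ) :
    ∃ (E : Type) (_ : NormedAddCommGroup E) (_ : InnerProductSpace ℝ E) (_ : CompleteSpace E)
      (_ : Module ℍ[ℝ]ᵐᵒᵖ E) (_ : IsScalarTower ℝ ℍ[ℝ]ᵐᵒᵖ E) (B : E → E → ℍ[ℝ]) (e : Fin κ → E)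
      (k : ℍ[ℝ] → (Fin N → ℍ[ℝ]) →ₗ[ℍ[ℝ]ᵐᵒᵖ] E) (V V' : Module.End ℍ[ℝ]ᵐᵒᵖ E),
      IsShiftModel B e (caratheodoryKernel J φ) 𝒱 k V V' := by
  classical
  have h0 : (0 : ℍ[ℝ]) ∈ 𝒱 := mem_of_mem_nhds h𝒱
  have hKc := continuousOn_caratheodoryKernel J h𝒱_ball hφ
  obtain ⟨E, _, _, _, _, _, B, e, ι, hmodel, hι, hBι, hιc⟩ := exists_model_of_kernel hneg
    (fun p hp i j => (hKc i j).comp (f := fun q : ℍ[ℝ] => (p, q))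
      (continuousOn_const.prodMk continuousOn_id) fun q hq => ⟨hp, hq⟩)
    (fun i j => (hKc i j).comp (f := fun q : ℍ[ℝ] => (q, q))
      (continuousOn_id.prodMk continuousOn_id) fun q hq => ⟨hq, hq⟩)
  have hB := hmodel.hermitian
  let k : ℍ[ℝ] → (Fin N → ℍ[ℝ]) →ₗ[ℍ[ℝ]ᵐᵒᵖ] E := fun q =>
    if hq : q ∈ 𝒱 then ι ∘ₗ Finsupp.lsingle ⟨q, hq⟩ else 0
  have hk : ∀ (q : 𝒱) c, k q c = ι (Finsupp.single q c) := fun q c => by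
    simp only [k, q.2, dif_pos]; rfl
  clear_value k
  have hgram : ∀ p ∈ 𝒱, ∀ q ∈ 𝒱, ∀ c d : Fin N → ℍ[ℝ],
      B (k q c) (k p d) = star d ⬝ᵥ (caratheodoryKernel J φ p q *ᵥ c) := by
    intro p hp q hq c d
    rw [hk ⟨q, hq⟩, hk ⟨p, hp⟩, hBι, kernelForm_single]
  have hkc : ∀ c, ContinuousOn (fun q => k q c) 𝒱 := fun c =>
    continuousOn_iff_continuous_domRestrict.mpr ((hιc c).congr fun q => (hk q c).symm)
  have htotal : ∀ g, (∀ q ∈ 𝒱, ∀ c, B g (k q c) = 0) → g = 0 := by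
    intro g hg
    have h1 : ∀ f, B (ι f) g = 0 := by
      intro f
      induction f using Finsupp.induction_linear with
      | zero => rw [map_zero, hB.zero_left]
      | add f₁ f₂ hf₁ hf₂ => rw [map_add, hB.add_left, hf₁, hf₂, add_zero]
      | single p d => rw [← hk, ← hB.star_eq, hg p p.2, star_zero]
    refine hmodel.eq_zero_of_form fun w => ?_
    rw [← hB.star_eq, star_eq_zero]
    exact hι.induction_on (p := fun w => B w g = 0) w
      (isClosed_eq (hmodel.continuous_form_left g) continuous_const) h1
  -- the vectors `k q c` with `q ≠ 0` span a dense subspace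
  let T : (𝒱 →₀ (Fin N → ℍ[ℝ])) →ₗ[ℍ[ℝ]ᵐᵒᵖ] E := ι ∘ₗ conjPointMap N 𝒱
  let T₀ : (𝒱 →₀ (Fin N → ℍ[ℝ])) →ₗ[ℍ[ℝ]ᵐᵒᵖ] E := ι ∘ₗ subOriginMap N h0
  have hT : ∀ (q : 𝒱) c, T (Finsupp.single q c) = k q (star (q : ℍ[ℝ]) • c) := fun q c => by
    rw [LinearMap.comp_apply, conjPointMap_single, hk]
  have hT₀ : ∀ (q : 𝒱) c, T₀ (Finsupp.single q c) = k q c - k 0 c := fun q c => by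
    rw [LinearMap.comp_apply, subOriginMap_single, map_sub, hk, ← hk ⟨0, h0⟩]
  have hTT₀ : ∀ f g, B (T₀ f) (T₀ g) = B (T f) (T g) := fun f g => by
    simp only [T, T₀, LinearMap.comp_apply, hBι]
    exact kernelForm_subOriginMap hJ h0 h𝒱_ball f g
  have hTdense : DenseRange T := by
    refine hmodel.denseRange_of_total T fun g hg => ?_
    have h1 : ∀ q ∈ 𝒱, q ≠ 0 → ∀ c, B (k q c) g = 0 := by
      intro q hq hq0 c
      have h2 := hg (Finsupp.single ⟨q, hq⟩ ((star q)⁻¹ • c))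
      rwa [hT, smul_inv_smul₀ (star_ne_zero.mpr hq0)] at h2
    have h2 : ∀ c, B (k 0 c) g = 0 := by
      intro c
      have h3 : Tendsto (fun t : ℝ => B (k (t : ℍ[ℝ]) c) g) (𝓝[≠] 0) (𝓝 (B (k 0 c) g)) := by
        refine ((hmodel.continuous_form_left g).tendsto _).comp ?_
        exact ((hkc c).continuousAt h𝒱).tendsto.comp tendsto_coe_nhdsNE_zero
      refine tendsto_nhds_unique h3 (tendsto_const_nhds.congr' ?_)
      filter_upwards [tendsto_coe_nhdsNE_zero h𝒱, self_mem_nhdsWithin] with t ht ht0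
      exact (h1 _ ht (fun h4 => ht0 (Quaternion.coe_injective h4)) c).symm
    refine htotal g fun q hq c => ?_
    rw [← hB.star_eq, star_eq_zero]
    by_cases hq0 : q = 0
    · rw [hq0]; exact h2 c
    · exact h1 q hq hq0 c
  -- a frame inside the domain of the isometry, and its image
  have hBT : IsHermitianForm fun f g => B (T f) (T g) := hB.comp T
  obtain ⟨w₀, hw₀⟩ := hmodel.exists_negDefFamily_of_denseRange T hTdense
  obtain ⟨w, hw, -⟩ := hw₀.exists_negOrthonormal hBT
  have hframe₀ : IsFrame B fun i => T₀ (w i) := by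
    have h1 : NegOrthonormal B fun i => T₀ (w i) := fun i j => by rw [hTT₀]; exact hw i j
    exact ⟨h1, fun f hf => h1.nonneg_of_maximal hB (fun m v hv => hmodel.le_of_negDefFamily hv) hf⟩
  obtain ⟨c₀, hc₀, hbound⟩ := hmodel.norm_sq_le_of_frame hframe₀
  -- the norm of the image frame involves only values of the form, which are the same for `T₀ f`
  -- and the vectors `T₀ (w i)` as for `T f` and the vectors `T (w i)`
  have hTbound : ∃ C, ∀ f, ‖T₀ f‖ ≤ C * ‖T f‖ := by
    set a : ℝ := (1 + 2 * κ) + 2 * ∑ i, ((1 + 2 * κ) * ‖T (w i)‖) ^ 2 with ha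
    have ha0 : 0 ≤ a := by positivity
    refine ⟨√(c₀ * a), fun f => ?_⟩
    have h1 : (B (T f) (T f)).re ≤ (1 + 2 * κ) * ‖T f‖ ^ 2 := by
      calc (B (T f) (T f)).re ≤ ‖B (T f) (T f)‖ :=
            (le_abs_self _).trans (quaternion_abs_re_le_norm _)
        _ ≤ (1 + 2 * κ) * ‖T f‖ * ‖T f‖ := hmodel.norm_form_le _ _
        _ = _ := by ring
    have h2 : ∀ i, ‖B (T f) (T (w i))‖ ^ 2 ≤ ((1 + 2 * κ) * ‖T (w i)‖) ^ 2 * ‖T f‖ ^ 2 := by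
      intro i
      rw [← mul_pow]
      refine pow_le_pow_left₀ (norm_nonneg _) ((hmodel.norm_form_le _ _).trans_eq ?_) 2
      ring
    have h3 : ‖T₀ f‖ ^ 2 ≤ c₀ * (a * ‖T f‖ ^ 2) := by
      refine (hbound (T₀ f)).trans (mul_le_mul_of_nonneg_left ?_ hc₀)
      simp only [hTT₀]
      have h4 := Finset.sum_le_sum fun i (_ : i ∈ Finset.univ) => h2 i
      rw [← Finset.sum_mul] at h4
      rw [ha, add_mul, mul_assoc 2]
      linarith
    refine le_of_sq_le_sq ?_ (by positivity)
    rw [mul_pow, Real.sq_sqrt (by positivity), mul_assoc]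
    exact h3
  have := hmodel.isBoundedSMul
  let V' : E →L[ℍ[ℝ]ᵐᵒᵖ] E := LinearMap.extendOfNorm (𝕜 := ℍ[ℝ]ᵐᵒᵖ) (𝕜₂ := ℍ[ℝ]ᵐᵒᵖ)
    (σ₁₂ := RingHom.id _) T₀ T
  have hV' : ∀ f, V' (T f) = T₀ f := LinearMap.extendOfNorm_eq hTdense hTbound
  have hV'B : ∀ f g, B (V' f) (V' g) = B f g := by
    intro f g
    refine hTdense.induction_on₂ (p := fun f g => B (V' f) (V' g) = B f g) ?_ ?_ f g
    · exact isClosed_eq (hmodel.continuous_form_comp (V'.continuous.comp continuous_fst)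
        (V'.continuous.comp continuous_snd)) hmodel.continuous_form
    · intro f g
      rw [hV', hV', hTT₀]
  obtain ⟨V, hV⟩ := hmodel.exists_isAdjointEnd (T := (V' : E →ₗ[ℍ[ℝ]ᵐᵒᵖ] E)) V'.continuous
  refine ⟨E, _, _, inferInstance, _, inferInstance, B, e, k, V,
    (V' : E →ₗ[ℍ[ℝ]ᵐᵒᵖ] E), hmodel, hgram, htotal, hkc, hV, ?_, ?_⟩
  · ext f
    refine hmodel.eq_of_form_left fun g => ?_
    rw [Module.End.mul_apply, hV]
    exact hV'B f g
  · intro q hq c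
    change V' _ = _
    rw [← hT ⟨q, hq⟩, hV', hT₀]

end Construction

/-! ### Functions on a quaternionic sphere -/

theorem quaternion_sq_eq (p : ℍ[ℝ]) : p * p = (2 * p.re) • p - ‖p‖ ^ 2 • (1 : ℍ[ℝ]) := by
  have h1 : (2 * p.re) • p = p * (p + star p) := by
    rw [add_star_eq, Quaternion.mul_coe_eq_smul]
  rw [h1, mul_add, self_mul_star_eq, ← Quaternion.coe_mul_eq_smul, mul_one, add_sub_cancel_right]

/-- For `|x| ≤ r` the zeros of `q² - 2xq + r²` have real part `x`. -/
theorem re_eq_of_quadratic_eq_zero {x r : ℝ} (hx : |x| ≤ r) {q : ℍ[ℝ]}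
    (hq : q * q - (2 * x) • q + r ^ 2 • (1 : ℍ[ℝ]) = 0) : q.re = x := by
  have h0 := congrArg QuaternionAlgebra.re hq
  have h1 := congrArg QuaternionAlgebra.imI hq
  have h2 := congrArg QuaternionAlgebra.imJ hq
  have h3 := congrArg QuaternionAlgebra.imK hq
  simp at h0 h1 h2 h3
  by_contra hne
  have hne' : q.re - x ≠ 0 := sub_ne_zero.mpr hne
  have i1 : q.imI = 0 := by
    have : (q.re - x) * q.imI = 0 := by linarith
    exact (mul_eq_zero.mp this).resolve_left hne'
  have i2 : q.imJ = 0 := by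
    have : (q.re - x) * q.imJ = 0 := by linarith
    exact (mul_eq_zero.mp this).resolve_left hne'
  have i3 : q.imK = 0 := by
    have : (q.re - x) * q.imK = 0 := by linarith
    exact (mul_eq_zero.mp this).resolve_left hne'
  rw [i1, i2, i3] at h0
  have h4 : x ^ 2 ≤ r ^ 2 :=
    sq_le_sq' (by linarith [neg_le_of_abs_le hx]) ((le_abs_self x).trans hx)
  have h5 : (q.re - x) ^ 2 = 0 := le_antisymm (by nlinarith) (sq_nonneg _)
  exact hne' (pow_eq_zero_iff two_ne_zero |>.mp h5)

/-- Conjugation moves a quaternion that is not real along its sphere. -/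
theorem exists_same_sphere {Ω : Set ℍ[ℝ]} (hΩ : IsOpen Ω) {p : ℍ[ℝ]} (hp : p ∈ Ω)
    (hreal : p ≠ (p.re : ℍ[ℝ])) : ∃ q ∈ Ω, q ≠ p ∧ q.re = p.re ∧ ‖q‖ = ‖p‖ := by
  obtain ⟨w, hw⟩ : ∃ w : ℍ[ℝ], w * p ≠ p * w := by
    by_contra! hcomm
    have h1 := congrArg QuaternionAlgebra.imJ (hcomm ⟨0, 1, 0, 0⟩)
    have h2 := congrArg QuaternionAlgebra.imK (hcomm ⟨0, 1, 0, 0⟩)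
    have h3 := congrArg QuaternionAlgebra.imK (hcomm ⟨0, 0, 1, 0⟩)
    erw [Quaternion.imJ_mul, Quaternion.imJ_mul] at h1
    erw [Quaternion.imK_mul, Quaternion.imK_mul] at h2 h3
    dsimp only at h1 h2 h3
    refine hreal (Quaternion.ext _ _ rfl ?_ ?_ ?_)
    · change p.imI = 0; linarith
    · change p.imJ = 0; linarith
    · change p.imK = 0; linarith
  have hu : Continuous fun t : ℝ => 1 + (t : ℍ[ℝ]) * w :=
    continuous_const.add (Quaternion.continuous_coe.mul continuous_const)
  have hu0 : (1 + ((0 : ℝ) : ℍ[ℝ]) * w) = 1 := by simp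
  have hne : ∀ᶠ t : ℝ in 𝓝 0, 1 + (t : ℍ[ℝ]) * w ≠ 0 :=
    hu.continuousAt.eventually_ne (by rw [hu0]; exact one_ne_zero)
  have hc : ContinuousAt (fun t : ℝ => (1 + (t : ℍ[ℝ]) * w) * p * (1 + (t : ℍ[ℝ]) * w)⁻¹) 0 :=
    (hu.continuousAt.mul continuousAt_const).mul
      (hu.continuousAt.inv₀ (by rw [hu0]; exact one_ne_zero))
  have hmem : ∀ᶠ t : ℝ in 𝓝 0, (1 + (t : ℍ[ℝ]) * w) * p * (1 + (t : ℍ[ℝ]) * w)⁻¹ ∈ Ω :=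
    hc.eventually_mem (by simpa [hu0] using hΩ.mem_nhds hp)
  obtain ⟨t, ⟨hne, hmem⟩, ht⟩ := ((hne.and hmem).filter_mono nhdsWithin_le_nhds).and
    (self_mem_nhdsWithin (s := {(0 : ℝ)}ᶜ)) |>.exists
  refine ⟨_, hmem, fun h => hw ?_, ?_, ?_⟩
  · rw [mul_inv_eq_iff_eq_mul₀ hne, add_mul, mul_add, one_mul, mul_one, add_right_inj, mul_assoc,
      ← mul_assoc p, ← Quaternion.coe_commutes, mul_assoc] at h
    exact mul_left_cancel₀ (fun h' => ht (Quaternion.coe_injective h')) h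
  · rw [quaternion_re_mul_comm, ← mul_assoc, inv_mul_cancel₀ hne, one_mul]
  · rw [norm_mul, norm_mul, norm_inv, mul_comm, ← mul_assoc,
      inv_mul_cancel₀ (norm_ne_zero_iff.mpr hne), one_mul]

section Sphere

variable {Ω : Set ℍ[ℝ]} {f g l : ℍ[ℝ] → ℍ[ℝ]} {a b : ℍ[ℝ]} {x r : ℝ}

/-- The pencil relation, multiplied by `q²` to eliminate the backward shifts `g` and `l` of `f`. -/
theorem quadratic_mul_eq {q : ℍ[ℝ]} (hf : f q = a + q * g q) (hg : g q = b + q * l q)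
    (hl : r ^ 2 • l q - (2 * x) • g q + f q = 0) :
    (q * q - (2 * x) • q + r ^ 2 • (1 : ℍ[ℝ])) * f q
      = r ^ 2 • a + r ^ 2 • (q * b) - (2 * x) • (q * a) := by
  have h1 : q * g q = f q - a := by rw [hf]; abel
  have h2 : q * (q * l q) = f q - a - q * b := by rw [← h1, hg, mul_add]; abel
  have h3 := congrArg (fun y => q * (q * y)) hl
  simp only [mul_add, mul_sub, mul_smul_comm, mul_zero, h1, h2] at h3
  rw [add_mul, sub_mul, smul_mul_assoc, smul_mul_assoc, one_mul, mul_assoc]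
  rw [← sub_eq_zero, ← h3]
  module

/-- At `p`, where the quadratic polynomial vanishes, its product with `f` gives a relation between
the values `a` and `b` of `f` and of its backward shift at the origin. -/
theorem eq_star_mul_of_quadratic {p : ℍ[ℝ]} (hp : p ≠ 0) (hf : f p = a + p * g p)
    (hg : g p = b + p * l p) (hl : ‖p‖ ^ 2 • l p - (2 * p.re) • g p + f p = 0) :
    a = star p * b := by
  have h1 := quadratic_mul_eq hf hg hl
  rw [quaternion_sq_eq] at h1
  have h2 : ‖p‖ ^ 2 • (p * b) = p * (p * (star p * b)) := by
    rw [← mul_assoc p (star p), self_mul_star_eq, Quaternion.coe_mul_eq_smul, mul_smul_comm]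
  have h3 : (2 * p.re) • (p * a) = p * (p * a) + ‖p‖ ^ 2 • a := by
    rw [← mul_assoc p p, quaternion_sq_eq, sub_mul, smul_mul_assoc, smul_mul_assoc, one_mul]
    abel
  rw [h2, h3] at h1
  have h4 : p * (p * a) = p * (p * (star p * b)) := by
    rw [← sub_eq_zero]
    have : ((2 * p.re) • p - ‖p‖ ^ 2 • (1 : ℍ[ℝ]) - (2 * p.re) • p + ‖p‖ ^ 2 • (1 : ℍ[ℝ])) = 0 := by
      abel
    rw [this, zero_mul] at h1
    rw [← neg_eq_zero, h1]
    abel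
  exact mul_left_cancel₀ hp (mul_left_cancel₀ hp h4)

/-- The quadratic polynomial has no zeros at the points `q + t` with small real `t ≠ 0`. -/
theorem eventually_quadratic_ne_zero (hx : |x| ≤ r) (q : ℍ[ℝ]) :
    ∀ᶠ t : ℝ in 𝓝[≠] 0, (q + t) * (q + t) - (2 * x) • (q + t) + r ^ 2 • (1 : ℍ[ℝ]) ≠ 0 := by
  have h1 : ∀ᶠ t : ℝ in 𝓝[≠] 0, t ≠ x - q.re := by
    by_cases h : x - q.re = 0
    · rw [h]; exact self_mem_nhdsWithin
    · exact eventually_nhdsWithin_of_eventually_nhds (eventually_ne_nhds (Ne.symm h))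
  filter_upwards [h1] with t ht h2
  have h3 := re_eq_of_quadratic_eq_zero hx h2
  rw [Quaternion.re_add, Quaternion.re_coe] at h3
  exact ht (by linarith)

theorem tendsto_add_coe_nhdsNE (q : ℍ[ℝ]) : Tendsto (fun t : ℝ => q + t) (𝓝[≠] 0) (𝓝 q) := by
  simpa using tendsto_coe_nhdsNE_zero.const_add q

/-- A continuous function `f` with backward shifts `g` and `l` vanishes if the pencil of the
shift annihilates it. -/
theorem eq_zero_of_pencil (hΩ : IsOpen Ω) {p : ℍ[ℝ]} (hpΩ : p ∈ Ω) (hp : p ≠ 0)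
    (hf : ∀ q ∈ Ω, f q = a + q * g q) (hg : ∀ q ∈ Ω, g q = b + q * l q)
    (hl : ∀ q ∈ Ω, ‖p‖ ^ 2 • l q - (2 * p.re) • g q + f q = 0) (hfc : ContinuousOn f Ω)
    {q : ℍ[ℝ]} (hq : q ∈ Ω) : f q = 0 := by
  have ha := eq_star_mul_of_quadratic hp (hf p hpΩ) (hg p hpΩ) (hl p hpΩ)
  have hlim : ∀ {q}, q ∈ Ω → Tendsto (fun t : ℝ => f (q + t)) (𝓝[≠] 0) (𝓝 (f q)) := fun hq =>
    (hfc.continuousAt (hΩ.mem_nhds hq)).tendsto.comp (tendsto_add_coe_nhdsNE _)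
  have hmem : ∀ {q}, q ∈ Ω → ∀ᶠ t : ℝ in 𝓝[≠] 0, q + (t : ℍ[ℝ]) ∈ Ω := fun hq =>
    (tendsto_add_coe_nhdsNE _).eventually_mem (hΩ.mem_nhds hq)
  have hb : b = 0 := by
    by_cases hreal : p = (p.re : ℍ[ℝ])
    · -- a real point is a double zero of the polynomial
      obtain ⟨s, rfl⟩ : ∃ s : ℝ, p = s := ⟨_, hreal⟩
      rw [Quaternion.star_coe, Quaternion.coe_mul_eq_smul] at ha
      have hnorm : ‖(s : ℍ[ℝ])‖ ^ 2 = s ^ 2 := by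
        rw [Quaternion.norm_coe, Real.norm_eq_abs, sq_abs]
      have h1 : ∀ᶠ t : ℝ in 𝓝[≠] 0, t • f (s + t) = -s ^ 2 • b := by
        filter_upwards [hmem hpΩ, self_mem_nhdsWithin] with t ht ht0
        have h2 := quadratic_mul_eq (x := s) (r := s) (hf _ ht) (hg _ ht)
          (by rw [← hnorm]; exact hl _ ht)
        rw [← Quaternion.coe_add] at h2 ⊢
        have h3 : ((s + t : ℝ) : ℍ[ℝ]) * ((s + t : ℝ) : ℍ[ℝ]) - (2 * s) • ((s + t : ℝ) : ℍ[ℝ])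
            + s ^ 2 • (1 : ℍ[ℝ]) = ((t ^ 2 : ℝ) : ℍ[ℝ]) := by
          rw [← Quaternion.coe_mul_eq_smul, ← Quaternion.coe_mul_eq_smul, mul_one,
            ← Quaternion.coe_mul, ← Quaternion.coe_mul, ← Quaternion.coe_sub, ← Quaternion.coe_add]
          congr 1
          ring
        rw [h3, ha] at h2
        simp only [Quaternion.coe_mul_eq_smul] at h2
        have h4 : t • t • f ((s + t : ℝ) : ℍ[ℝ]) = t • (-s ^ 2 • b) := by
          rw [smul_smul, ← sq, h2]
          module
        exact smul_right_injective _ ht0 h4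
      have h5 : Tendsto (fun t : ℝ => t • f (s + t)) (𝓝[≠] 0) (𝓝 ((0 : ℝ) • f s)) :=
        (tendsto_id.mono_left nhdsWithin_le_nhds).smul (hlim hpΩ)
      have h6 := tendsto_nhds_unique (h5.congr' h1) tendsto_const_nhds
      rw [zero_smul] at h6
      have hs : s ≠ 0 := fun h => hp (by rw [h, Quaternion.coe_zero])
      exact (smul_eq_zero.mp h6.symm).resolve_left (neg_ne_zero.mpr (pow_ne_zero 2 hs))
    · obtain ⟨p', hp'Ω, hne, hre, hnorm⟩ := exists_same_sphere hΩ hpΩ hreal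
      have hp' : p' ≠ 0 := by rwa [← norm_ne_zero_iff, hnorm, norm_ne_zero_iff]
      have ha' := eq_star_mul_of_quadratic hp' (hf p' hp'Ω) (hg p' hp'Ω)
        (by rw [hnorm, hre]; exact hl p' hp'Ω)
      have h1 : (star p' - star p) * b = 0 := by rw [sub_mul, ← ha, ← ha', sub_self]
      refine (mul_eq_zero.mp h1).resolve_left ?_
      rw [← star_sub]
      refine star_ne_zero.mpr ?_
      exact sub_ne_zero.mpr hne
  rw [hb, mul_zero] at ha
  refine tendsto_nhds_unique (hlim hq) (tendsto_const_nhds.congr' ?_)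
  filter_upwards [hmem hq, eventually_quadratic_ne_zero (quaternion_abs_re_le_norm p) q]
    with t ht hne
  have h1 := quadratic_mul_eq (hf _ ht) (hg _ ht) (hl _ ht)
  rw [ha, hb] at h1
  simp only [mul_zero, smul_zero, add_zero, sub_zero] at h1
  exact ((mul_eq_zero.mp h1).resolve_left hne).symm

end Sphere

/-! ### The realization -/

section Evaluation

variable {N : ℕ} {X : Type*} [AddCommGroup X] [Module ℍ[ℝ]ᵐᵒᵖ X] {B : X → X → ℍ[ℝ]}

/-- The adjoint of an operator defined on the columns. -/
def IsHermitianForm.columnsAdjoint (hB : IsHermitianForm B)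
    (u : (Fin N → ℍ[ℝ]) →ₗ[ℍ[ℝ]ᵐᵒᵖ] X) : X →ₗ[ℍ[ℝ]ᵐᵒᵖ] (Fin N → ℍ[ℝ]) where
  toFun f i := B f (u (Pi.single i 1))
  map_add' f g := funext fun i => hB.add_left f g _
  map_smul' a f := funext fun i => by
    rw [← op_unop a]
    exact hB.smul_left _ f _

theorem IsHermitianForm.isAdjointToColumns (hB : IsHermitianForm B)
    (u : (Fin N → ℍ[ℝ]) →ₗ[ℍ[ℝ]ᵐᵒᵖ] X) : IsAdjointToColumns B (hB.columnsAdjoint u) u := by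
  intro f d
  conv_rhs => rw [eq_rightComb_single d, map_rightComb, hB.comb_right]
  rfl

end Evaluation

namespace IsShiftModel

variable {N κ : ℕ} {E : Type*} [NormedAddCommGroup E] [InnerProductSpace ℝ E]
  [Module ℍ[ℝ]ᵐᵒᵖ E] {B : E → E → ℍ[ℝ]} {e : Fin κ → E}
  {K : ℍ[ℝ] → ℍ[ℝ] → Matrix (Fin N) (Fin N) ℍ[ℝ]} {Ω : Set ℍ[ℝ]}
  {k : ℍ[ℝ] → (Fin N → ℍ[ℝ]) →ₗ[ℍ[ℝ]ᵐᵒᵖ] E} {V V' : Module.End ℍ[ℝ]ᵐᵒᵖ E}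

/-- The value at `p` of the function represented by an element of the model. -/
def eval (h : IsShiftModel B e K Ω k V V') (p : ℍ[ℝ]) : E →ₗ[ℍ[ℝ]ᵐᵒᵖ] (Fin N → ℍ[ℝ]) :=
  h.model.hermitian.columnsAdjoint (k p)

theorem isAdjoint_eval (h : IsShiftModel B e K Ω k V V') (p : ℍ[ℝ]) :
    IsAdjointToColumns B (h.eval p) (k p) := h.model.hermitian.isAdjointToColumns (k p)

/-- The operator `V` is the backward shift. -/
theorem eval_eq (h : IsShiftModel B e K Ω k V V') {p : ℍ[ℝ]} (hp : p ∈ Ω) (f : E) :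
    h.eval p f = h.eval 0 f + p • h.eval p (V f) := by
  rw [← sub_eq_iff_eq_add']
  refine eq_of_star_dotProduct fun d => ?_
  rw [dotProduct_sub, h.isAdjoint_eval, h.isAdjoint_eval, star_dotProduct_smul, h.isAdjoint_eval,
    h.adjoint, h.shift p hp, h.model.hermitian.sub_right]

theorem eq_zero_of_eval (h : IsShiftModel B e K Ω k V V') {f : E}
    (hf : ∀ p ∈ Ω, h.eval p f = 0) : f = 0 :=
  h.total f fun q hq c => by rw [← h.isAdjoint_eval, hf q hq, dotProduct_zero]

theorem isAdjointEnd_symm (h : IsShiftModel B e K Ω k V V') : IsAdjointEnd B V' V := fun v w => by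
  rw [← h.model.hermitian.star_eq, ← h.adjoint, h.model.hermitian.star_eq]

theorem operator_adjoint_apply (h : IsShiftModel B e K Ω k V V') (f : E) : V (V' f) = f := by
  rw [← Module.End.mul_apply, h.coisometry, Module.End.one_apply]

/-- The co-isometry `V` is a contraction where the form agrees with the square of the norm, that is
on vectors orthogonal to the frame. -/
theorem norm_operator_le (h : IsShiftModel B e K Ω k V V') {f : E} (h1 : ∀ i, B f (e i) = 0)
    (h2 : ∀ i, B (V f) (e i) = 0) (h3 : ∀ i, B (V' (V f)) (e i) = 0) : ‖V f‖ ≤ ‖f‖ := by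
  have hB := h.model.hermitian
  -- `f` is the orthogonal sum of `V' V f` and a vector in the kernel of `V`
  set g := f - V' (V f) with hg
  have hVg : V g = 0 := by rw [hg, map_sub, h.operator_adjoint_apply, sub_self]
  have h4 : ∀ i, B g (e i) = 0 := fun i => by rw [hg, hB.sub_left, h1, h3, sub_zero]
  have h5 : B g (V' (V f)) = 0 := by rw [← h.adjoint, hVg, hB.zero_left]
  have h6 : B (V' (V f)) g = 0 := by rw [← hB.star_eq, h5, star_zero]
  have h7 : B (V' (V f)) (V' (V f)) = B (V f) (V f) := by
    rw [← h.adjoint, h.operator_adjoint_apply]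
  have h8 : B f f = B (V f) (V f) + B g g := by
    have hf : f = V' (V f) + g := by rw [hg]; abel
    conv_lhs => rw [hf]
    rw [hB.add_left, hB.add_right, hB.add_right, h5, h6, h7, add_zero, zero_add]
  have h9 := congrArg QuaternionAlgebra.re h8
  have h10 := h.model.nonneg_of_orthogonal h1
  have h11 := h.model.nonneg_of_orthogonal h2
  have h12 := h.model.nonneg_of_orthogonal h4
  have h13 : ‖f‖ ^ 2 = ‖V f‖ ^ 2 + ‖g‖ ^ 2 := by
    rw [← h10, ← h11, ← h12]; exact h9
  exact le_of_sq_le_sq (by nlinarith [sq_nonneg ‖g‖]) (norm_nonneg f)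

variable [IsScalarTower ℝ ℍ[ℝ]ᵐᵒᵖ E]

theorem continuousOn_eval (h : IsShiftModel B e K Ω k V V') (f : E) (i : Fin N) :
    ContinuousOn (fun p => h.eval p f i) Ω :=
  h.model.continuous_form.comp_continuousOn
    (continuousOn_const.prodMk (h.continuousOn (Pi.single i 1)))

/-- An element of the kernel of the pencil represents a function that vanishes, because the
relation between the values of this function at the points of a sphere and at the origin is
overdetermined. -/
theorem eq_zero_of_spherePencil (h : IsShiftModel B e K Ω k V V') (hΩ : IsOpen Ω) {p : ℍ[ℝ]}
    (hp : p ∈ Ω) {f : E} (hf : spherePencil V p f = 0) : f = 0 := by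
  by_cases hp0 : p = 0
  · rw [spherePencil_apply, hp0] at hf
    simpa using hf
  refine h.eq_zero_of_eval fun q hq => funext fun i => ?_
  refine eq_zero_of_pencil (f := fun q => h.eval q f i) (g := fun q => h.eval q (V f) i)
    (l := fun q => h.eval q (V (V f)) i) hΩ hp hp0 (fun q hq => congrFun (h.eval_eq hq f) i)
    (fun q hq => congrFun (h.eval_eq hq (V f)) i) (fun q hq => ?_) (h.continuousOn_eval f i) hq
  have h1 := congrFun (congrArg (h.eval q) hf) i
  rw [spherePencil_apply, map_add, map_sub, map_smul, map_smul, op_coe_smul, op_coe_smul,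
    map_zero] at h1
  exact h1

variable [CompleteSpace E]

theorem continuous_operator (h : IsShiftModel B e K Ω k V V') : Continuous V :=
  h.model.continuous_of_isAdjointEnd h.adjoint

/-- The operator `V` as a bounded real linear operator. -/
def realOperator (h : IsShiftModel B e K Ω k V V') : E →L[ℝ] E :=
  ⟨V.restrictScalars ℝ, h.continuous_operator⟩

/-- The forms that vanish on a subspace of finite codimension where `V` is a contraction. -/
def defectForms (h : IsShiftModel B e K Ω k V V') : E →L[ℝ] (Fin κ → ℍ[ℝ] × ℍ[ℝ] × ℍ[ℝ]) where
  toFun f i := (B f (e i), B (V f) (e i), B (V' (V f)) (e i))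
  map_add' f g := by
    ext1 i
    simp only [map_add, h.model.hermitian.add_left, Pi.add_apply, Prod.mk_add_mk]
  map_smul' t f := by
    ext1 i
    simp only [← op_coe_smul t, map_smul, h.model.hermitian.smul_left, Pi.smul_apply,
      RingHom.id_apply, Prod.smul_mk, Quaternion.mul_coe_eq_smul]
  cont := continuous_pi fun i =>
    (h.model.continuous_form_left _).prodMk (((h.model.continuous_form_left _).comp
      h.continuous_operator).prodMk ((h.model.continuous_form_left _).comp
      ((h.model.continuous_of_isAdjointEnd h.isAdjointEnd_symm).comp h.continuous_operator)))

theorem norm_operator_le_of_defectForms (h : IsShiftModel B e K Ω k V V') {f : E}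
    (hf : h.defectForms f = 0) : ‖h.realOperator f‖ ≤ ‖f‖ :=
  h.norm_operator_le (fun i => congrArg Prod.fst (congrFun hf i))
    (fun i => congrArg (fun y => y.2.1) (congrFun hf i))
    (fun i => congrArg (fun y => y.2.2) (congrFun hf i))

theorem spherePencil_eq (h : IsShiftModel B e K Ω k V V') (p : ℍ[ℝ]) (f : E) :
    spherePencil V p f = ‖p‖ ^ 2 • h.realOperator (h.realOperator f)
      - (2 * p.re) • h.realOperator f + f := by
  rw [spherePencil_apply, op_coe_smul, op_coe_smul]
  rfl

theorem isUnit_spherePencil (h : IsShiftModel B e K Ω k V V') (hΩ : IsOpen Ω)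
    (hΩ1 : Ω ⊆ Metric.ball (0 : ℍ[ℝ]) 1) {p : ℍ[ℝ]} (hp : p ∈ Ω) :
    IsUnit (spherePencil V p) := by
  have hinj : ∀ f, spherePencil V p f = 0 → f = 0 := fun f => h.eq_zero_of_spherePencil hΩ hp
  refine (Module.End.isUnit_iff _).mpr
    ⟨(injective_iff_map_eq_zero (spherePencil V p)).mpr hinj, fun g => ?_⟩
  simp only [h.spherePencil_eq] at hinj ⊢
  exact quadratic_surjective_of_injective h.realOperator h.defectForms
    (fun f => h.norm_operator_le_of_defectForms) (quaternion_abs_re_le_norm p)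
    (mem_ball_zero_iff.mp (hΩ1 hp)) hinj g

/-- The resolvent evaluates the function represented by an element of the model. -/
theorem starResolvent_eq_eval (h : IsShiftModel B e K Ω k V V') (hΩ : IsOpen Ω)
    (hΩ1 : Ω ⊆ Metric.ball (0 : ℍ[ℝ]) 1) {p : ℍ[ℝ]} (hp : p ∈ Ω) (f : E) :
    starResolvent (h.eval 0) V p f = h.eval p f := by
  have hu := h.isUnit_spherePencil hΩ hΩ1 hp
  obtain ⟨g, rfl⟩ := exists_spherePencil_eq hu f
  rw [starResolvent_spherePencil _ hu]
  have h1 : h.eval 0 g = h.eval p g - p • h.eval p (V g) := by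
    rw [h.eval_eq hp g]; abel
  have h2 : h.eval 0 (V g) = h.eval p (V g) - p • h.eval p (V (V g)) := by
    rw [h.eval_eq hp (V g)]; abel
  rw [h1, h2, spherePencil_apply, map_add, map_sub, map_smul, map_smul, op_coe_smul, op_coe_smul]
  ext1 i
  simp only [Pi.add_apply, Pi.sub_apply, Pi.smul_apply, smul_eq_mul]
  rw [mul_sub, ← mul_assoc, star_mul_self_eq, Quaternion.coe_mul_eq_smul,
    ← Quaternion.coe_mul_eq_smul (2 * p.re), ← add_star_eq, add_mul]
  abel

/-- On the closed invariant subspace `⋂ ker C Vⁿ` the pencils are invertible, so the resolvents,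
which give all the values of a function, vanish there. -/
theorem isObservable (h : IsShiftModel B e K Ω k V V') (hΩ : IsOpen Ω)
    (hΩ1 : Ω ⊆ Metric.ball (0 : ℍ[ℝ]) 1) : IsObservable (h.eval 0) V := by
  intro f hf
  let M : Submodule ℝ E := ⨅ n : ℕ, LinearMap.ker ((h.eval 0 ∘ₗ V ^ n).restrictScalars ℝ)
  have hM : ∀ {g}, g ∈ M ↔ ∀ n : ℕ, h.eval 0 ((V ^ n) g) = 0 := fun {g} => by
    simp only [M, Submodule.mem_iInf, LinearMap.mem_ker]
    rfl
  have hVn : ∀ n : ℕ, Continuous (V ^ n : Module.End ℍ[ℝ]ᵐᵒᵖ E) := fun n => by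
    induction n with
    | zero => exact continuous_id
    | succ n ih =>
      rw [pow_succ]
      exact ih.comp h.continuous_operator
  have hMc : IsClosed (M : Set E) := by
    have : (M : Set E) = ⋂ n : ℕ, {g | h.eval 0 ((V ^ n) g) = 0} := by
      ext g
      simp only [SetLike.mem_coe, hM, Set.mem_iInter, Set.mem_ofPred_eq]
    rw [this]
    exact isClosed_iInter fun n => isClosed_eq
      ((h.model.continuous_of_isAdjointToColumns (h.isAdjoint_eval 0)).comp (hVn n))
      continuous_const
  have hMV : ∀ g ∈ M, h.realOperator g ∈ M := fun g hg => hM.mpr fun n => by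
    have := hM.mp hg (n + 1)
    rwa [pow_succ] at this
  refine h.eq_zero_of_eval fun p hp => ?_
  obtain ⟨g, hg, rfl⟩ := quadratic_surjectiveOn_of_injectiveOn h.realOperator h.defectForms
    (fun f => h.norm_operator_le_of_defectForms) (quaternion_abs_re_le_norm p)
    (mem_ball_zero_iff.mp (hΩ1 hp))
    (fun f hf => h.eq_zero_of_spherePencil hΩ hp (by rw [h.spherePencil_eq, hf])) hMc hMV
    (hM.mpr hf)
  have h0 : h.eval 0 g = 0 := hM.mp hg 0
  have h1 : h.eval 0 (V g) = 0 := by simpa using hM.mp hg 1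
  rw [← h.spherePencil_eq, ← h.starResolvent_eq_eval hΩ hΩ1 hp,
    starResolvent_spherePencil _ (h.isUnit_spherePencil hΩ hΩ1 hp), h0, h1, smul_zero, sub_zero]

end IsShiftModel

/-- The vector `k 0 (J c)` represents the function `φ(·) c`, up to a constant. -/
theorem IsShiftModel.eval_eq_mulVec_add {N κ : ℕ} {E : Type*} [NormedAddCommGroup E]
    [InnerProductSpace ℝ E] [Module ℍ[ℝ]ᵐᵒᵖ E]
    {B : E → E → ℍ[ℝ]} {e : Fin κ → E} {Ω : Set ℍ[ℝ]} {J : Matrix (Fin N) (Fin N) ℍ[ℝ]}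
    {φ : ℍ[ℝ] → Matrix (Fin N) (Fin N) ℍ[ℝ]}
    {k : ℍ[ℝ] → (Fin N → ℍ[ℝ]) →ₗ[ℍ[ℝ]ᵐᵒᵖ] E} {V V' : Module.End ℍ[ℝ]ᵐᵒᵖ E}
    (h : IsShiftModel B e (caratheodoryKernel J φ) Ω k V V') (hJ : J * J = 1)
    (h0 : (0 : ℍ[ℝ]) ∈ Ω) {q : ℍ[ℝ]} (hq : q ∈ Ω) (c : Fin N → ℍ[ℝ]) :
    h.eval q (k 0 (J *ᵥ c)) = (φ q + J * (φ 0)ᴴ * J) *ᵥ c := by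
  have h1 : h.eval q (k 0 (J *ᵥ c)) = caratheodoryKernel J φ q 0 *ᵥ (J *ᵥ c) :=
    eq_of_star_dotProduct fun d => by rw [h.isAdjoint_eval, h.gram q hq 0 h0]
  rw [h1, caratheodoryKernel_zero_right, Matrix.mulVec_mulVec, Matrix.add_mul, Matrix.mul_assoc,
    hJ, Matrix.mul_one]

/-- The realization formula holds in every shift model of the kernel. -/
theorem IsShiftModel.realization {N κ : ℕ} {E : Type*} [NormedAddCommGroup E]
    [InnerProductSpace ℝ E] [CompleteSpace E] [Module ℍ[ℝ]ᵐᵒᵖ E] [IsScalarTower ℝ ℍ[ℝ]ᵐᵒᵖ E]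
    {B : E → E → ℍ[ℝ]} {e : Fin κ → E} {Ω : Set ℍ[ℝ]} {J : Matrix (Fin N) (Fin N) ℍ[ℝ]}
    {φ : ℍ[ℝ] → Matrix (Fin N) (Fin N) ℍ[ℝ]}
    {k : ℍ[ℝ] → (Fin N → ℍ[ℝ]) →ₗ[ℍ[ℝ]ᵐᵒᵖ] E} {V V' : Module.End ℍ[ℝ]ᵐᵒᵖ E}
    (h : IsShiftModel B e (caratheodoryKernel J φ) Ω k V V') (hJ : J * J = 1) (hΩ : IsOpen Ω)
    (hΩ1 : Ω ⊆ Metric.ball (0 : ℍ[ℝ]) 1) (h0 : (0 : ℍ[ℝ]) ∈ Ω) {p : ℍ[ℝ]} (hp : p ∈ Ω)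
    (c : Fin N → ℍ[ℝ]) :
    φ p *ᵥ c = (1 / 2 : ℝ) • starCayley (h.eval 0) V p (k 0 (J *ᵥ c))
      + (1 / 2 : ℝ) • ((φ 0 - J * (φ 0)ᴴ * J) *ᵥ c) := by
  rw [starCayley_eq _ (h.isUnit_spherePencil hΩ hΩ1 hp), h.starResolvent_eq_eval hΩ hΩ1 hp,
    h.eval_eq_mulVec_add hJ h0 hp,
    h.eval_eq_mulVec_add hJ h0 h0]
  simp only [Matrix.add_mulVec, Matrix.sub_mulVec]
  module

/-! ### Slice hyperholomorphic power series -/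

/-- The derivative of `q ↦ qⁿ a`. The powers of `p` on both sides of a direction `v` can be
collected when `v` commutes with `p`. -/
theorem exists_hasFDerivAt_pow_mul (n : ℕ) (p a : ℍ[ℝ]) :
    ∃ L : ℍ[ℝ] →L[ℝ] ℍ[ℝ], HasFDerivAt (fun q : ℍ[ℝ] => q ^ n * a) L p ∧
      ‖L‖ ≤ n * ‖p‖ ^ (n - 1) * ‖a‖ ∧
      ∀ v, Commute v p → L v = (n : ℝ) • (v * p ^ (n - 1) * a) := by
  have hD := (hasFDerivAt_pow' (𝕜 := ℝ) n (x := p)).mul_const' a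
  have happ : ∀ v, (op a • ∑ i ∈ Finset.range n, op (p ^ i) • p ^ (n.pred - i) •
      ContinuousLinearMap.id ℝ ℍ[ℝ]) v
      = (∑ i ∈ Finset.range n, p ^ (n - 1 - i) * (v * p ^ i)) * a := by
    intro v
    simp [mul_assoc]
  refine ⟨_, hD, ContinuousLinearMap.opNorm_le_bound _ (by positivity) fun v => ?_, fun v hv => ?_⟩
  · rw [happ, norm_mul]
    have h1 : ‖∑ i ∈ Finset.range n, p ^ (n - 1 - i) * (v * p ^ i)‖
        ≤ ∑ i ∈ Finset.range n, ‖p‖ ^ (n - 1) * ‖v‖ := by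
      refine norm_sum_le_of_le _ fun i hi => ?_
      have hi' : n - 1 = (n - 1 - i) + i := by have := Finset.mem_range.mp hi; omega
      conv_rhs => rw [hi', pow_add]
      rw [norm_mul, norm_mul, norm_pow, norm_pow]
      exact le_of_eq (by ring)
    rw [Finset.sum_const, Finset.card_range, nsmul_eq_mul] at h1
    calc _ ≤ (n * (‖p‖ ^ (n - 1) * ‖v‖)) * ‖a‖ := mul_le_mul_of_nonneg_right h1 (norm_nonneg a)
      _ = _ := by ring
  · rw [happ]
    have h1 : ∀ i ∈ Finset.range n, p ^ (n - 1 - i) * (v * p ^ i) = v * p ^ (n - 1) := by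
      intro i hi
      have hi' : n - 1 = (n - 1 - i) + i := by have := Finset.mem_range.mp hi; omega
      rw [← mul_assoc, ← (hv.pow_right (n - 1 - i)).eq, mul_assoc, ← pow_add, ← hi']
    rw [Finset.sum_congr rfl h1, Finset.sum_const, Finset.card_range, smul_mul_assoc,
      Nat.cast_smul_eq_nsmul]

theorem summable_pow_mul {a : ℕ → ℍ[ℝ]} {M : ℝ} (ha : ∀ n, ‖a n‖ ≤ M) {p : ℍ[ℝ]} (hp : ‖p‖ < 1) :
    Summable fun n => p ^ n * a n :=
  Summable.of_norm_bounded ((summable_geometric_of_lt_one (norm_nonneg p) hp).mul_right M)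
    fun n => by
      rw [norm_mul, norm_pow]
      exact mul_le_mul_of_nonneg_left (ha n) (by positivity)

/-- Termwise differentiation of a series, with the derivative described by its values. -/
theorem exists_hasFDerivAt_tsum {E F : Type*} [NormedAddCommGroup E] [NormedSpace ℝ E]
    [NormedAddCommGroup F] [NormedSpace ℝ F] [CompleteSpace F] {f : ℕ → E → F}
    {f' : ℕ → E → E →L[ℝ] F} {u : ℕ → ℝ} {s : Set E} {x : E} (hu : Summable u) (hs : IsOpen s)
    (h's : IsPreconnected s) (hf : ∀ n y, y ∈ s → HasFDerivAt (f n) (f' n y) y)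
    (hf' : ∀ n y, y ∈ s → ‖f' n y‖ ≤ u n) (hx : x ∈ s) (hfx : Summable fun n => f n x) :
    ∃ L : E →L[ℝ] F, HasFDerivAt (fun y => ∑' n, f n y) L x ∧
      ∀ v, HasSum (fun n => f' n x v) (L v) :=
  ⟨_, hasFDerivAt_tsum_of_isPreconnected hu hs h's hf hf' hx hfx hx, fun v =>
    (ContinuousLinearMap.apply ℝ F v).hasSum
      (Summable.of_norm_bounded hu fun n => hf' n x hx).hasSum⟩

/-- On the slice of an imaginary unit `I` the derivatives of `pⁿ a` in the directions `1` and `I`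
are those of a holomorphic monomial. -/
theorem sliceHyperholomorphicOn_tsum {a : ℕ → ℍ[ℝ]} {M : ℝ} (ha : ∀ n, ‖a n‖ ≤ M) :
    SliceHyperholomorphicOn (fun p => ∑' n, p ^ n * a n) (Metric.ball (0 : ℍ[ℝ]) 1) := by
  choose L hL hLnorm hLcomm using fun (n : ℕ) (p : ℍ[ℝ]) => exists_hasFDerivAt_pow_mul n p (a n)
  have hM : 0 ≤ M := (norm_nonneg _).trans (ha 0)
  have key : ∀ p ∈ Metric.ball (0 : ℍ[ℝ]) 1, ∃ D : ℍ[ℝ] →L[ℝ] ℍ[ℝ],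
      HasFDerivAt (fun p => ∑' n, p ^ n * a n) D p ∧ ∀ v, HasSum (fun n => L n p v) (D v) := by
    intro p hp
    rw [mem_ball_zero_iff] at hp
    -- the derivatives are summable uniformly on a smaller ball
    obtain ⟨ρ, hpρ, hρ⟩ := exists_between hp
    have hρ0 : 0 < ρ := (norm_nonneg p).trans_lt hpρ
    have hu : Summable fun n : ℕ => n * ρ ^ (n - 1) * M := by
      have h1 := summable_pow_mul_geometric_of_norm_lt_one (R := ℝ) 1
        (r := ρ) (by rwa [Real.norm_of_nonneg hρ0.le])
      refine ((h1.mul_right (ρ⁻¹ * M))).congr fun n => ?_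
      rcases n with _ | n
      · simp
      · rw [Nat.add_sub_cancel, pow_one, pow_succ]
        field_simp
    have hbound : ∀ n, ∀ q ∈ Metric.ball (0 : ℍ[ℝ]) ρ, ‖L n q‖ ≤ n * ρ ^ (n - 1) * M := by
      intro n q hq
      rw [mem_ball_zero_iff] at hq
      refine (hLnorm n q).trans ?_
      gcongr
      exact ha n
    have hpmem : p ∈ Metric.ball (0 : ℍ[ℝ]) ρ := mem_ball_zero_iff.mpr hpρ
    exact exists_hasFDerivAt_tsum hu Metric.isOpen_ball (convex_ball (0 : ℍ[ℝ]) ρ).isPreconnected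
      (fun n q _ => hL n q) hbound hpmem (summable_pow_mul ha hp)
  choose! D hD happ using key
  refine ⟨fun p hp => (hD p hp).differentiableAt.differentiableWithinAt, ?_⟩
  intro I hI x y hp
  set p := (x : ℍ[ℝ]) + I * (y : ℍ[ℝ]) with hpdef
  have hIp : Commute I p :=
    (Quaternion.coe_commute x I).symm.add_right
      ((Commute.refl I).mul_right (Quaternion.coe_commute y I).symm)
  have hterm : ∀ n, L n p 1 + I * L n p I = 0 := fun n => by
    rw [hLcomm n p 1 (Commute.one_left p), hLcomm n p I hIp, mul_smul_comm, one_mul, mul_assoc I,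
      ← mul_assoc I I, hI, neg_one_mul, smul_neg, add_neg_cancel]
  rw [(hD p hp).fderiv]
  refine ((happ p hp 1).add ((happ p hp I).mul_left I)).unique ?_
  simp only [hterm]
  exact hasSum_zero

theorem SliceHyperholomorphicOn.sub_const {f : ℍ[ℝ] → ℍ[ℝ]} {Ω : Set ℍ[ℝ]}
    (hf : SliceHyperholomorphicOn f Ω) (c : ℍ[ℝ]) : SliceHyperholomorphicOn (fun p => f p - c) Ω :=
  ⟨hf.1.sub_const c, fun I hI x y h => by
    rw [fderiv_sub_const]
    exact hf.2 I hI x y h⟩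

/-! ### Extension to the ball in the definite case -/

section Definite

variable {N : ℕ} {E : Type*} [NormedAddCommGroup E] [InnerProductSpace ℝ E]
  [CompleteSpace E] [Module ℍ[ℝ]ᵐᵒᵖ E] [IsScalarTower ℝ ℍ[ℝ]ᵐᵒᵖ E] {B : E → E → ℍ[ℝ]}
  {e : Fin 0 → E} {K : ℍ[ℝ] → ℍ[ℝ] → Matrix (Fin N) (Fin N) ℍ[ℝ]} {Ω : Set ℍ[ℝ]}
  {k : ℍ[ℝ] → (Fin N → ℍ[ℝ]) →ₗ[ℍ[ℝ]ᵐᵒᵖ] E} {V V' : Module.End ℍ[ℝ]ᵐᵒᵖ E}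

/-- When the form is positive definite the backward shift is a contraction. -/
theorem IsShiftModel.exists_norm_eval_pow_le (h : IsShiftModel B e K Ω k V V') (p : ℍ[ℝ]) (f : E)
    (i : Fin N) : ∃ M : ℝ, ∀ n : ℕ, ‖h.eval p ((V ^ n) f) i‖ ≤ M := by
  let T : E →L[ℝ] (Fin N → ℍ[ℝ]) := ⟨(h.eval p).restrictScalars ℝ,
    h.model.continuous_of_isAdjointToColumns (h.isAdjoint_eval p)⟩
  have hV : ∀ n : ℕ, ‖(V ^ n) f‖ ≤ ‖f‖ := by
    intro n
    induction n with
    | zero => exact le_rfl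
    | succ n ih =>
      rw [pow_succ', Module.End.mul_apply]
      exact (h.norm_operator_le finZeroElim finZeroElim finZeroElim).trans ih
  refine ⟨‖T‖ * ‖f‖, fun n => (norm_le_pi_norm (h.eval p ((V ^ n) f)) i).trans ?_⟩
  exact (T.le_opNorm _).trans (mul_le_mul_of_nonneg_left (hV n) (norm_nonneg T))

/-- The Taylor expansion, by iteration of `f(p) = f(0) + p (V f)(p)`. -/
theorem IsShiftModel.hasSum_eval (h : IsShiftModel B e K Ω k V V')
    (hΩ1 : Ω ⊆ Metric.ball (0 : ℍ[ℝ]) 1) {p : ℍ[ℝ]} (hp : p ∈ Ω) (f : E) (i : Fin N) :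
    HasSum (fun n : ℕ => p ^ n * h.eval 0 ((V ^ n) f) i) (h.eval p f i) := by
  have hp1 : ‖p‖ < 1 := mem_ball_zero_iff.mp (hΩ1 hp)
  obtain ⟨M, hM⟩ := h.exists_norm_eval_pow_le 0 f i
  obtain ⟨M', hM'⟩ := h.exists_norm_eval_pow_le p f i
  have hpartial : ∀ n : ℕ, ∑ m ∈ Finset.range n, p ^ m * h.eval 0 ((V ^ m) f) i
      = h.eval p f i - p ^ n * h.eval p ((V ^ n) f) i := by
    intro n
    induction n with
    | zero => simp
    | succ n ih =>
      have h1 := congrFun (h.eval_eq hp ((V ^ n) f)) i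
      rw [Pi.add_apply, Pi.smul_apply, smul_eq_mul, ← Module.End.mul_apply, ← pow_succ'] at h1
      rw [Finset.sum_range_succ, ih, h1, pow_succ p, mul_add, mul_assoc]
      abel
  refine (summable_pow_mul hM hp1).hasSum_iff_tendsto_nat.mpr ?_
  simp only [hpartial]
  have hlim : Tendsto (fun n => p ^ n * h.eval p ((V ^ n) f) i) atTop (𝓝 0) :=
    (summable_pow_mul hM' hp1).tendsto_atTop_zero
  simpa using hlim.const_sub (h.eval p f i)

end Definite

/-- The Taylor series of the function represented by `k 0 (J c)` extends `φ` to the ball. -/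
theorem exists_sliceHyperholomorphic_extension {N : ℕ} {J : Matrix (Fin N) (Fin N) ℍ[ℝ]}
    (hJ : IsSignatureMatrix J) {𝒱 : Set ℍ[ℝ]} (h𝒱 : 𝒱 ∈ 𝓝 (0 : ℍ[ℝ]))
    (h𝒱_ball : 𝒱 ⊆ Metric.ball (0 : ℍ[ℝ]) 1) {φ : ℍ[ℝ] → Matrix (Fin N) (Fin N) ℍ[ℝ]}
    (hφ : GeneralizedCaratheodory 0 J 𝒱 φ) :
    ∃ Φ : ℍ[ℝ] → Matrix (Fin N) (Fin N) ℍ[ℝ],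
      MatrixSliceHyperholomorphicOn Φ (Metric.ball (0 : ℍ[ℝ]) 1) ∧ Set.EqOn Φ φ 𝒱 := by
  obtain ⟨E, _, _, _, _, _, B, e, k, V, V', h⟩ := exists_isShiftModel hJ.1 h𝒱 h𝒱_ball
    (fun i j => (hφ.1 i j).1.continuousOn) hφ.2
  let v : Fin N → E := fun j => k 0 (J *ᵥ Pi.single j 1)
  refine ⟨fun p => Matrix.of fun i j =>
    (∑' n : ℕ, p ^ n * h.eval 0 ((V ^ n) (v j)) i) - (J * (φ 0)ᴴ * J) i j, fun i j => ?_,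
    fun p hp => ?_⟩
  · obtain ⟨M, hM⟩ := h.exists_norm_eval_pow_le 0 (v j) i
    exact (sliceHyperholomorphicOn_tsum hM).sub_const _
  · ext1 i j
    change (∑' n : ℕ, p ^ n * h.eval 0 ((V ^ n) (v j)) i) - (J * (φ 0)ᴴ * J) i j = φ p i j
    rw [(h.hasSum_eval h𝒱_ball hp (v j) i).tsum_eq,
      h.eval_eq_mulVec_add hJ.2 (mem_of_mem_nhds h𝒱) hp, Matrix.mulVec_single_one, Matrix.col_apply,
      Matrix.add_apply, add_sub_cancel_right]

theorem IsPontryaginSpace.hasNegativeSquares_of_realization {κ : ℕ} {P : Type} [AddCommGroup P]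
    [Module ℍ[ℝ]ᵐᵒᵖ P] {B : P → P → ℍ[ℝ]} (h : IsPontryaginSpace B κ) {N : ℕ}
    {J : Matrix (Fin N) (Fin N) ℍ[ℝ]} (hJ : IsSignatureMatrix J) {𝒱 : Set ℍ[ℝ]}
    (h𝒱 : 𝒱 ∈ 𝓝 (0 : ℍ[ℝ])) (h𝒱_ball : 𝒱 ⊆ Metric.ball (0 : ℍ[ℝ]) 1)
    {φ : ℍ[ℝ] → Matrix (Fin N) (Fin N) ℍ[ℝ]} {V V' : Module.End ℍ[ℝ]ᵐᵒᵖ P}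
    {C : P →ₗ[ℍ[ℝ]ᵐᵒᵖ] (Fin N → ℍ[ℝ])} {C' : (Fin N → ℍ[ℝ]) →ₗ[ℍ[ℝ]ᵐᵒᵖ] P}
    (hV : IsAdjointEnd B V V') (hVV' : V * V' = 1) (hC : IsAdjointToColumns B C C')
    (hobs : IsObservable C V)
    (hφ : ∀ p ∈ 𝒱, IsUnit (spherePencil V p) ∧ ∀ c : Fin N → ℍ[ℝ],
      φ p *ᵥ c = (1 / 2 : ℝ) • starCayley C V p (C' (J *ᵥ c))
        + (1 / 2 : ℝ) • ((φ 0 - J * (φ 0)ᴴ * J) *ᵥ c)) :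
    HasNegativeSquares (caratheodoryKernel J φ) 𝒱 κ := by
  refine h.of_model (fun E _ _ B => ∀ (V V' : Module.End ℍ[ℝ]ᵐᵒᵖ E)
      (C : E →ₗ[ℍ[ℝ]ᵐᵒᵖ] (Fin N → ℍ[ℝ])) (C' : (Fin N → ℍ[ℝ]) →ₗ[ℍ[ℝ]ᵐᵒᵖ] E),
      IsAdjointEnd B V V' → V * V' = 1 → IsAdjointToColumns B C C' → IsObservable C V →
      (∀ p ∈ 𝒱, IsUnit (spherePencil V p) ∧ ∀ c : Fin N → ℍ[ℝ],
        φ p *ᵥ c = (1 / 2 : ℝ) • starCayley C V p (C' (J *ᵥ c))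
          + (1 / 2 : ℝ) • ((φ 0 - J * (φ 0)ᴴ * J) *ᵥ c)) →
      HasNegativeSquares (caratheodoryKernel J φ) 𝒱 κ) ?_ V V' C C' hV hVV' hC hobs hφ
  intro E _ _ _ _ _ B e hmodel V V' C C' hV hVV' hC hobs hφ
  exact hmodel.hasNegativeSquares_of_realization hJ h𝒱 h𝒱_ball hV hVV' hC hobs hφ

theorem mainTheorem3 (N κ : ℕ) (J : Matrix (Fin N) (Fin N) ℍ[ℝ]) (hJ : IsSignatureMatrix J)
    (𝒱 : Set ℍ[ℝ]) (h𝒱_open : IsOpen 𝒱) (h𝒱_zero : (0 : ℍ[ℝ]) ∈ 𝒱)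
    (h𝒱_ball : 𝒱 ⊆ Metric.ball (0 : ℍ[ℝ]) 1)
    (φ : ℍ[ℝ] → Matrix (Fin N) (Fin N) ℍ[ℝ]) (hφ : MatrixSliceHyperholomorphicOn φ 𝒱) :
    (GeneralizedCaratheodory κ J 𝒱 φ ↔
      ∃ (P : Type) (_ : AddCommGroup P) (_ : Module ℍ[ℝ]ᵐᵒᵖ P) (B : P → P → ℍ[ℝ])
        (V : Module.End ℍ[ℝ]ᵐᵒᵖ P) (C : P →ₗ[ℍ[ℝ]ᵐᵒᵖ] (Fin N → ℍ[ℝ]))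
        (C' : (Fin N → ℍ[ℝ]) →ₗ[ℍ[ℝ]ᵐᵒᵖ] P),
        IsPontryaginSpace B κ ∧ IsCoisometry B V ∧ IsBoundedToColumns B C ∧
        IsAdjointToColumns B C C' ∧ IsObservable C V ∧
        ∀ p ∈ 𝒱, IsUnit (spherePencil V p) ∧
          ∀ h : Fin N → ℍ[ℝ],
            φ p *ᵥ h = (1 / 2 : ℝ) • starCayley C V p (C' (J *ᵥ h))
              + (1 / 2 : ℝ) • ((φ 0 - J * (φ 0)ᴴ * J) *ᵥ h)) ∧
    (J = 1 → GeneralizedCaratheodory 0 J 𝒱 φ →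
      ∃ Φ : ℍ[ℝ] → Matrix (Fin N) (Fin N) ℍ[ℝ],
        MatrixSliceHyperholomorphicOn Φ (Metric.ball (0 : ℍ[ℝ]) 1) ∧ Set.EqOn Φ φ 𝒱) := by
  have h𝒱 : 𝒱 ∈ 𝓝 (0 : ℍ[ℝ]) := h𝒱_open.mem_nhds h𝒱_zero
  refine ⟨⟨fun hGC => ?_, ?_⟩, fun _ hGC =>
    exists_sliceHyperholomorphic_extension hJ h𝒱 h𝒱_ball hGC⟩
  · obtain ⟨E, _, _, _, _, _, B, e, k, V, V', h⟩ := exists_isShiftModel hJ.1 h𝒱 h𝒱_ball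
      (fun i j => (hφ i j).1.continuousOn) hGC.2
    exact ⟨E, inferInstance, inferInstance, B, V, h.eval 0, k 0, h.model.isPontryaginSpace,
      ⟨h.model.isBoundedEnd h.continuous_operator, V', h.adjoint, h.coisometry⟩,
      h.model.isBoundedToColumns (h.model.continuous_of_isAdjointToColumns (h.isAdjoint_eval 0)),
      h.isAdjoint_eval 0, h.isObservable h𝒱_open h𝒱_ball, fun p hp =>
      ⟨h.isUnit_spherePencil h𝒱_open h𝒱_ball hp, fun c =>
        h.realization hJ.2 h𝒱_open h𝒱_ball h𝒱_zero hp c⟩⟩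
  · rintro ⟨P, _, _, B, V, C, C', hP, ⟨-, V', hV, hVV'⟩, -, hC, hobs, hreal⟩
    exact ⟨hφ, hP.hasNegativeSquares_of_realization hJ h𝒱 h𝒱_ball hV hVV' hC hobs hreal⟩

end
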